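/- Let $G_1, G_2$ be finitely generated groups, let $H$ be a finite group, and let $i_1\colon H\to G_1$, $i_2\colon H\to G_2$ be injective homomorphisms such that each $i_j(H)$ is almost normal in $G_j$, i.e. its normalizer in $G_j$ has finite index. Let $G_1 *_H G_2$ be the amalgamated free product, that is, the quotient of the free product $G_1*G_2$ by the normal closure of $\{i_1(h)i_2(h)^{-1} : h\in H\}$. Then: (HS) if $G_1$ and $G_2$ are flexibly Hilbert–Schmidt stable, then so is $G_1*_H G_2$; (P) if $G_1$ and $G_2$ are flexibly stable in permutations, then so is $G_1*_H G_2$. Here flexible stability is defined as follows. For an operator $A$ on a nonzero finite-dimensional complex Hilbert space $X$ put $\|A\|_{HS,X} = \left(\frac{1}{\dim X}\mathrm{Tr}(A^*A)\right)^{1/2}$. A group $G$ is *flexibly Hilbert–Schmidt stable* if for every sequence of nonzero finite-dimensional complex Hilbert spaces $X_n$ and every sequence of maps $\varphi_n\colon G\to U(X_n)$ into their unitary groups such that $\|\varphi_n(a)\varphi_n(b)-\varphi_n(ab)\|_{HS,X_n}\to 0$ for all $a,b\in G$, there exist finite-dimensional Hilbert spaces $Y_n\supseteq X_n$ and homomorphisms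 $\psi_n\colon G\to U(Y_n)$ such that $\dim Y_n/\dim X_n\to 1$ and $\|\varphi_n(a)-p_n\psi_n(a)p_n\|_{HS,X_n}\to 0$ for all $a\in G$, where $p_n$ is the orthogonal projection of $Y_n$ onto $X_n$ and $p_n\psi_n(a)p_n$ is regarded as an operator on $X_n$. A group $G$ is *flexibly stable in permutations* if for every sequence of nonempty finite sets $X_n$ and every sequence of maps $\varphi_n\colon G\to \mathrm{Sym}(X_n)$ such that $\frac{1}{|X_n|}\#\{x\in X_n : \varphi_n(a)\varphi_n(b)(x)\neq\varphi_n(ab)(x)\}\to 0$ for all $a,b\in G$, there exist finite sets $Y_n\supseteq X_n$ and homomorphisms $\psi_n\colon G\to\mathrm{Sym}(Y_n)$ such that $|Y_n|/|X_n|\to 1$ and $\frac{1}{|X_n|}\#\{x\in X_n : \varphi_n(a)(x)\neq\psi_n(a)(x)\}\to 0$ for all $a\in G$. -/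

import Mathlib

open Filter Topology

noncomputable section

/-- A subgroup `K` of `G` is almost normal if its normalizer has finite index in `G`, i.e. if `K`
has only finitely many conjugates. -/
def IsAlmostNormal {G : Type*} [Group G] (K : Subgroup G) : Prop :=
  (Subgroup.normalizer (K : Set G)).FiniteIndex

/-- The amalgamated free product `G₁ *_H G₂` along `i₁ : H → G₁` and `i₂ : H → G₂`: the quotient of
the free product `G₁ * G₂` by the normal closure of the elements `i₁(h) i₂(h)⁻¹`, `h ∈ H`. -/
abbrev AmalgamatedProduct {H G₁ G₂ : Type*} [Group H] [Group G₁] [Group G₂]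
    (i₁ : H →* G₁) (i₂ : H →* G₂) : Type _ :=
  Monoid.Coprod G₁ G₂ ⧸ Subgroup.normalClosure
    (Set.range fun h : H =>
      (Monoid.Coprod.inl (i₁ h) * (Monoid.Coprod.inr (i₂ h))⁻¹ : Monoid.Coprod G₁ G₂))

/-- The normalized number of points of the finite set `X` at which two maps out of `X` differ. For
permutations of `X` this is the normalized Hamming distance. -/
def hammDist {X Z : Type*} (f g : X → Z) : ℝ :=
  (Nat.card {x : X // f x ≠ g x} : ℝ) / (Nat.card X : ℝ)

/-- Flexible stability in permutations. The inclusion `X n ⊆ Y n` of finite sets is the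
embedding `ι n`. -/
def IsFlexiblyPStable (G : Type*) [Group G] : Prop :=
  ∀ (X : ℕ → Type) [∀ n, Finite (X n)] [∀ n, Nonempty (X n)]
    (φ : ∀ n, G → Equiv.Perm (X n)),
    (∀ a b : G, Tendsto
      (fun n => hammDist (φ n a * φ n b : Equiv.Perm (X n)) (φ n (a * b))) atTop (𝓝 0)) →
    ∃ (Y : ℕ → Type) (_ : ∀ n, Finite (Y n)) (ι : ∀ n, X n ↪ Y n)
      (ψ : ∀ n, G →* Equiv.Perm (Y n)),
      (∀ a : G, Tendsto
        (fun n => hammDist (fun x => ι n (φ n a x)) (fun x => ψ n a (ι n x))) atTop (𝓝 0)) ∧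
      Tendsto (fun n => (Nat.card (Y n) : ℝ) / (Nat.card (X n) : ℝ)) atTop (𝓝 1)

/-- The normalized Hilbert–Schmidt norm `tr(A* A)^(1/2)`, with `tr` the normalized trace, of an
operator on a finite-dimensional complex Hilbert space. -/
def hsNorm {X : Type*} [NormedAddCommGroup X] [InnerProductSpace ℂ X] [FiniteDimensional ℂ X]
    (A : X →ₗ[ℂ] X) : ℝ :=
  √((LinearMap.trace ℂ X (LinearMap.adjoint A ∘ₗ A)).re / (Module.finrank ℂ X : ℝ))

/-- The underlying linear operator of a unitary. -/
def unitaryOp {X : Type*} [NormedAddCommGroup X] [InnerProductSpace ℂ X]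
    (u : X ≃ₗᵢ[ℂ] X) : X →ₗ[ℂ] X :=
  u.toLinearEquiv.toLinearMap

/-- The compression `p B p` of an operator `B` on `Y` to the subspace `X ⊆ Y` (the inclusion being
the isometry `ι`), regarded as an operator on `X`; here `p` is the orthogonal projection onto `X`,
which as a map `Y → X` is the adjoint of `ι`. -/
def compression {X Y : Type*} [NormedAddCommGroup X] [InnerProductSpace ℂ X]
    [FiniteDimensional ℂ X] [NormedAddCommGroup Y] [InnerProductSpace ℂ Y]
    [FiniteDimensional ℂ Y] (ι : X →ₗᵢ[ℂ] Y) (B : Y →ₗ[ℂ] Y) : X →ₗ[ℂ] X :=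
  LinearMap.adjoint ι.toLinearMap ∘ₗ B ∘ₗ ι.toLinearMap

/-- Flexible Hilbert–Schmidt stability. The inclusion `X n ⊆ Y n` of finite-dimensional Hilbert
spaces is the linear isometry `ι n`. -/
def IsFlexiblyHSStable (G : Type*) [Group G] : Prop :=
  ∀ (X : ℕ → Type) [∀ n, NormedAddCommGroup (X n)] [∀ n, InnerProductSpace ℂ (X n)]
    [∀ n, FiniteDimensional ℂ (X n)] [∀ n, Nontrivial (X n)]
    (φ : ∀ n, G → (X n ≃ₗᵢ[ℂ] X n)),
    (∀ a b : G, Tendsto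
      (fun n => hsNorm (unitaryOp (φ n a * φ n b) - unitaryOp (φ n (a * b)))) atTop (𝓝 0)) →
    ∃ (Y : ℕ → Type) (_ : ∀ n, NormedAddCommGroup (Y n)) (_ : ∀ n, InnerProductSpace ℂ (Y n))
      (_ : ∀ n, FiniteDimensional ℂ (Y n)) (ι : ∀ n, X n →ₗᵢ[ℂ] Y n)
      (ψ : ∀ n, G →* (Y n ≃ₗᵢ[ℂ] Y n)),
      (∀ a : G, Tendsto
        (fun n => hsNorm (unitaryOp (φ n a) - compression (ι n) (unitaryOp (ψ n a))))
        atTop (𝓝 0)) ∧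
      Tendsto (fun n => (Module.finrank ℂ (Y n) : ℝ) / (Module.finrank ℂ (X n) : ℝ)) atTop (𝓝 1)

end

/-! The image of `H` in each factor is finite with finitely many conjugates, so by Dietzmann's lemma
it lies in a finite normal subgroup `F` (`IsAlmostNormal.exists_finite_normal`). Normality makes
restriction to `H` rigid. A finite action of the factor splits according to the conjugacy orbit of
the stabilizer in `F`, a unitary representation according to the scalars by which the class sums of
`F` act. The type of a piece over `H` (its point counts by stabilizer, or its character) is its size
times a vector `c r` from a finite list that does not depend on the action (`exists_perm_rays`,
`exists_unitary_rays`).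

An approximate homomorphism of the amalgam on `X` restricts to both factors, and their stability
gives genuine actions on spaces barely larger than `X`. Over `H` both are close to the same maps, so
their types `∑ u r • c₁ r` and `∑ v r • c₂ r` differ by little compared with the size of `X`. The
arithmetic core, `exists_seq_balance`, makes such a near-equality exact by dropping and adding
pieces of negligible total size. It uses that types lie in a discrete group: integer-valued
functions, or virtual characters. Compactness produces a real relation among the pieces of positive
density, Dirichlet approximation makes it integral, and a positive integral relation allows any
defect to be cancelled at proportional cost. Dropped pieces are not removed but made trivial, so
that `X` still embeds; the other side receives as many trivial points or dimensions.

With equal types the two actions are isomorphic over `H`, and the isomorphism can be chosen almost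
compatible with the embeddings of `X`. For permutations, the partial identification of the two
copies of `X` extends equivariantly (`exists_equivariant_extension`). For unitaries, it is averaged
over `H` and the result is replaced by a nearby unitary intertwiner
(`exists_unitary_intertwiner_near`). Transporting the first action along the isomorphism makes both
agree on `H`, so they glue to an action of the amalgam. It is close to the given maps on both
factors, hence on all products. -/

/-! ### Integral relations -/

/-- Simultaneous Dirichlet approximation, in qualitative form. -/
theorem exists_nat_mul_near_int {ι : Type*} [Fintype ι] (w : ι → ℝ) {ε : ℝ} (hε : 0 < ε) :
    ∃ q : ℕ, 0 < q ∧ ∃ m : ι → ℤ, ∀ i, |q * w i - m i| < ε := by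
  have hmem : ∀ n : ℕ, (fun i => Int.fract ((n : ℝ) * w i)) ∈ Set.Icc (0 : ι → ℝ) 1 := fun n =>
    ⟨fun i => Int.fract_nonneg _, fun i => (Int.fract_lt_one _).le⟩
  obtain ⟨a, -, φ, hφ, ha⟩ := isCompact_Icc.tendsto_subseq hmem
  obtain ⟨N, hN⟩ := Metric.cauchySeq_iff'.1 ha.cauchySeq ε hε
  -- Two close terms of a convergent subsequence of fractional parts: the difference of their
  -- indices is the required denominator.
  have h1 := hN (N + 1) (Nat.le_succ N)
  have hlt : φ N < φ (N + 1) := hφ (Nat.lt_succ_self N)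
  refine ⟨φ (N + 1) - φ N, Nat.sub_pos_of_lt hlt,
    fun i => ⌊(φ (N + 1) : ℝ) * w i⌋ - ⌊(φ N : ℝ) * w i⌋, fun i => ?_⟩
  have h2 := lt_of_le_of_lt (dist_le_pi_dist _ _ i) h1
  simp only [Function.comp, Real.dist_eq, Int.fract] at h2
  rw [Nat.cast_sub hlt.le]
  push_cast
  rw [sub_mul, sub_sub_sub_comm]
  exact h2

/-- Finitely many balls of radius `ρ / 2` cover the given ball, and two elements of `Λ` in the same
small ball differ by an element of norm less than `ρ`, so they coincide. -/
theorem finite_discrete_inter_closedBall {E : Type*} [NormedAddCommGroup E] [NormedSpace ℝ E]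
    [FiniteDimensional ℝ E] (Λ : AddSubgroup E) {ρ : ℝ} (hρ : 0 < ρ)
    (hΛ : ∀ l ∈ Λ, ‖l‖ < ρ → l = 0) (B : ℝ) : {f : E | f ∈ Λ ∧ ‖f‖ ≤ B}.Finite := by
  have : ProperSpace E := FiniteDimensional.proper ℝ E
  obtain ⟨t, ht, hcov⟩ := Metric.totallyBounded_iff.1
    (isCompact_closedBall (0 : E) B).totallyBounded (ρ / 2) (by positivity)
  have hex : ∀ f : E, ∃ y, ‖f‖ ≤ B → y ∈ t ∧ dist f y < ρ / 2 := by
    intro f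
    by_cases hf : ‖f‖ ≤ B
    · have := hcov (mem_closedBall_zero_iff.2 hf)
      simp only [Set.mem_iUnion, Metric.mem_ball, exists_prop] at this
      obtain ⟨y, hy⟩ := this
      exact ⟨y, fun _ => hy⟩
    · exact ⟨0, fun h => absurd h hf⟩
  choose y hy using hex
  refine Set.Finite.of_injOn (f := y) (t := t) (fun f hf => (hy f hf.2).1) ?_ ht
  intro f hf g hg hfg
  rw [← sub_eq_zero]
  refine hΛ _ (Λ.sub_mem hf.1 hg.1) ?_
  rw [← dist_eq_norm]
  have h1 := (hy f hf.2).2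
  have h2 := (hy g hg.2).2
  rw [← hfg] at h2
  linarith [dist_triangle_right f g (y f)]

/-- A real relation with positive coefficients can be replaced by an integral one. -/
theorem exists_integral_relation {R E : Type*} [Fintype R] [NormedAddCommGroup E]
    [NormedSpace ℝ E] (c : R → E) (D : R → AddSubmonoid ℕ)
    (Λ : AddSubgroup E) {ρ : ℝ} (hρ : 0 < ρ) (hΛ : ∀ l ∈ Λ, ‖l‖ < ρ → l = 0)
    (hD : ∀ r, ∀ n ∈ D r, (n : ℝ) • c r ∈ Λ) (w : R → ℝ) (hw : ∀ r, 0 < w r)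
    (hrel : ∑ r, w r • c r = 0) (ht : ∀ r, ∃ t ∈ D r, 0 < t) :
    ∃ P : R → ℕ, (∀ r, P r ∈ D r) ∧ (∀ r, 0 < P r) ∧ ∑ r, (P r : ℝ) • c r = 0 := by
  choose t htD ht0 using ht
  set A : ℝ := ∑ r, ‖(t r : ℝ) • c r‖ with hA
  have hA0 : 0 ≤ A := Finset.sum_nonneg fun r _ => norm_nonneg _
  -- The first bound makes the final sum, an element of `Λ`, too short to be nonzero; the second
  -- keeps the approximating integers positive. Approximating `w r / t r` instead of `w r` leaves
  -- room to multiply by `t r`, which puts the coefficients in `D r`.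
  obtain ⟨ε, hε, hεA, hεw⟩ : ∃ ε > 0, ε * A < ρ ∧ ∀ r, ε ≤ w r / t r := by
    have hpos : ∀ r, 0 < w r / t r := fun r => div_pos (hw r) (by exact_mod_cast ht0 r)
    have h1 : ∃ ε₁ > 0, ∀ r, ε₁ ≤ w r / t r := by
      rcases isEmpty_or_nonempty R with hR | hR
      · exact ⟨1, one_pos, fun r => hR.elim r⟩
      · obtain ⟨r₀, hr₀⟩ := Finite.exists_min (fun r => w r / t r)
        exact ⟨_, hpos r₀, hr₀⟩
    obtain ⟨ε₁, hε₁, h1⟩ := h1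
    refine ⟨min ε₁ (ρ / (A + 1)), lt_min hε₁ (by positivity), ?_, fun r => (min_le_left _ _).trans (h1 r)⟩
    calc min ε₁ (ρ / (A + 1)) * A ≤ ρ / (A + 1) * A := by gcongr; exact min_le_right _ _
      _ < ρ := by
        rw [div_mul_eq_mul_div, div_lt_iff₀ (by positivity)]
        nlinarith
  obtain ⟨q, hq, m, hm⟩ := exists_nat_mul_near_int (fun r => w r / t r) hε
  have hm0 : ∀ r, 0 < m r := fun r => by
    have h1 := (abs_lt.1 (hm r)).2
    have h2 : w r / t r ≤ q * (w r / t r) :=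
      le_mul_of_one_le_left (hε.le.trans (hεw r)) (by exact_mod_cast hq)
    have : (0 : ℝ) < m r := by linarith [hεw r]
    exact_mod_cast this
  have hcast : ∀ r, (((m r).toNat : ℕ) : ℝ) = m r := fun r => by
    exact_mod_cast Int.toNat_of_nonneg (hm0 r).le
  have hmem : ∀ r, (m r).toNat * t r ∈ D r := fun r => by
    simpa using (D r).nsmul_mem (htD r) (m r).toNat
  refine ⟨fun r => (m r).toNat * t r, hmem, fun r => Nat.mul_pos (by have := hm0 r; omega) (ht0 r), ?_⟩
  refine hΛ _ (Λ.sum_mem fun r _ => hD r _ (hmem r)) (lt_of_le_of_lt ?_ hεA)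
  have h0 : ∑ r, (((m r).toNat * t r : ℕ) : ℝ) • c r
      = ∑ r, (m r - q * (w r / t r)) • ((t r : ℝ) • c r) := by
    have h3 : ∑ r, ((q : ℝ) * (w r / t r)) • ((t r : ℝ) • c r) = 0 := by
      rw [← smul_zero (q : ℝ), ← hrel, Finset.smul_sum]
      refine Finset.sum_congr rfl fun r _ => ?_
      have : (t r : ℝ) ≠ 0 := by exact_mod_cast (ht0 r).ne'
      rw [smul_smul, smul_smul]
      congr 1
      field_simp
    simp_rw [sub_smul]
    rw [Finset.sum_sub_distrib, h3, sub_zero]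
    refine Finset.sum_congr rfl fun r _ => ?_
    rw [Nat.cast_mul, hcast, mul_smul]
  rw [h0, hA, Finset.mul_sum]
  refine (norm_sum_le _ _).trans (Finset.sum_le_sum fun r _ => ?_)
  rw [norm_smul]
  gcongr
  rw [Real.norm_eq_abs, abs_sub_comm]
  exact (hm r).le

/-- In the presence of a positive integral relation, every integral combination can be cancelled by
adding one of comparable size. -/
theorem exists_cancel_of_relation {R E : Type*} [Fintype R] [NormedAddCommGroup E]
    [NormedSpace ℝ E] [FiniteDimensional ℝ E] (c : R → E) (D : R → AddSubmonoid ℕ)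
    (Λ : AddSubgroup E) {ρ : ℝ} (hρ : 0 < ρ) (hΛ : ∀ l ∈ Λ, ‖l‖ < ρ → l = 0)
    (hD : ∀ r, ∀ n ∈ D r, (n : ℝ) • c r ∈ Λ) (P : R → ℕ) (hPD : ∀ r, P r ∈ D r)
    (hP : ∀ r, 0 < P r) (hrel : ∑ r, (P r : ℝ) • c r = 0) :
    ∃ C : ℝ, 0 ≤ C ∧ ∀ u : R → ℕ, (∀ r, u r ∈ D r) → ∃ α : R → ℕ, (∀ r, α r ∈ D r) ∧
      ∑ r, (u r : ℝ) • c r + ∑ r, (α r : ℝ) • c r = 0 ∧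
      ∑ r, (α r : ℝ) ≤ C * (‖∑ r, (u r : ℝ) • c r‖ + 1) := by
  -- every combination can be cancelled
  have hcancel : ∀ u : R → ℕ, (∀ r, u r ∈ D r) → ∃ α : R → ℕ, (∀ r, α r ∈ D r) ∧
      ∑ r, (u r : ℝ) • c r + ∑ r, (α r : ℝ) • c r = 0 := by
    intro u hu
    -- Adding `(m - 1) * u r` turns `u r` into `m * u r`, a multiple of `P r`. It is then topped up
    -- to `K * P r` with the same `K` for all `r`, which is a multiple of the relation.
    set m : ℕ := ∏ r, P r with hm
    have hm0 : 0 < m := Finset.prod_pos fun r _ => hP r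
    have hdvd : ∀ r, P r ∣ m := fun r => Finset.dvd_prod_of_mem _ (Finset.mem_univ r)
    set K : ℕ := ∑ r, m / P r * u r with hK
    have hle : ∀ r, m / P r * u r ≤ K := fun r =>
      Finset.single_le_sum (f := fun r => m / P r * u r) (fun _ _ => Nat.zero_le _)
        (Finset.mem_univ r)
    refine ⟨fun r => (m - 1) * u r + (K - m / P r * u r) * P r, fun r => ?_, ?_⟩
    · exact (D r).add_mem (by simpa using (D r).nsmul_mem (hu r) (m - 1))
        (by simpa using (D r).nsmul_mem (hPD r) (K - m / P r * u r))
    · rw [← Finset.sum_add_distrib, ← smul_zero (K : ℝ), ← hrel, Finset.smul_sum]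
      refine Finset.sum_congr rfl fun r _ => ?_
      rw [← add_smul, smul_smul]
      congr 1
      have h1 : ((m / P r : ℕ) : ℝ) * P r = m := by exact_mod_cast Nat.div_mul_cancel (hdvd r)
      push_cast [Nat.cast_sub (hle r), Nat.cast_sub (Nat.succ_le_of_lt hm0)]
      linear_combination (-(u r : ℝ)) * h1
  -- a bounded section of the linear map
  obtain ⟨Cs, hCs0, hCs⟩ : ∃ Cs : ℝ, 0 ≤ Cs ∧ ∀ u : R → ℝ, ∃ z : R → ℝ,
      ∑ r, z r • c r = ∑ r, u r • c r ∧ ∀ r, |z r| ≤ Cs * ‖∑ r, u r • c r‖ := by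
    let A : (R → ℝ) →ₗ[ℝ] E := Fintype.linearCombination ℝ c
    obtain ⟨s, hs⟩ := A.rangeRestrict.exists_rightInverse_of_surjective A.range_rangeRestrict
    let s' : A.range →L[ℝ] (R → ℝ) := LinearMap.toContinuousLinearMap s
    refine ⟨‖s'‖, s'.opNorm_nonneg, fun u => ⟨s ⟨A u, LinearMap.mem_range_self _ _⟩, ?_, fun r => ?_⟩⟩
    · have := congrArg Subtype.val (LinearMap.congr_fun hs ⟨A u, LinearMap.mem_range_self _ _⟩)
      simpa [A, Fintype.linearCombination_apply] using this
    · have h1 := s'.le_opNorm ⟨A u, LinearMap.mem_range_self _ _⟩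
      exact (norm_le_pi_norm (s' ⟨A u, LinearMap.mem_range_self _ _⟩) r).trans h1
  set B : ℝ := ∑ r, P r * ‖c r‖ with hB
  -- the finitely many bounded remainders
  have hfin := finite_discrete_inter_closedBall Λ hρ hΛ B
  obtain ⟨M, hM0, hM⟩ : ∃ M : ℝ, 0 ≤ M ∧ ∀ u : R → ℕ, (∀ r, u r ∈ D r) →
      ‖∑ r, (u r : ℝ) • c r‖ ≤ B → ∃ α : R → ℕ, (∀ r, α r ∈ D r) ∧
      ∑ r, (u r : ℝ) • c r + ∑ r, (α r : ℝ) • c r = 0 ∧ ∑ r, (α r : ℝ) ≤ M := by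
    have hch : ∀ f : E, ∃ α : R → ℕ, (∃ u : R → ℕ, (∀ r, u r ∈ D r) ∧ ∑ r, (u r : ℝ) • c r = f) →
        (∀ r, α r ∈ D r) ∧ f + ∑ r, (α r : ℝ) • c r = 0 := by
      intro f
      by_cases h : ∃ u : R → ℕ, (∀ r, u r ∈ D r) ∧ ∑ r, (u r : ℝ) • c r = f
      · obtain ⟨u, hu, rfl⟩ := h
        obtain ⟨α, hα⟩ := hcancel u hu
        exact ⟨α, fun _ => hα⟩
      · exact ⟨0, fun h' => absurd h' h⟩
    choose α hα using hch
    refine ⟨∑ f ∈ hfin.toFinset, ∑ r, (α f r : ℝ), by positivity, fun u hu hub =>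
      ⟨α _, (hα _ ⟨u, hu, rfl⟩).1, (hα _ ⟨u, hu, rfl⟩).2, ?_⟩⟩
    refine Finset.single_le_sum (f := fun f => ∑ r, (α f r : ℝ)) (fun _ _ => by positivity) ?_
    rw [Set.Finite.mem_toFinset]
    exact ⟨Λ.sum_mem fun r _ => hD r _ (hu r), hub⟩
  refine ⟨∑ r, (P r * (2 * Cs) + P r : ℝ) + M, by positivity, fun u hu => ?_⟩
  set e : E := ∑ r, (u r : ℝ) • c r with he
  obtain ⟨z, hz, hzb⟩ := hCs fun r => (u r : ℝ)
  rw [← he] at hz hzb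
  -- The real vector `-z` cancels the defect; adding `K` times the relation makes it nonnegative
  -- without changing its value.
  set K : ℕ := ⌈Cs * ‖e‖⌉₊ with hK
  have hKz : ∀ r, 0 ≤ K * P r - z r := fun r => by
    have h1 : z r ≤ K := (le_abs_self _).trans ((hzb r).trans (Nat.le_ceil _))
    have h2 : (1 : ℝ) ≤ P r := by exact_mod_cast hP r
    nlinarith [(Nat.cast_nonneg K : (0 : ℝ) ≤ K)]
  have hP' : ∀ r, (0 : ℝ) < P r := fun r => by exact_mod_cast hP r
  -- Rounding down to multiples of `P r` stays in `D r` and costs at most `P r` in each coordinate,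
  -- so the remaining defect is at most `B` and is one of the finitely many already handled.
  set κ : R → ℕ := fun r => ⌊(K * P r - z r) / P r⌋₊ with hκ
  have hκ1 : ∀ r, (κ r : ℝ) * P r ≤ K * P r - z r := fun r => by
    rw [← le_div_iff₀ (hP' r)]
    exact Nat.floor_le (div_nonneg (hKz r) (hP' r).le)
  have hκ2 : ∀ r, K * P r - z r ≤ (κ r : ℝ) * P r + P r := fun r => by
    have := (Nat.lt_floor_add_one ((K * P r - z r) / P r)).le
    rw [div_le_iff₀ (hP' r)] at this
    linarith
  have hκD : ∀ r, κ r * P r ∈ D r := fun r => by simpa using (D r).nsmul_mem (hPD r) (κ r)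
  have hbound : ‖∑ r, ((u r + κ r * P r : ℕ) : ℝ) • c r‖ ≤ B := by
    have h1 : ∑ r, ((u r + κ r * P r : ℕ) : ℝ) • c r
        = ∑ r, ((κ r : ℝ) * P r - (K * P r - z r)) • c r := by
      have h2 : ∑ r, ((K : ℝ) * P r) • c r = 0 := by
        simp_rw [mul_smul]
        rw [← Finset.smul_sum, hrel, smul_zero]
      simp_rw [sub_smul, Nat.cast_add, add_smul, Finset.sum_sub_distrib, Finset.sum_add_distrib]
      rw [h2, hz, ← he]
      push_cast
      abel
    rw [h1]
    refine (norm_sum_le _ _).trans (Finset.sum_le_sum fun r _ => ?_)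
    rw [norm_smul, Real.norm_eq_abs]
    gcongr
    rw [abs_le]
    constructor <;> linarith [hκ1 r, hκ2 r, (hP' r).le]
  obtain ⟨β, hβD, hβ, hβM⟩ := hM (fun r => u r + κ r * P r) (fun r => (D r).add_mem (hu r) (hκD r)) hbound
  refine ⟨fun r => κ r * P r + β r, fun r => (D r).add_mem (hκD r) (hβD r), ?_, ?_⟩
  · rw [← hβ, he, ← Finset.sum_add_distrib, ← Finset.sum_add_distrib]
    refine Finset.sum_congr rfl fun r _ => ?_
    rw [← add_smul, ← add_smul]
    push_cast
    congr 1
    ring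
  · have hKle : (K : ℝ) ≤ Cs * ‖e‖ + 1 := (Nat.ceil_lt_add_one (by positivity)).le
    have h1 : ∀ r, (κ r : ℝ) * P r ≤ (P r * (2 * Cs) + P r) * (‖e‖ + 1) := fun r => by
      have h2 := hκ1 r
      have h3 := (abs_le.1 (hzb r)).1
      have h4 : (1 : ℝ) ≤ P r := by exact_mod_cast hP r
      have h5 : 0 ≤ Cs * ‖e‖ := by positivity
      have h6 : (K : ℝ) * P r ≤ (Cs * ‖e‖ + 1) * P r := by gcongr
      have h7 : Cs * ‖e‖ ≤ Cs * ‖e‖ * P r := le_mul_of_one_le_right h5 h4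
      have h8 : (P r : ℝ) ≤ P r * (‖e‖ + 1) := le_mul_of_one_le_right (hP' r).le (by linarith [norm_nonneg e])
      have h9 : 0 ≤ P r * (2 * Cs) := by positivity
      nlinarith
    have h10 : M ≤ M * (‖e‖ + 1) := le_mul_of_one_le_right hM0 (by linarith [norm_nonneg e])
    push_cast
    rw [Finset.sum_add_distrib, add_mul, Finset.sum_mul]
    exact add_le_add (Finset.sum_le_sum fun r _ => h1 r) (hβM.trans h10)

/-- Approximate relations are close to exact ones: an approximate relation `∑ u r • c r ≈ 0` becomes
exact after dropping and adding few terms. -/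
theorem exists_delta_exact_relation {R E : Type*} [Fintype R] [DecidableEq R] [NormedAddCommGroup E]
    [NormedSpace ℝ E] [FiniteDimensional ℝ E] (c : R → E) (D : R → AddSubmonoid ℕ)
    (Λ : AddSubgroup E) {ρ : ℝ} (hρ : 0 < ρ) (hΛ : ∀ l ∈ Λ, ‖l‖ < ρ → l = 0)
    (hD : ∀ r, ∀ n ∈ D r, (n : ℝ) • c r ∈ Λ) {ε : ℝ} (hε : 0 < ε) :
    ∃ δ > 0, ∀ x : ℝ, 0 < x → ∀ u : R → ℕ, (∀ r, u r ∈ D r) → (∀ r, (u r : ℝ) ≤ 2 * x) →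
      ‖∑ r, (u r : ℝ) • c r‖ ≤ δ * x → ∃ (J : Finset R) (α : R → ℕ), (∀ r, α r ∈ D r) ∧
      ∑ r ∈ J, (u r : ℝ) • c r + ∑ r, (α r : ℝ) • c r = 0 ∧
      ∑ r ∈ Jᶜ, (u r : ℝ) + ∑ r, (α r : ℝ) ≤ ε * x := by
  -- Compactness argument: counterexamples for `δ = 1 / (n + 1)` are rescaled by `x n` and a limit
  -- relation is extracted.
  by_contra! hcon
  choose x hx u huD hu2 hus hno using fun n : ℕ =>
    hcon (1 / ((n : ℝ) + 1)) Nat.one_div_pos_of_nat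
  -- the defects are nonzero, so that the sizes tend to infinity
  have hne : ∀ n, ρ ≤ ‖∑ r, (u n r : ℝ) • c r‖ := fun n => by
    by_contra! hlt
    have h0 := hΛ _ (Λ.sum_mem fun r _ => hD r _ (huD n r)) hlt
    have := hno n Finset.univ (fun _ => 0) (fun r => (D r).zero_mem) (by simpa using h0)
    simp only [Finset.compl_univ, Finset.sum_empty, Nat.cast_zero, Finset.sum_const_zero,
      add_zero] at this
    nlinarith [hx n]
  have hxtop : ∀ n : ℕ, ρ * (n + 1) ≤ x n := fun n => by
    have h1 := (hne n).trans (hus n)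
    rw [one_div, inv_mul_eq_div, le_div_iff₀ (by positivity)] at h1
    exact h1
  have hmem : ∀ n, (fun r => (u n r : ℝ) / x n) ∈ Set.Icc (0 : R → ℝ) (fun _ => 2) := fun n =>
    ⟨fun r => div_nonneg (Nat.cast_nonneg _) (hx n).le, fun r => (div_le_iff₀ (hx n)).2 (hu2 n r)⟩
  obtain ⟨w, hwmem, φ, hφ, hw⟩ := isCompact_Icc.tendsto_subseq hmem
  have hwr : ∀ r, Tendsto (fun n => (u (φ n) r : ℝ) / x (φ n)) atTop (𝓝 (w r)) := fun r =>
    (tendsto_pi_nhds.1 hw) r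
  have hw0 : ∀ r, 0 ≤ w r := hwmem.1
  classical
  -- The support of the limit: terms outside it are of lower order and can be dropped, and on it the
  -- limit is a relation with positive coefficients.
  set J : Finset R := Finset.univ.filter fun r => 0 < w r with hJ
  have hJpos : ∀ r ∈ J, 0 < w r := fun r hr => (Finset.mem_filter.1 hr).2
  have hJc : ∀ r, r ∉ J → w r = 0 := fun r hr => by
    simp only [hJ, Finset.mem_filter, Finset.mem_univ, true_and, not_lt] at hr
    exact le_antisymm hr (hw0 r)
  -- partial defects are small
  have hsmall : Tendsto (fun n => 1 / ((φ n : ℝ) + 1)) atTop (𝓝 0) :=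
    tendsto_one_div_add_atTop_nhds_zero_nat.comp hφ.tendsto_atTop
  have hfull : Tendsto (fun n => ∑ r, ((u (φ n) r : ℝ) / x (φ n)) • c r) atTop (𝓝 0) := by
    refine squeeze_zero_norm (fun n => ?_) hsmall
    have h1 : ∑ r, ((u (φ n) r : ℝ) / x (φ n)) • c r
        = (x (φ n))⁻¹ • ∑ r, (u (φ n) r : ℝ) • c r := by
      rw [Finset.smul_sum]
      exact Finset.sum_congr rfl fun r _ => by rw [smul_smul, div_eq_inv_mul]
    rw [h1, norm_smul, norm_inv, Real.norm_of_nonneg (hx _).le, inv_mul_le_iff₀ (hx _), mul_comm]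
    exact hus _
  have hrel : ∑ r, w r • c r = 0 := tendsto_nhds_unique
    (tendsto_finsetSum _ fun r _ => (hwr r).smul_const (c r)) hfull
  have hcompl : Tendsto (fun n => ∑ r ∈ Jᶜ, (u (φ n) r : ℝ) / x (φ n)) atTop (𝓝 0) := by
    have := tendsto_finsetSum Jᶜ fun r _ => hwr r
    rwa [Finset.sum_eq_zero (s := Jᶜ) (f := w) fun r hr => hJc r (Finset.mem_compl.1 hr)] at this
  have hpart : Tendsto (fun n => ∑ r ∈ J, ((u (φ n) r : ℝ) / x (φ n)) • c r) atTop (𝓝 0) := by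
    have h1 := tendsto_finsetSum J fun r _ => (hwr r).smul_const (c r)
    have h2 : ∑ r ∈ J, w r • c r = 0 := by
      rw [← hrel]
      refine Finset.sum_subset (Finset.subset_univ _) fun r _ hr => ?_
      rw [hJc r hr, zero_smul]
    rwa [h2] at h1
  -- apply the cancellation on `J`
  have ht : ∀ r : J, ∃ t ∈ D r, 0 < t := fun r => by
    have h0 := hJpos r r.2
    obtain ⟨n, hn⟩ := ((hwr r).eventually (lt_mem_nhds h0)).exists
    refine ⟨_, huD (φ n) r, Nat.pos_of_ne_zero fun h => ?_⟩
    rw [h] at hn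
    simp at hn
  obtain ⟨P, hPD, hP0, hPrel⟩ := exists_integral_relation (fun r : J => c r) (fun r => D r) Λ hρ hΛ
    (fun r => hD r) (fun r => w r) (fun r => hJpos r r.2)
    (by
      rw [Finset.sum_coe_sort J fun r => w r • c r, ← hrel]
      refine Finset.sum_subset (Finset.subset_univ _) fun r _ hr => ?_
      rw [hJc r hr, zero_smul]) ht
  obtain ⟨C, hC0, hC⟩ := exists_cancel_of_relation (fun r : J => c r) (fun r => D r) Λ hρ hΛ
    (fun r => hD r) P hPD hP0 hPrel
  have hinv : Tendsto (fun n => (x (φ n))⁻¹) atTop (𝓝 0) := by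
    have h1 : Tendsto (fun n => ρ⁻¹ * (1 / ((φ n : ℝ) + 1))) atTop (𝓝 0) := by
      simpa using hsmall.const_mul ρ⁻¹
    refine squeeze_zero (fun n => inv_nonneg.2 (hx _).le) (fun n => ?_) h1
    rw [one_div, ← mul_inv]
    exact inv_anti₀ (by positivity) (hxtop _)
  -- The relative cost of dropping the terms outside `J` and cancelling the rest. The additive
  -- constant in the cancellation bound is absorbed because `x (φ n)` tends to infinity.
  have hlim : Tendsto (fun n => ∑ r ∈ Jᶜ, (u (φ n) r : ℝ) / x (φ n)
      + C * (‖∑ r ∈ J, ((u (φ n) r : ℝ) / x (φ n)) • c r‖ + (x (φ n))⁻¹)) atTop (𝓝 0) := by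
    simpa using hcompl.add ((hpart.norm.add hinv).const_mul C)
  obtain ⟨n, hn⟩ := (hlim.eventually (gt_mem_nhds hε)).exists
  obtain ⟨α, hαD, hα, hαC⟩ := hC (fun r => u (φ n) r) fun r => huD _ _
  set α' : R → ℕ := fun r => if h : r ∈ J then α ⟨r, h⟩ else 0 with hα'
  have hα'J : ∀ r : J, α' r = α r := fun r => by simp [hα']
  have hα'c : ∀ r, r ∉ J → α' r = 0 := fun r hr => by simp [hα', hr]
  have hs1 : ∑ r, (α' r : ℝ) • c r = ∑ r : J, (α r : ℝ) • c r := by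
    rw [← Finset.sum_subset (Finset.subset_univ J), ← Finset.sum_coe_sort J]
    · simp_rw [hα'J]
    · intro r _ hr
      rw [hα'c r hr, Nat.cast_zero, zero_smul]
  have hs2 : ∑ r, (α' r : ℝ) = ∑ r : J, (α r : ℝ) := by
    rw [← Finset.sum_subset (Finset.subset_univ J), ← Finset.sum_coe_sort J]
    · simp_rw [hα'J]
    · intro r _ hr
      rw [hα'c r hr, Nat.cast_zero]
  rw [Finset.sum_coe_sort J fun r => (u (φ n) r : ℝ) • c r] at hα hαC
  refine (hno (φ n) J α' (fun r => ?_) (by rw [hs1]; exact hα)).not_ge ?_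
  · by_cases h : r ∈ J
    · simpa [hα', h] using hαD ⟨r, h⟩
    · rw [hα'c r h]
      exact (D r).zero_mem
  · rw [hs2]
    have h1 : ∑ r ∈ J, ((u (φ n) r : ℝ) / x (φ n)) • c r
        = (x (φ n))⁻¹ • ∑ r ∈ J, (u (φ n) r : ℝ) • c r := by
      rw [Finset.smul_sum]
      exact Finset.sum_congr rfl fun r _ => by rw [smul_smul, div_eq_inv_mul]
    rw [h1, norm_smul, norm_inv, Real.norm_of_nonneg (hx _).le, ← Finset.sum_div] at hn
    have h2 := mul_le_mul_of_nonneg_right hn.le (hx (φ n)).le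
    have h3 := (hx (φ n)).ne'
    calc _ ≤ ∑ r ∈ Jᶜ, (u (φ n) r : ℝ) + C * (‖∑ r ∈ J, (u (φ n) r : ℝ) • c r‖ + 1) := by gcongr
      _ = (((∑ r ∈ Jᶜ, (u (φ n) r : ℝ)) / x (φ n)) + C * ((x (φ n))⁻¹ *
          ‖∑ r ∈ J, (u (φ n) r : ℝ) • c r‖ + (x (φ n))⁻¹)) * x (φ n) := by field_simp
      _ ≤ ε * x (φ n) := h2

/-- The sequential form of `exists_delta_exact_relation`. -/
theorem exists_seq_exact_relation {R E : Type*} [Fintype R] [DecidableEq R] [NormedAddCommGroup E]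
    [NormedSpace ℝ E] [FiniteDimensional ℝ E] (c : R → E) (D : R → AddSubmonoid ℕ)
    (Λ : AddSubgroup E) {ρ : ℝ} (hρ : 0 < ρ) (hΛ : ∀ l ∈ Λ, ‖l‖ < ρ → l = 0)
    (hD : ∀ r, ∀ n ∈ D r, (n : ℝ) • c r ∈ Λ) (x : ℕ → ℝ) (hx : ∀ n, 0 < x n) (u : ℕ → R → ℕ)
    (huD : ∀ n r, u n r ∈ D r) (hu2 : ∀ᶠ n in atTop, ∀ r, (u n r : ℝ) ≤ 2 * x n)
    (hus : Tendsto (fun n => ‖∑ r, (u n r : ℝ) • c r‖ / x n) atTop (𝓝 0)) :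
    ∃ (J : ℕ → Finset R) (α : ℕ → R → ℕ), (∀ n r, α n r ∈ D r) ∧
      (∀ n, ∑ r ∈ J n, (u n r : ℝ) • c r + ∑ r, (α n r : ℝ) • c r = 0) ∧
      Tendsto (fun n => (∑ r ∈ (J n)ᶜ, (u n r : ℝ)) / x n) atTop (𝓝 0) ∧
      Tendsto (fun n => (∑ r, (α n r : ℝ)) / x n) atTop (𝓝 0) := by
  let good : ℕ → Set (Finset R × (R → ℕ)) := fun n => {p | (∀ r, p.2 r ∈ D r) ∧
    ∑ r ∈ p.1, (u n r : ℝ) • c r + ∑ r, (p.2 r : ℝ) • c r = 0}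
  let cost : ℕ → Finset R × (R → ℕ) → ℕ := fun n p => ∑ r ∈ p.1ᶜ, u n r + ∑ r, p.2 r
  -- A cheapest correction for each `n` does at least as well as the one supplied for any `ε`, so no
  -- diagonal argument is needed. Dropping everything is always admissible.
  have hmin : ∀ n, ∃ p ∈ good n, ∀ p' ∈ good n, cost n p ≤ cost n p' := fun n => by
    have hne : (good n).Nonempty := ⟨(∅, 0), fun r => (D r).zero_mem, by simp⟩
    exact ⟨Function.argminOn (cost n) (good n) hne, Function.argminOn_mem _ _ _,
      fun p' hp' => Function.argminOn_le _ _ hp'⟩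
  choose p hp hpmin using hmin
  have hcost : Tendsto (fun n => (cost n (p n) : ℝ) / x n) atTop (𝓝 0) := by
    rw [Metric.tendsto_atTop']
    intro ε hε
    obtain ⟨δ, hδ, h⟩ := exists_delta_exact_relation c D Λ hρ hΛ hD (half_pos hε)
    obtain ⟨N, hN⟩ := eventually_atTop.1 (hu2.and (hus.eventually (gt_mem_nhds hδ)))
    refine ⟨N, fun n hn => ?_⟩
    obtain ⟨h1, h2⟩ := hN n hn.le
    rw [div_lt_iff₀ (hx n)] at h2
    obtain ⟨J, α, hα, hJα, hle⟩ := h (x n) (hx n) (u n) (huD n) h1 h2.le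
    have h3 : (cost n (p n) : ℝ) ≤ cost n (J, α) := by exact_mod_cast hpmin n (J, α) ⟨hα, hJα⟩
    have h4 : (cost n (J, α) : ℝ) ≤ ε / 2 * x n := by simpa [cost] using hle
    rw [Real.dist_eq, sub_zero, abs_of_nonneg (div_nonneg (Nat.cast_nonneg _) (hx n).le),
      div_lt_iff₀ (hx n)]
    nlinarith [hx n]
  refine ⟨fun n => (p n).1, fun n => (p n).2, fun n => (hp n).1, fun n => (hp n).2, ?_, ?_⟩
  · refine squeeze_zero (fun n => div_nonneg (by positivity) (hx n).le) (fun n => ?_) hcost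
    have := (hx n).le
    gcongr
    simp only [cost]
    push_cast
    exact le_add_of_nonneg_right (by positivity)
  · refine squeeze_zero (fun n => div_nonneg (by positivity) (hx n).le) (fun n => ?_) hcost
    have := (hx n).le
    gcongr
    simp only [cost]
    push_cast
    exact le_add_of_nonneg_left (by positivity)

/-- The two-sided form of `exists_seq_exact_relation`. -/
theorem exists_seq_balance {R₁ R₂ E : Type*} [Fintype R₁] [DecidableEq R₁] [Fintype R₂]
    [DecidableEq R₂] [NormedAddCommGroup E] [NormedSpace ℝ E] [FiniteDimensional ℝ E]
    (c₁ : R₁ → E) (c₂ : R₂ → E) (D₁ : R₁ → AddSubmonoid ℕ) (D₂ : R₂ → AddSubmonoid ℕ)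
    (Λ : AddSubgroup E) {ρ : ℝ} (hρ : 0 < ρ) (hΛ : ∀ l ∈ Λ, ‖l‖ < ρ → l = 0)
    (hD₁ : ∀ r, ∀ n ∈ D₁ r, (n : ℝ) • c₁ r ∈ Λ) (hD₂ : ∀ r, ∀ n ∈ D₂ r, (n : ℝ) • c₂ r ∈ Λ)
    (x : ℕ → ℝ) (hx : ∀ n, 0 < x n) (u : ℕ → R₁ → ℕ) (v : ℕ → R₂ → ℕ)
    (hu : ∀ n r, u n r ∈ D₁ r) (hv : ∀ n r, v n r ∈ D₂ r)
    (hu2 : ∀ᶠ n in atTop, ∀ r, (u n r : ℝ) ≤ 2 * x n)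
    (hv2 : ∀ᶠ n in atTop, ∀ r, (v n r : ℝ) ≤ 2 * x n)
    (huv : Tendsto (fun n => ‖∑ r, (u n r : ℝ) • c₁ r - ∑ r, (v n r : ℝ) • c₂ r‖ / x n)
      atTop (𝓝 0)) :
    ∃ (J₁ : ℕ → Finset R₁) (J₂ : ℕ → Finset R₂) (α : ℕ → R₁ → ℕ) (β : ℕ → R₂ → ℕ),
      (∀ n r, α n r ∈ D₁ r) ∧ (∀ n r, β n r ∈ D₂ r) ∧
      (∀ n, ∑ r ∈ J₁ n, (u n r : ℝ) • c₁ r + ∑ r, (α n r : ℝ) • c₁ r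
        = ∑ r ∈ J₂ n, (v n r : ℝ) • c₂ r + ∑ r, (β n r : ℝ) • c₂ r) ∧
      Tendsto (fun n => (∑ r ∈ (J₁ n)ᶜ, (u n r : ℝ)) / x n) atTop (𝓝 0) ∧
      Tendsto (fun n => (∑ r ∈ (J₂ n)ᶜ, (v n r : ℝ)) / x n) atTop (𝓝 0) ∧
      Tendsto (fun n => (∑ r, (α n r : ℝ)) / x n) atTop (𝓝 0) ∧
      Tendsto (fun n => (∑ r, (β n r : ℝ)) / x n) atTop (𝓝 0) := by
  obtain ⟨J, α, hα, hrel, hJ, hαx⟩ := exists_seq_exact_relation (R := R₁ ⊕ R₂)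
    -- With the second family negated, an equality between the two sides becomes a single relation.
    (Sum.elim c₁ (-c₂)) (Sum.elim D₁ D₂) Λ hρ hΛ
    (by
      rintro (r | r) n hn
      · exact hD₁ r n hn
      · simpa using hD₂ r n hn) x hx (fun n => Sum.elim (u n) (v n))
    (fun n => by
      rintro (r | r)
      · exact hu n r
      · exact hv n r)
    (by
      filter_upwards [hu2, hv2] with n h1 h2
      rintro (r | r)
      · exact h1 r
      · exact h2 r)
    (by simpa [Fintype.sum_sum_type, sub_eq_add_neg] using huv)
  have hJl : ∀ n, (J n)ᶜ.toLeft = (J n).toLeftᶜ := fun n => by ext; simp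
  have hJr : ∀ n, (J n)ᶜ.toRight = (J n).toRightᶜ := fun n => by ext; simp
  simp_rw [Finset.sum_sum_eq_sum_toLeft_add_sum_toRight, hJl, hJr] at hJ
  simp only [Sum.elim_inl, Sum.elim_inr] at hJ
  simp only [Fintype.sum_sum_type] at hαx
  refine ⟨fun n => (J n).toLeft, fun n => (J n).toRight, fun n r => α n (Sum.inl r),
    fun n r => α n (Sum.inr r), fun n r => hα n (Sum.inl r), fun n r => hα n (Sum.inr r), fun n => ?_, ?_, ?_, ?_, ?_⟩
  · have htl : (Finset.univ : Finset (R₁ ⊕ R₂)).toLeft = Finset.univ := by ext; simp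
    have htr : (Finset.univ : Finset (R₁ ⊕ R₂)).toRight = Finset.univ := by ext; simp
    have := hrel n
    simp only [htl, htr, Finset.sum_sum_eq_sum_toLeft_add_sum_toRight, Sum.elim_inl,
      Sum.elim_inr, Pi.neg_apply, smul_neg, Finset.sum_neg_distrib] at this
    rw [← sub_eq_zero, ← this]
    abel
  all_goals
    first
    | refine squeeze_zero (fun n => div_nonneg (by positivity) (hx n).le) (fun n => ?_) hJ
      have := (hx n).le
      gcongr
      first
      | exact le_add_of_nonneg_right (by positivity)
      | exact le_add_of_nonneg_left (by positivity)
    | refine squeeze_zero (fun n => div_nonneg (by positivity) (hx n).le) (fun n => ?_) hαx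
      have := (hx n).le
      gcongr
      first
      | exact le_add_of_nonneg_right (by positivity)
      | exact le_add_of_nonneg_left (by positivity)

/-! ### Finite almost normal subgroups -/

-- A commutator depends only on the classes of its entries modulo the center, so representatives of
-- the finitely many classes already give all of them.
open scoped commutatorElement in
theorem finite_commutatorSet_of_finiteIndex_center {G : Type*} [Group G]
    [(Subgroup.center G).FiniteIndex] : Finite (commutatorSet G) := by
  have hsub : commutatorSet G ⊆ Set.range
      (fun p : (G ⧸ Subgroup.center G) × (G ⧸ Subgroup.center G) => ⁅p.1.out, p.2.out⁆) := by
    rintro _ ⟨a, b, rfl⟩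
    refine ⟨(a, b), ?_⟩
    obtain ⟨⟨z, hz⟩, h1⟩ := QuotientGroup.mk_out_eq_mul (Subgroup.center G) a
    obtain ⟨⟨w, hw⟩, h2⟩ := QuotientGroup.mk_out_eq_mul (Subgroup.center G) b
    simp only at h1 h2 ⊢
    rw [h1, h2, commutatorElement_def, commutatorElement_def]
    have hz' := Subgroup.mem_center_iff.1 hz
    have hw' := Subgroup.mem_center_iff.1 hw
    have e1 : a * z * (b * w) * (a * z)⁻¹ * (b * w)⁻¹
        = a * (z * b) * w * z⁻¹ * a⁻¹ * (w⁻¹ * b⁻¹) := by group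
    rw [e1, ← hz' b]
    have e2 : a * (b * z) * w * z⁻¹ * a⁻¹ * (w⁻¹ * b⁻¹)
        = a * b * (z * w) * z⁻¹ * a⁻¹ * w⁻¹ * b⁻¹ := by group
    rw [e2, ← hz' w]
    have e3 : a * b * (w * z) * z⁻¹ * a⁻¹ * w⁻¹ * b⁻¹ = a * b * (w * a⁻¹) * w⁻¹ * b⁻¹ := by group
    rw [e3, ← hw' a⁻¹]
    group
  exact (Set.finite_range _).subset hsub

/-- Dietzmann's lemma: a group generated by a finite conjugation-invariant set of torsion elements
is finite. -/
theorem finite_of_closure_conj_invariant {G : Type*} [Group G] (S : Set G) (hS : S.Finite)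
    (hconj : ∀ g : G, ∀ s ∈ S, g * s * g⁻¹ ∈ S) (htor : ∀ s ∈ S, IsOfFinOrder s)
    (hgen : Subgroup.closure S = ⊤) : Finite G := by
  -- Each generator has a finite conjugacy class, so its centralizer has finite index; the center is
  -- the intersection of these finitely many centralizers.
  have hcent : ∀ s ∈ S, (Subgroup.centralizer {s}).FiniteIndex := fun s hs => by
    have horb : (MulAction.orbit (ConjAct G) s).Finite := by
      refine hS.subset ?_
      rintro _ ⟨g, rfl⟩
      exact hconj (ConjAct.ofConjAct g) s hs
    have h1 : (MulAction.stabilizer (ConjAct G) s).FiniteIndex := ⟨by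
      rw [MulAction.index_stabilizer]
      exact (Set.ncard_pos horb).2 (MulAction.nonempty_orbit s) |>.ne'⟩
    rw [ConjAct.stabilizer_eq_centralizer] at h1
    exact h1
  have : Finite S := hS
  have hZ : (Subgroup.center G).FiniteIndex := by
    rw [Subgroup.center_eq_infi' hgen]
    exact Subgroup.finiteIndex_iInf fun s => hcent s s.2
  have : Finite (commutatorSet G) := finite_commutatorSet_of_finiteIndex_center
  have : Group.FG G := Group.fg_iff.2 ⟨S, hgen, hS⟩
  have : Group.FG (Abelianization G) := Group.fg_of_surjective (f := Abelianization.of)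
    (QuotientGroup.mk'_surjective _)
  -- The commutator subgroup is finite by Schur's theorem. It remains to treat the abelianization,
  -- which is finitely generated and torsion.
  have htA : IsMulTorsion (Abelianization G) := by
    have htop : (⊤ : Subgroup G) ≤ (CommGroup.torsion (Abelianization G)).comap Abelianization.of := by
      rw [← hgen, Subgroup.closure_le]
      intro s hs
      exact MonoidHom.isOfFinOrder _ (htor s hs)
    intro x
    obtain ⟨g, rfl⟩ := QuotientGroup.mk'_surjective _ x
    exact htop (Subgroup.mem_top g)
  have : Finite (G ⧸ commutator G) := CommGroup.finite_of_fg_isMulTorsion (G := Abelianization G) htA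
  exact Finite.of_subgroup_quotient (commutator G)

/-- A finite almost normal subgroup is contained in a finite normal subgroup. -/
theorem IsAlmostNormal.exists_finite_normal {G : Type*} [Group G] {K : Subgroup G} [Finite K]
    (hK : IsAlmostNormal K) : ∃ F : Subgroup G, F.Normal ∧ Finite F ∧ K ≤ F := by
  have : (Subgroup.normalizer (K : Set G)).FiniteIndex := hK
  -- Representatives of the cosets of the normalizer produce all conjugates. These generate the
  -- normal closure and are torsion, so Dietzmann's lemma applies.
  have hfin : (Group.conjugatesOfSet (K : Set G)).Finite := by
    have hsub : Group.conjugatesOfSet (K : Set G) ⊆ Set.range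
        (fun p : (G ⧸ Subgroup.normalizer (K : Set G)) × K => p.1.out * p.2 * p.1.out⁻¹) := by
      intro x hx
      obtain ⟨k, hk, hkx⟩ := Group.mem_conjugatesOfSet_iff.1 hx
      obtain ⟨g, rfl⟩ := isConj_iff.1 hkx
      obtain ⟨⟨z, hz⟩, h1⟩ := QuotientGroup.mk_out_eq_mul (Subgroup.normalizer (K : Set G)) g
      have hk' : z⁻¹ * k * z⁻¹⁻¹ ∈ K :=
        (Subgroup.mem_normalizer_iff.1 (Subgroup.inv_mem _ hz) k).1 hk
      refine ⟨(g, ⟨_, hk'⟩), ?_⟩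
      simp only at h1 ⊢
      rw [h1]
      group
    exact (Set.finite_range _).subset hsub
  refine ⟨Subgroup.normalClosure K, Subgroup.normalClosure_normal, ?_,
    Subgroup.subset_normalClosure⟩
  refine finite_of_closure_conj_invariant
    (((↑) : Subgroup.normalClosure (K : Set G) → G) ⁻¹' Group.conjugatesOfSet (K : Set G))
    (hfin.preimage Subtype.val_injective.injOn) ?_ ?_ Subgroup.closure_closure_coe_preimage
  · intro g s hs
    exact Group.conj_mem_conjugatesOfSet hs
  · intro s hs
    obtain ⟨k, hk, hks⟩ := Group.mem_conjugatesOfSet_iff.1 hs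
    refine Submonoid.isOfFinOrder_coe.1 ?_
    have h1 : IsOfFinOrder k := by
      have := isOfFinOrder_of_finite (⟨k, hk⟩ : K)
      exact Submonoid.isOfFinOrder_coe.2 this
    obtain ⟨g, hg⟩ := isConj_iff.1 hks
    exact hg ▸ MonoidHom.isOfFinOrder (MulAut.conj g).toMonoidHom h1

/-! ### The amalgamated product -/

section Amalgam

variable {H G₁ G₂ : Type*} [Group H] [Group G₁] [Group G₂]

/-- The canonical map from the first factor into the amalgamated product. -/
def amalgInl (i₁ : H →* G₁) (i₂ : H →* G₂) : G₁ →* AmalgamatedProduct i₁ i₂ :=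
  (QuotientGroup.mk' _).comp Monoid.Coprod.inl

/-- The canonical map from the second factor into the amalgamated product. -/
def amalgInr (i₁ : H →* G₁) (i₂ : H →* G₂) : G₂ →* AmalgamatedProduct i₁ i₂ :=
  (QuotientGroup.mk' _).comp Monoid.Coprod.inr

theorem amalgInl_eq_amalgInr (i₁ : H →* G₁) (i₂ : H →* G₂) (h : H) :
    amalgInl i₁ i₂ (i₁ h) = amalgInr i₁ i₂ (i₂ h) := by
  rw [← mul_inv_eq_one]
  change QuotientGroup.mk' _ _ * (QuotientGroup.mk' _ _)⁻¹ = 1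
  rw [← map_inv, ← map_mul]
  exact (QuotientGroup.eq_one_iff _).2 (Subgroup.subset_normalClosure ⟨h, rfl⟩)

theorem exists_amalgLift {i₁ : H →* G₁} {i₂ : H →* G₂} {K : Type*} [Group K] (f₁ : G₁ →* K)
    (f₂ : G₂ →* K) (hf : ∀ h, f₁ (i₁ h) = f₂ (i₂ h)) :
    ∃ f : AmalgamatedProduct i₁ i₂ →* K, (∀ g, f (amalgInl i₁ i₂ g) = f₁ g) ∧
      ∀ g, f (amalgInr i₁ i₂ g) = f₂ g := by
  have hle : Subgroup.normalClosure (Set.range fun h : H =>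
      (Monoid.Coprod.inl (i₁ h) * (Monoid.Coprod.inr (i₂ h))⁻¹ : Monoid.Coprod G₁ G₂))
      ≤ (Monoid.Coprod.lift f₁ f₂).ker := by
    refine Subgroup.normalClosure_le_normal ?_
    rintro _ ⟨h, rfl⟩
    simp [MonoidHom.mem_ker, hf h]
  refine ⟨QuotientGroup.lift _ (Monoid.Coprod.lift f₁ f₂) hle, fun g => ?_, fun g => ?_⟩
  · exact Monoid.Coprod.lift_apply_inl f₁ f₂ g
  · exact Monoid.Coprod.lift_apply_inr f₁ f₂ g

theorem amalg_induction {i₁ : H →* G₁} {i₂ : H →* G₂} {P : AmalgamatedProduct i₁ i₂ → Prop}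
    (hl : ∀ g, P (amalgInl i₁ i₂ g)) (hr : ∀ g, P (amalgInr i₁ i₂ g))
    (hm : ∀ a b, P a → P b → P (a * b)) (a : AmalgamatedProduct i₁ i₂) : P a := by
  obtain ⟨w, rfl⟩ := QuotientGroup.mk'_surjective _ a
  induction w using Monoid.Coprod.induction_on with
  | inl g => exact hl g
  | inr g => exact hr g
  | mul x y hx hy =>
    rw [map_mul]
    exact hm _ _ hx hy

end Amalgam

/-! ### Permutation actions of a finite group -/

section PermTypes

variable {H G : Type*} [Group H] [Group G]

/-- The stabilizer of a point under a permutation action. -/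
def permStab {Y : Type*} (θ : H →* Equiv.Perm Y) (y : Y) : Subgroup H where
  carrier := {h | θ h y = y}
  one_mem' := by simp
  mul_mem' {a b} ha hb := by
    simp only [Set.mem_ofPred_eq, map_mul, Equiv.Perm.mul_apply] at *
    rw [hb, ha]
  inv_mem' {a} ha := by
    simp only [Set.mem_ofPred_eq, map_inv] at *
    rw [Equiv.Perm.inv_eq_iff_eq, ha]

theorem mem_permStab {Y : Type*} {θ : H →* Equiv.Perm Y} {y : Y} {h : H} :
    h ∈ permStab θ y ↔ θ h y = y := Iff.rfl

/-- The number of points with a given stabilizer. -/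
noncomputable def permType {Y : Type*} (θ : H →* Equiv.Perm Y) (L : Subgroup H) : ℝ :=
  Nat.card {y // permStab θ y = L}

/-- The type of a one-point set. -/
noncomputable def trivType (H : Type*) [Group H] (L : Subgroup H) : ℝ :=
  open Classical in if L = ⊤ then 1 else 0

/-- `t` is the type, over `H`, of some action of `G` on a set with `n` points. -/
def IsPermType (i : H →* G) (n : ℕ) (t : Subgroup H → ℝ) : Prop :=
  ∃ (A : Type) (_ : Finite A) (ψ : G →* Equiv.Perm A), Nat.card A = n ∧ permType (ψ.comp i) = t

/-- The disjoint union of two permutation actions. -/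
def permSum {Y Z : Type*} (ψ : G →* Equiv.Perm Y) (χ : G →* Equiv.Perm Z) :
    G →* Equiv.Perm (Y ⊕ Z) :=
  (Equiv.Perm.sumCongrHom Y Z).comp (ψ.prod χ)

theorem permType_permSum {Y Z : Type*} [Finite Y] [Finite Z] (i : H →* G) (ψ : G →* Equiv.Perm Y)
    (χ : G →* Equiv.Perm Z) : permType ((permSum ψ χ).comp i)
      = permType (ψ.comp i) + permType (χ.comp i) := by
  funext L
  have hl : ∀ y, permStab ((permSum ψ χ).comp i) (Sum.inl y) = permStab (ψ.comp i) y := fun y => by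
    ext h
    simp [mem_permStab, permSum]
  have hr : ∀ y, permStab ((permSum ψ χ).comp i) (Sum.inr y) = permStab (χ.comp i) y := fun y => by
    ext h
    simp [mem_permStab, permSum]
  simp only [permType, Pi.add_apply]
  rw [Nat.card_congr (Equiv.subtypeSum (p := fun y => permStab ((permSum ψ χ).comp i) y = L)),
    Nat.card_sum]
  simp only [hl, hr]
  push_cast
  rfl

theorem permType_of_trivial {Y : Type*} [Finite Y] (θ : H →* Equiv.Perm Y)
    (hθ : ∀ h y, θ h y = y) : permType θ = (Nat.card Y : ℝ) • trivType H := by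
  have hs : ∀ y, permStab θ y = ⊤ := fun y => by
    ext h
    simp [mem_permStab, hθ]
  funext L
  simp only [permType, trivType, Pi.smul_apply, smul_eq_mul, hs]
  split_ifs with h
  · subst h
    simp
  · have : IsEmpty {y : Y // (⊤ : Subgroup H) = L} := ⟨fun y => h y.2.symm⟩
    simp

theorem isPermType_zero (i : H →* G) : IsPermType i 0 0 :=
  ⟨Empty, inferInstance, 1, by simp, by
    funext L
    simp [permType]⟩

theorem IsPermType.add {i : H →* G} {m n : ℕ} {s t : Subgroup H → ℝ} (hs : IsPermType i m s)
    (ht : IsPermType i n t) : IsPermType i (m + n) (s + t) := by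
  obtain ⟨A, _, ψ, rfl, rfl⟩ := hs
  obtain ⟨B, _, χ, rfl, rfl⟩ := ht
  exact ⟨A ⊕ B, inferInstance, permSum ψ χ, Nat.card_sum, permType_permSum i ψ χ⟩

theorem IsPermType.sum {i : H →* G} {R : Type*} (s : Finset R) {n : R → ℕ}
    {t : R → Subgroup H → ℝ} (h : ∀ r ∈ s, IsPermType i (n r) (t r)) :
    IsPermType i (∑ r ∈ s, n r) (∑ r ∈ s, t r) := by
  classical
  induction s using Finset.induction_on with
  | empty => simpa using isPermType_zero i
  | insert a s ha ih =>
    rw [Finset.sum_insert ha, Finset.sum_insert ha]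
    exact (h a (Finset.mem_insert_self a s)).add
      (ih fun r hr => h r (Finset.mem_insert_of_mem hr))

theorem isPermType_triv (i : H →* G) (k : ℕ) : IsPermType i k ((k : ℝ) • trivType H) :=
  ⟨Fin k, inferInstance, 1, by simp, by
    rw [permType_of_trivial _ fun h y => by simp]
    simp⟩

/-- Counting along fibres of constant size. It turns proportions of points of an action into
proportions of possible stabilizers. -/
theorem Nat.card_subtype_comp {Y A : Type*} [Finite Y] [Finite A] (κ : Y → A) (P : A → Prop)
    (N : ℕ) (hN : ∀ a, P a → Nat.card {y // κ y = a} = N) :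
    Nat.card {y // P (κ y)} = Nat.card {a // P a} * N := by
  have := Fintype.ofFinite {a // P a}
  rw [← Nat.card_congr (Equiv.sigmaSubtypeFiberEquivSubtype κ (p := fun y => P (κ y)) (q := P) fun _ => Iff.rfl)]
  have h1 : ∀ a : {a // P a}, Nat.card {y // κ y = a} = N := fun a => hN a a.2
  rw [Nat.card_sigma]
  simp_rw [h1]
  rw [Finset.sum_const, Finset.card_univ, Nat.card_eq_fintype_card, smul_eq_mul]

/-- If the image of `H` lies in a finite normal subgroup of `G`, then every finite action of `G`
splits into finitely many kinds of invariant pieces, and the type over `H` of a piece is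
determined by its kind and its number of points. -/
theorem exists_perm_rays (i : H →* G) (F : Subgroup G) [F.Normal] [Finite F] (hF : ∀ h, i h ∈ F) :
    ∃ (k : ℕ) (c : Fin k → Subgroup H → ℝ), ∀ (Y : Type) [Finite Y] (ψ : G →* Equiv.Perm Y),
      ∃ ρ : Y → Fin k, (∀ g y, ρ (ψ g y) = ρ y) ∧
        ∀ r L, (Nat.card {y // ρ y = r ∧ permStab (ψ.comp i) y = L} : ℝ)
          = Nat.card {y // ρ y = r} * c r L := by
  -- The conjugation action of `G` on subsets of `F`, available because `F` is normal. The kinds are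
  -- its orbits.
  let cj : G → Set F → Set F := fun g A => {f | (⟨g⁻¹ * f * g, by
    simpa using Subgroup.Normal.conj_mem ‹_› (f : G) f.2 g⁻¹⟩ : F) ∈ A}
  have hcj1 : ∀ A, cj 1 A = A := fun A => by
    ext f
    simp [cj]
  have hcjm : ∀ g h A, cj (g * h) A = cj g (cj h A) := fun g h A => by
    ext f
    simp [cj, mul_assoc]
  let S : Setoid (Set F) :=
    { r := fun A B => ∃ g, cj g A = B
      iseqv := ⟨fun A => ⟨1, hcj1 A⟩, fun {A B} ⟨g, hg⟩ => ⟨g⁻¹, by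
        rw [← hg, ← hcjm, inv_mul_cancel, hcj1]⟩, fun {A B C} ⟨g, hg⟩ ⟨h, hh⟩ => ⟨h * g, by
        rw [hcjm, hg, hh]⟩⟩ }
  obtain ⟨k, ⟨eR⟩⟩ := Finite.exists_equiv_fin (Quotient S)
  let q : Set F → Fin k := fun A => eR (Quotient.mk S A)
  let res : Set F → Set H := fun A => {h | (⟨i h, hF h⟩ : F) ∈ A}
  -- The proportion, within the orbit `r`, of the subsets of `F` that restrict to `L` over `H`.
  refine ⟨k, fun r L => (Nat.card {A // q A = r ∧ res A = (L : Set H)} : ℝ)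
    / Nat.card {A // q A = r}, fun Y _ ψ => ?_⟩
  let κ : Y → Set F := fun y => {f | ψ f y = y}
  have hκ : ∀ g y, κ (ψ g y) = cj g (κ y) := fun g y => by
    ext f
    simp only [κ, cj, Set.mem_ofPred_eq, map_mul, Equiv.Perm.mul_apply, map_inv]
    rw [Equiv.Perm.inv_eq_iff_eq]
  have hres : ∀ y (L : Subgroup H), permStab (ψ.comp i) y = L ↔ res (κ y) = (L : Set H) := by
    intro y L
    rw [← SetLike.coe_set_eq]
    rfl
  refine ⟨fun y => q (κ y), fun g y => ?_, fun r L => ?_⟩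
  · simp only [q, hκ]
    congr 1
    exact Quotient.sound (s := S) ⟨g⁻¹, by rw [← hcjm, inv_mul_cancel, hcj1]⟩
  · obtain ⟨A₀, hA₀⟩ : ∃ A₀, q A₀ = r := by
      obtain ⟨A₀, h⟩ := Quotient.mk_surjective (eR.symm r)
      exact ⟨A₀, by simp [q, h]⟩
    -- An element of `G` carrying `A` to `A₀` also carries the points with stabilizer `A` onto those
    -- with stabilizer `A₀`: stabilizers are equidistributed on each orbit.
    have hN : ∀ A, q A = r → Nat.card {y // κ y = A} = Nat.card {y // κ y = A₀} := by
      intro A hA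
      obtain ⟨g, hg⟩ : ∃ g, cj g A = A₀ :=
        Quotient.exact (s := S) (eR.injective (hA.trans hA₀.symm))
      refine Nat.card_congr ((ψ g).subtypeEquiv fun y => ?_)
      rw [hκ, ← hg]
      refine ⟨fun h => by rw [h], fun h => ?_⟩
      have := congrArg (cj g⁻¹) h
      rwa [← hcjm, ← hcjm, inv_mul_cancel, hcj1, hcj1] at this
    simp_rw [hres]
    rw [Nat.card_subtype_comp κ (fun A => q A = r ∧ res A = (L : Set H)) _ fun A hA => hN A hA.1,
      Nat.card_subtype_comp κ (fun A => q A = r) _ hN]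
    have hpos : (Nat.card {A // q A = r} : ℝ) ≠ 0 := by
      have : Nonempty {A // q A = r} := ⟨⟨A₀, hA₀⟩⟩
      exact_mod_cast Nat.card_pos.ne'
    push_cast
    field_simp

/-- Making an action trivial outside of the pieces of the kinds in `J`. -/
theorem exists_perm_modify {Y : Type} [Finite Y] (i : H →* G) {k : ℕ} (c : Fin k → Subgroup H → ℝ)
    (ψ : G →* Equiv.Perm Y) (ρ : Y → Fin k) (hρ : ∀ g y, ρ (ψ g y) = ρ y)
    (hc : ∀ r L, (Nat.card {y // ρ y = r ∧ permStab (ψ.comp i) y = L} : ℝ)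
          = Nat.card {y // ρ y = r} * c r L) (J : Finset (Fin k)) :
    ∃ ψ' : G →* Equiv.Perm Y, (∀ g y, ρ y ∈ J → ψ' g y = ψ g y) ∧
      permType (ψ'.comp i) = ∑ r ∈ J, (Nat.card {y // ρ y = r} : ℝ) • c r
        + ((∑ r ∈ Jᶜ, Nat.card {y // ρ y = r} : ℕ) : ℝ) • trivType H := by
  -- Multiplicativity is checked for plain self-maps; invertibility is then automatic, `G` being a
  -- group.
  let f : G →* Function.End Y :=
    { toFun := fun g y => if ρ y ∈ J then ψ g y else y
      map_one' := by
        funext y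
        simp
        rfl
      map_mul' := fun a b => by
        funext y
        change _ = (if ρ (if ρ y ∈ J then ψ b y else y) ∈ J then _ else _)
        by_cases h : ρ y ∈ J <;> simp [h, hρ] }
  refine ⟨f.toHomPerm, fun g y hy => if_pos hy, ?_⟩
  have hin : ∀ g y, ρ y ∈ J → f.toHomPerm g y = ψ g y := fun g y hy => if_pos hy
  have hout : ∀ g y, ρ y ∉ J → f.toHomPerm g y = y := fun g y hy => if_neg hy
  have hsin : ∀ y, ρ y ∈ J → permStab (f.toHomPerm.comp i) y = permStab (ψ.comp i) y :=
    fun y hy => by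
      ext h
      simp only [mem_permStab, MonoidHom.comp_apply, hin _ y hy]
  have hsout : ∀ y, ρ y ∉ J → permStab (f.toHomPerm.comp i) y = ⊤ := fun y hy => by
    ext h
    simp only [mem_permStab, MonoidHom.comp_apply, hout _ y hy, Subgroup.mem_top]
  funext L
  have hsplit : permType (f.toHomPerm.comp i) L
      = ∑ r, (Nat.card {y // ρ y = r ∧ permStab (f.toHomPerm.comp i) y = L} : ℝ) := by
    rw [permType, ← Nat.card_congr (Equiv.sigmaFiberEquiv
      (fun y : {y // permStab (f.toHomPerm.comp i) y = L} => ρ y)), Nat.card_sigma]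
    push_cast
    refine Finset.sum_congr rfl fun r _ => ?_
    congr 1
    exact Nat.card_congr ((Equiv.subtypeSubtypeEquivSubtypeInter
      (fun y => permStab (f.toHomPerm.comp i) y = L) (fun y => ρ y = r)).trans
      (Equiv.subtypeEquivRight fun y => and_comm))
  rw [hsplit, ← Finset.sum_add_sum_compl J]
  simp only [Pi.add_apply, Finset.sum_apply, Pi.smul_apply, smul_eq_mul]
  congr 1
  · refine Finset.sum_congr rfl fun r hr => ?_
    rw [← hc]
    congr 1
    refine Nat.card_congr (Equiv.subtypeEquivRight fun y => ?_)
    exact and_congr_right fun h => by rw [hsin y (h ▸ hr)]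
  · rw [Nat.cast_sum, Finset.sum_mul]
    refine Finset.sum_congr rfl fun r hr => ?_
    have hr' : r ∉ J := Finset.mem_compl.1 hr
    unfold trivType
    split_ifs with h
    · rw [mul_one]
      congr 1
      refine Nat.card_congr (Equiv.subtypeEquivRight fun y => ?_)
      exact and_iff_left_of_imp fun hy => by rw [hsout y (by rwa [hy]), h]
    · have : IsEmpty {y // ρ y = r ∧ permStab (f.toHomPerm.comp i) y = L} :=
        ⟨fun y => h (by rw [← y.2.2, hsout _ (by rwa [y.2.1])])⟩
      simp

end PermTypes

/-! ### Extending partial isomorphisms of finite `H`-sets -/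

section PermExtension

variable {H : Type*} [Group H]

theorem permStab_of_equivariant {Y Z : Type*} {θ : H →* Equiv.Perm Y} {η : H →* Equiv.Perm Z}
    {A : Set Y} {f : Y → Z} (hA : ∀ h, ∀ y ∈ A, θ h y ∈ A)
    (hf : ∀ h, ∀ y ∈ A, f (θ h y) = η h (f y)) (hinj : Set.InjOn f A) {y : Y} (hy : y ∈ A) :
    permStab η (f y) = permStab θ y := by
  ext h
  rw [mem_permStab, mem_permStab, ← hf h y hy]
  exact hinj.eq_iff (hA h y hy) hy

/-- Only finitely many subgroups occur as stabilizers, and summing the type over them counts all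
points. -/
theorem card_eq_of_permType_eq {Y Z : Type*} [Finite Y] [Finite Z] {θ : H →* Equiv.Perm Y}
    {η : H →* Equiv.Perm Z} (hθη : permType θ = permType η) : Nat.card Y = Nat.card Z := by
  have hfinY : (Set.range (permStab θ)).Finite := Set.finite_range _
  have hfinZ : (Set.range (permStab η)).Finite := Set.finite_range _
  classical
  set S : Finset (Subgroup H) := hfinY.toFinset ∪ hfinZ.toFinset with hS
  have hY : Nat.card Y = ∑ L ∈ S, Nat.card {y // permStab θ y = L} := by
    rw [← Finset.sum_coe_sort S, ← Nat.card_sigma]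
    refine (Nat.card_congr (Equiv.sigmaSubtypeFiberEquiv (permStab θ) (· ∈ S) fun y => ?_)).symm
    simp [hS]
  have hZ : Nat.card Z = ∑ L ∈ S, Nat.card {z // permStab η z = L} := by
    rw [← Finset.sum_coe_sort S, ← Nat.card_sigma]
    refine (Nat.card_congr (Equiv.sigmaSubtypeFiberEquiv (permStab η) (· ∈ S) fun y => ?_)).symm
    simp [hS]
  rw [hY, hZ]
  refine Finset.sum_congr rfl fun L _ => ?_
  have := congrFun hθη L
  simp only [permType] at this
  exact_mod_cast this

/-- A partially defined equivariant injection between finite `H`-sets of the same type extends to an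
equivariant bijection. -/
theorem exists_equivariant_extension {Y Z : Type*} [Finite Y] [Finite Z] (θ : H →* Equiv.Perm Y)
    (η : H →* Equiv.Perm Z) (hθη : permType θ = permType η) (A : Set Y) (f : Y → Z)
    (hA : ∀ h, ∀ y ∈ A, θ h y ∈ A) (hf : ∀ h, ∀ y ∈ A, f (θ h y) = η h (f y))
    (hinj : Set.InjOn f A) :
    ∃ e : Y ≃ Z, (∀ h y, e (θ h y) = η h (e y)) ∧ ∀ y ∈ A, e y = f y := by
  -- One orbit outside `A` is added at a time, sent to an orbit outside the image with the same
  -- stabilizer.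
  induction hn : Aᶜ.ncard using Nat.strong_induction_on generalizing A f with
  | _ n ih =>
  subst hn
  have hcard := card_eq_of_permType_eq hθη
  by_cases hall : ∀ y, y ∈ A
  · have hfi : Function.Injective f := fun a b hab => hinj (hall a) (hall b) hab
    have hbij : Function.Bijective f := by
      have := Fintype.ofFinite Y
      have := Fintype.ofFinite Z
      rw [Fintype.bijective_iff_injective_and_card]
      exact ⟨hfi, by rw [← Nat.card_eq_fintype_card, ← Nat.card_eq_fintype_card, hcard]⟩
    exact ⟨Equiv.ofBijective f hbij, fun h y => hf h y (hall y), fun y _ => rfl⟩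
  push Not at hall
  obtain ⟨y₀, hy₀⟩ := hall
  -- a point of `Z` outside of the image, with the same stabilizer
  obtain ⟨z₀, hz₀A, hz₀⟩ : ∃ z₀, z₀ ∉ f '' A ∧ permStab η z₀ = permStab θ y₀ := by
    by_contra! hno
    have hlt : Nat.card {z // permStab η z = permStab θ y₀}
        < Nat.card {y // permStab θ y = permStab θ y₀} := by
      rw [← Set.coe_ofPred, ← Set.coe_ofPred, Nat.card_coe_set_eq, Nat.card_coe_set_eq]
      have h1 : {z | permStab η z = permStab θ y₀}
          -- If every such point of `Z` were already used, all would come from points of `A` with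
          -- this stabilizer; but `y₀` is not in `A`, so `Z` would have too few of them.
          ⊆ f '' ({y | permStab θ y = permStab θ y₀} \ {y₀}) := by
        intro z hz
        have hzA : z ∈ f '' A := by
          by_contra h
          exact hno z h hz
        obtain ⟨y, hy, rfl⟩ := hzA
        refine ⟨y, ⟨?_, fun h => hy₀ (h ▸ hy)⟩, rfl⟩
        rw [Set.mem_ofPred_eq, permStab_of_equivariant hA hf hinj hy] at hz
        exact hz
      calc _ ≤ (f '' ({y | permStab θ y = permStab θ y₀} \ {y₀})).ncard :=
            Set.ncard_le_ncard h1 (Set.toFinite _)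
        _ ≤ ({y | permStab θ y = permStab θ y₀} \ {y₀}).ncard := Set.ncard_image_le (Set.toFinite _)
        _ < _ := Set.ncard_sdiff_singleton_lt_of_mem rfl (Set.toFinite _)
    have := congrFun hθη (permStab θ y₀)
    simp only [permType] at this
    have h2 : Nat.card {y // permStab θ y = permStab θ y₀}
        = Nat.card {z // permStab η z = permStab θ y₀} := by exact_mod_cast this
    omega
  have hfA : ∀ h, ∀ z ∈ f '' A, η h z ∈ f '' A := by
    rintro h _ ⟨y, hy, rfl⟩
    exact ⟨θ h y, hA h y hy, hf h y hy⟩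
  set O : Set Y := Set.range fun h => θ h y₀ with hO
  have hOA : ∀ y ∈ O, y ∉ A := by
    rintro _ ⟨h, rfl⟩ hmem
    refine hy₀ ?_
    have := hA h⁻¹ _ hmem
    simpa using this
  have hzO : ∀ h, η h z₀ ∉ f '' A := fun h hmem => by
    refine hz₀A ?_
    have := hfA h⁻¹ _ hmem
    simpa using this
  -- Equality of the stabilizers makes the map from the orbit of `y₀` to that of `z₀` both well
  -- defined and injective.
  have hiff : ∀ a b, θ a y₀ = θ b y₀ ↔ η a z₀ = η b z₀ := fun a b => by
    have h1 : b⁻¹ * a ∈ permStab θ y₀ ↔ b⁻¹ * a ∈ permStab η z₀ := by rw [hz₀]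
    simpa only [mem_permStab, map_mul, Equiv.Perm.mul_apply, map_inv,
      Equiv.Perm.inv_eq_iff_eq] using h1
  classical
  let f' : Y → Z := fun y => if h : y ∈ O then η h.choose z₀ else f y
  have hf'A : ∀ y ∈ A, f' y = f y := fun y hy => dif_neg fun h => hOA y h hy
  have hf'O : ∀ a, f' (θ a y₀) = η a z₀ := fun a => by
    have hmem : θ a y₀ ∈ O := ⟨a, rfl⟩
    simp only [f', dif_pos hmem]
    exact (hiff _ _).1 hmem.choose_spec
  obtain ⟨e, he, heA⟩ := ih (A ∪ O)ᶜ.ncard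
    (Set.ncard_lt_ncard (compl_lt_compl_iff_lt.2 ⟨Set.subset_union_left, fun h =>
      hy₀ (h (Or.inr ⟨1, by simp⟩))⟩) (Set.toFinite _)) (A ∪ O) f'
    (by
      rintro h y (hy | ⟨a, rfl⟩)
      · exact Or.inl (hA h y hy)
      · exact Or.inr ⟨h * a, by simp⟩)
    (by
      rintro h y (hy | ⟨a, rfl⟩)
      · rw [hf'A y hy, hf'A _ (hA h y hy), hf h y hy]
      · have h1 := hf'O (h * a)
        simp only [map_mul, Equiv.Perm.mul_apply] at h1
        simp only [hf'O, h1])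
    (by
      rintro y (hy | ⟨a, rfl⟩) y' (hy' | ⟨b, rfl⟩) heq
      · rw [hf'A y hy, hf'A y' hy'] at heq
        exact hinj hy hy' heq
      · simp only [hf'A y hy, hf'O] at heq
        exact (hzO b ⟨y, hy, heq⟩).elim
      · simp only [hf'A y' hy', hf'O] at heq
        exact (hzO a ⟨y', hy', heq.symm⟩).elim
      · simp only [hf'O] at heq
        exact (hiff a b).2 heq) rfl
  exact ⟨e, he, fun y hy => by rw [heA y (Or.inl hy), hf'A y hy]⟩

end PermExtension

/-! ### Negligible sets of points -/

section Negligible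

/-- The properties `p n` fail for asymptotically almost every point of the finite set `X n`. -/
def Negl {X : ℕ → Type} (p : ∀ n, X n → Prop) : Prop :=
  Tendsto (fun n => (Nat.card {x : X n // p n x} : ℝ) / (Nat.card (X n) : ℝ)) atTop (𝓝 0)

variable {X : ℕ → Type}

theorem Negl.of_le {p : ∀ n, X n → Prop} {b : ℕ → ℝ}
    (hb : Tendsto (fun n => b n / (Nat.card (X n) : ℝ)) atTop (𝓝 0))
    (h : ∀ n, (Nat.card {x : X n // p n x} : ℝ) ≤ b n) : Negl p :=
  squeeze_zero (fun n => by positivity) (fun n => by gcongr; exact h n) hb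

theorem Negl.mono [∀ n, Finite (X n)] {p q : ∀ n, X n → Prop} (hp : Negl p) (h : ∀ n x, q n x → p n x) : Negl q :=
  Negl.of_le hp fun n => by
    exact_mod_cast Nat.card_le_card_of_injective _ (Subtype.impEmbedding _ _ (h n)).injective

theorem Negl.or [∀ n, Finite (X n)] {p q : ∀ n, X n → Prop} (hp : Negl p) (hq : Negl q) :
    Negl fun n x => p n x ∨ q n x := by
  refine Negl.of_le (b := fun n => (Nat.card {x : X n // p n x} : ℝ) + Nat.card {x : X n // q n x})
    ?_ fun n => ?_
  · simpa [add_div] using Tendsto.add hp hq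
  · have h1 := Set.ncard_union_le {x | p n x} {x | q n x}
    exact_mod_cast h1

theorem Negl.false : Negl fun n (_ : X n) => False := by
  simp [Negl]

theorem Negl.exists [∀ n, Finite (X n)] {ι : Type*} [Finite ι] {p : ι → ∀ n, X n → Prop} (hp : ∀ i, Negl (p i)) :
    Negl fun n x => ∃ i, p i n x := by
  classical
  have := Fintype.ofFinite ι
  have h : ∀ s : Finset ι, Negl fun n x => ∃ i ∈ s, p i n x := by
    intro s
    induction s using Finset.induction_on with
    | empty => simpa using Negl.false
    | insert a s ha ih => exact ((hp a).or ih).mono fun n x => by simp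
  exact (h Finset.univ).mono fun n x => by simp

theorem Negl.perm [∀ n, Finite (X n)] {p : ∀ n, X n → Prop} (hp : Negl p) (σ : ∀ n, Equiv.Perm (X n)) :
    Negl fun n x => p n (σ n x) :=
  Negl.of_le hp fun n => by
    exact_mod_cast (Nat.card_congr ((σ n).subtypeEquiv fun x => Iff.rfl)).le

/-- Pulling a small set back along injections. -/
theorem Negl.comap {Y : ℕ → Type} [∀ n, Finite (Y n)] {q : ∀ n, Y n → Prop}
    (hq : Tendsto (fun n => (Nat.card {y : Y n // q n y} : ℝ) / (Nat.card (X n) : ℝ)) atTop (𝓝 0))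
    (ι : ∀ n, X n ↪ Y n) : Negl fun n x => q n (ι n x) :=
  Negl.of_le hq fun n => by
    exact_mod_cast Nat.card_le_card_of_injective _
      ((ι n).subtypeMap (q := q n) fun x (hx : q n (ι n x)) => hx).injective

theorem negl_iff_hammDist {Z : ℕ → Type} {f g : ∀ n, X n → Z n} :
    (Negl fun n x => f n x ≠ g n x) ↔ Tendsto (fun n => hammDist (f n) (g n)) atTop (𝓝 0) :=
  Iff.rfl

end Negligible

/-! ### Comparing two actions of `H` on sets containing `X` -/

section Good

variable {H X Y Z : Type*} [Group H]

/-- The points of `X` whose orbits under the two actions agree and stay in `X`. -/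
def Good (ι : X ↪ Y) (κ : X ↪ Z) (θ : H →* Equiv.Perm Y) (η : H →* Equiv.Perm Z) (x : X) : Prop :=
  ∀ h, ∃ x', θ h (ι x) = ι x' ∧ η h (κ x) = κ x'

/-- Goodness is a condition on whole orbits, so the good points form an invariant set on which the
two actions are identified. -/
theorem Good.orbit {ι : X ↪ Y} {κ : X ↪ Z} {θ : H →* Equiv.Perm Y} {η : H →* Equiv.Perm Z} {x x' : X}
    (hx : Good ι κ θ η x) {h : H} (h1 : θ h (ι x) = ι x') : η h (κ x) = κ x' ∧ Good ι κ θ η x' := by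
  obtain ⟨x'', h2, h3⟩ := hx h
  obtain rfl : x' = x'' := ι.injective (h1.symm.trans h2)
  refine ⟨h3, fun a => ?_⟩
  obtain ⟨w, hw1, hw2⟩ := hx (a * h)
  refine ⟨w, ?_, ?_⟩
  · rw [← h1, ← hw1, map_mul, Equiv.Perm.mul_apply]
  · rw [← h3, ← hw2, map_mul, Equiv.Perm.mul_apply]

theorem Good.permStab_eq {ι : X ↪ Y} {κ : X ↪ Z} {θ : H →* Equiv.Perm Y} {η : H →* Equiv.Perm Z}
    {x : X} (hx : Good ι κ θ η x) : permStab θ (ι x) = permStab η (κ x) := by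
  ext h
  obtain ⟨x', h1, h2⟩ := hx h
  rw [mem_permStab, mem_permStab, h1, h2, ι.injective.eq_iff, κ.injective.eq_iff]

/-- A good point has the same stabilizer on both sides, so an excess can only come from points of
`Y` outside `X` and from bad points of `X`. -/
theorem permType_sub_le [Finite X] [Finite Y] [Finite Z] (ι : X ↪ Y) (κ : X ↪ Z)
    (θ : H →* Equiv.Perm Y) (η : H →* Equiv.Perm Z) (L : Subgroup H) :
    permType θ L - permType η L
      ≤ (Nat.card Y : ℝ) - Nat.card X + Nat.card {x // ¬ Good ι κ θ η x} := by
  have h1 : {y | permStab θ y = L} ⊆ ι '' {x | Good ι κ θ η x ∧ permStab η (κ x) = L}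
      ∪ ((Set.range ι)ᶜ ∪ ι '' {x | ¬ Good ι κ θ η x}) := by
    intro y hy
    by_cases hr : y ∈ Set.range ι
    · obtain ⟨x, rfl⟩ := hr
      by_cases hg : Good ι κ θ η x
      · exact Or.inl ⟨x, ⟨hg, by rw [← hg.permStab_eq]; exact hy⟩, rfl⟩
      · exact Or.inr (Or.inr ⟨x, hg, rfl⟩)
    · exact Or.inr (Or.inl hr)
  have h2 := (Set.ncard_le_ncard h1 (Set.toFinite _)).trans ((Set.ncard_union_le _ _).trans
    (Nat.add_le_add_left (Set.ncard_union_le _ _) _))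
  rw [Set.ncard_image_of_injective _ ι.injective, Set.ncard_image_of_injective _ ι.injective] at h2
  have h3 : {x | Good ι κ θ η x ∧ permStab η (κ x) = L}.ncard ≤ {z | permStab η z = L}.ncard :=
    Set.ncard_le_ncard_of_injOn κ (fun x hx => hx.2) κ.injective.injOn (Set.toFinite _)
  have h4 : (Set.range ι).ncard + (Set.range ι)ᶜ.ncard = Nat.card Y := Set.ncard_add_ncard_compl _
  have h5 : (Set.range ι).ncard = Nat.card X := by
    rw [← Set.image_univ, Set.ncard_image_of_injective _ ι.injective, Set.ncard_univ]
  have e1 : permType θ L = {y | permStab θ y = L}.ncard := rfl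
  have e2 : permType η L = {z | permStab η z = L}.ncard := rfl
  have e3 : Nat.card {x // ¬ Good ι κ θ η x} = {x | ¬ Good ι κ θ η x}.ncard := rfl
  rw [e1, e2, e3]
  have h2' : ({y | permStab θ y = L}.ncard : ℝ) ≤ {x | Good ι κ θ η x ∧ permStab η (κ x) = L}.ncard
    + ((Set.range ι)ᶜ.ncard + {x | ¬ Good ι κ θ η x}.ncard) := by exact_mod_cast h2
  have h3' : ({x | Good ι κ θ η x ∧ permStab η (κ x) = L}.ncard : ℝ)
    ≤ {z | permStab η z = L}.ncard := by exact_mod_cast h3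
  have h4' : (Nat.card X : ℝ) + (Set.range ι)ᶜ.ncard = Nat.card Y := by
    rw [← h5]
    exact_mod_cast h4
  linarith

theorem Good.symm {ι : X ↪ Y} {κ : X ↪ Z} {θ : H →* Equiv.Perm Y} {η : H →* Equiv.Perm Z} {x : X}
    (hx : Good ι κ θ η x) : Good κ ι η θ x :=
  fun h => (hx h).imp fun _ => And.symm

theorem abs_permType_sub_le [Finite X] [Finite Y] [Finite Z] (ι : X ↪ Y) (κ : X ↪ Z)
    (θ : H →* Equiv.Perm Y) (η : H →* Equiv.Perm Z) (L : Subgroup H) :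
    |permType θ L - permType η L| ≤ ((Nat.card Y : ℝ) - Nat.card X)
      + ((Nat.card Z : ℝ) - Nat.card X) + Nat.card {x // ¬ Good ι κ θ η x} := by
  have hY : (Nat.card X : ℝ) ≤ Nat.card Y := by
    exact_mod_cast Nat.card_le_card_of_injective ι ι.injective
  have hZ : (Nat.card X : ℝ) ≤ Nat.card Z := by
    exact_mod_cast Nat.card_le_card_of_injective κ κ.injective
  have h1 := permType_sub_le ι κ θ η L
  have h2 := permType_sub_le κ ι η θ L
  have h3 : Nat.card {x // ¬ Good κ ι η θ x} = Nat.card {x // ¬ Good ι κ θ η x} :=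
    Nat.card_congr (Equiv.subtypeEquivRight fun x => not_congr ⟨Good.symm, Good.symm⟩)
  rw [h3] at h2
  rw [abs_le]
  constructor <;> linarith

/-- On the good points, matching the two copies of `X` is an equivariant injection, to which
`exists_equivariant_extension` applies. -/
theorem Good.exists_extension [Finite Y] [Finite Z] (ι : X ↪ Y) (κ : X ↪ Z) (θ : H →* Equiv.Perm Y)
    (η : H →* Equiv.Perm Z) (hθη : permType θ = permType η) :
    ∃ e : Y ≃ Z, (∀ h y, e (θ h y) = η h (e y)) ∧ ∀ x, Good ι κ θ η x → e (ι x) = κ x := by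
  classical
  have ⟨e₀⟩ : Nonempty (Y ≃ Z) := by
    rw [← Finite.card_eq]
    exact card_eq_of_permType_eq hθη
  -- The arbitrary bijection `e₀` only supplies default values off the image of `ι`; they are never
  -- used.
  let f : Y → Z := fun y => if h : ∃ x, ι x = y then κ h.choose else e₀ y
  have hf : ∀ x, f (ι x) = κ x := fun x => by
    have h : ∃ x', ι x' = ι x := ⟨x, rfl⟩
    simp only [f, dif_pos h]
    rw [ι.injective h.choose_spec]
  obtain ⟨e, he, heA⟩ := exists_equivariant_extension θ η hθη (ι '' {x | Good ι κ θ η x}) f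
    (by
      rintro h _ ⟨x, hx, rfl⟩
      obtain ⟨x', h1, -⟩ := hx h
      exact ⟨x', (hx.orbit h1).2, h1.symm⟩)
    (by
      rintro h _ ⟨x, hx, rfl⟩
      obtain ⟨x', h1, h2⟩ := hx h
      rw [h1, hf, hf, h2])
    (by
      rintro _ ⟨x, hx, rfl⟩ _ ⟨x', hx', rfl⟩ h
      rw [hf, hf] at h
      rw [κ.injective h])
  exact ⟨e, he, fun x hx => by rw [heA _ ⟨x, hx, rfl⟩, hf]⟩

end Good

/-! ### Stability in permutations for the amalgam -/

section PermMain

variable {H G : Type*} [Group H] [Group G]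

/-- A piece is invariant, so it is an action of `G` in its own right. This places the observed sizes
in the submonoids `permSizes`. -/
theorem isPermType_piece {Y : Type} [Finite Y] (i : H →* G) {k : ℕ} (c : Fin k → Subgroup H → ℝ)
    (ψ : G →* Equiv.Perm Y) (ρ : Y → Fin k) (hρ : ∀ g y, ρ (ψ g y) = ρ y)
    (hc : ∀ r L, (Nat.card {y // ρ y = r ∧ permStab (ψ.comp i) y = L} : ℝ)
          = Nat.card {y // ρ y = r} * c r L) (r : Fin k) :
    IsPermType i (Nat.card {y // ρ y = r}) ((Nat.card {y // ρ y = r} : ℝ) • c r) := by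
  let χ : G →* Equiv.Perm {y // ρ y = r} :=
    { toFun := fun g => (ψ g).subtypePerm fun y => by rw [hρ]
      map_one' := by ext; simp
      map_mul' := fun a b => by
        ext
        simp
        rfl }
  refine ⟨{y // ρ y = r}, inferInstance, χ, rfl, ?_⟩
  funext L
  rw [Pi.smul_apply, smul_eq_mul, ← hc, permType]
  congr 1
  have hst : ∀ y : {y // ρ y = r}, permStab (χ.comp i) y = permStab (ψ.comp i) y := fun y => by
    ext h
    simp only [mem_permStab, MonoidHom.comp_apply]
    rw [Subtype.ext_iff]
    rfl
  simp_rw [hst]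
  exact Nat.card_congr (Equiv.subtypeSubtypeEquivSubtypeInter (fun y => ρ y = r)
    (fun y => permStab (ψ.comp i) y = L))

theorem permType_eq_sum_pieces {Y : Type} [Finite Y] (i : H →* G) {k : ℕ}
    (c : Fin k → Subgroup H → ℝ)
    (ψ : G →* Equiv.Perm Y) (ρ : Y → Fin k) (hρ : ∀ g y, ρ (ψ g y) = ρ y)
    (hc : ∀ r L, (Nat.card {y // ρ y = r ∧ permStab (ψ.comp i) y = L} : ℝ)
          = Nat.card {y // ρ y = r} * c r L) :
    permType (ψ.comp i) = ∑ r, (Nat.card {y // ρ y = r} : ℝ) • c r := by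
  obtain ⟨ψ', h1, h2⟩ := exists_perm_modify i c ψ ρ hρ hc Finset.univ
  have h3 : ψ' = ψ := by
    ext g y
    exact h1 g y (Finset.mem_univ _)
  rw [h3] at h2
  simpa using h2

/-- Making an action trivial outside of some pieces, and adding a further set. -/
theorem exists_perm_enlarge {X Y : Type} [Finite Y] (ι : X ↪ Y) (i : H →* G) {k : ℕ}
    (c : Fin k → Subgroup H → ℝ)
    (ψ : G →* Equiv.Perm Y) (ρ : Y → Fin k) (hρ : ∀ g y, ρ (ψ g y) = ρ y)
    (hc : ∀ r L, (Nat.card {y // ρ y = r ∧ permStab (ψ.comp i) y = L} : ℝ)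
          = Nat.card {y // ρ y = r} * c r L) (J : Finset (Fin k)) {m : ℕ} {t : Subgroup H → ℝ}
    (ht : IsPermType i m t) :
    ∃ (Y' : Type) (_ : Finite Y') (ι' : X ↪ Y') (ψ' : G →* Equiv.Perm Y'),
      Nat.card Y' = Nat.card Y + m ∧
      permType (ψ'.comp i) = ∑ r ∈ J, (Nat.card {y // ρ y = r} : ℝ) • c r
        + ((∑ r ∈ Jᶜ, Nat.card {y // ρ y = r} : ℕ) : ℝ) • trivType H + t ∧
      ∀ g x x', ι x' = ψ g (ι x) → ρ (ι x) ∈ J → ι' x' = ψ' g (ι' x) := by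
  obtain ⟨ψ₀, h1, h2⟩ := exists_perm_modify i c ψ ρ hρ hc J
  obtain ⟨A, _, χ, rfl, rfl⟩ := ht
  refine ⟨Y ⊕ A, inferInstance, ι.trans Function.Embedding.inl, permSum ψ₀ χ, Nat.card_sum, ?_, ?_⟩
  · rw [permType_permSum, h2]
  · intro g x x' hx hJ
    change Sum.inl (ι x') = Sum.inl (ψ₀ g (ι x))
    rw [h1 g _ hJ, hx]

/-- The submonoid of the sizes of the actions of a given kind. -/
def permSizes (i : H →* G) (c : Subgroup H → ℝ) : AddSubmonoid ℕ where
  carrier := {n | IsPermType i n ((n : ℝ) • c)}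
  zero_mem' := by simpa using isPermType_zero i
  add_mem' {a b} ha hb := by
    have := IsPermType.add ha hb
    rwa [← add_smul, ← Nat.cast_add] at this

theorem card_fiber_compl {Y : Type} [Finite Y] {k : ℕ} (ρ : Y → Fin k) (J : Finset (Fin k)) :
    Nat.card {y // ρ y ∉ J} = ∑ r ∈ Jᶜ, Nat.card {y // ρ y = r} := by
  rw [← Nat.card_congr (Equiv.sigmaSubtypeFiberEquivSubtype ρ (p := fun y => ρ y ∉ J)
    (q := (· ∈ Jᶜ)) fun y => by simp), Nat.card_sigma, ← Finset.sum_coe_sort Jᶜ]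

/-- Almost all points of `X` are good for two actions that almost extend the same maps. -/
theorem negl_not_good [Finite H] {X Y Z : ℕ → Type} [∀ n, Finite (X n)] (ι : ∀ n, X n ↪ Y n)
    (κ : ∀ n, X n ↪ Z n) (θ : ∀ n, H →* Equiv.Perm (Y n)) (η : ∀ n, H →* Equiv.Perm (Z n))
    (φ : ∀ n, H → Equiv.Perm (X n))
    (h1 : ∀ h, Negl fun n x => ι n (φ n h x) ≠ θ n h (ι n x))
    (h2 : ∀ h, Negl fun n x => κ n (φ n h x) ≠ η n h (κ n x)) :
    Negl fun n x => ¬ Good (ι n) (κ n) (θ n) (η n) x := by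
  refine (Negl.exists fun h => (h1 h).or (h2 h)).mono fun n x hx => ?_
  by_contra! hno
  exact hx fun h => ⟨φ n h x, (hno h).1.symm, (hno h).2.symm⟩

/-- The integer-valued functions. -/
def intLattice (I : Type*) : AddSubgroup (I → ℝ) :=
  ((Int.castAddHom ℝ).compLeft I).range

theorem eq_zero_of_mem_intLattice {I : Type*} [Fintype I] {l : I → ℝ} (hl : l ∈ intLattice I)
    (h : ‖l‖ < 1) : l = 0 := by
  obtain ⟨m, rfl⟩ := hl
  funext L
  have h1 := (norm_le_pi_norm _ L).trans_lt h
  simp only [AddMonoidHom.compLeft_apply, Function.comp_apply, Int.coe_castAddHom,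
    Real.norm_eq_abs] at h1
  have h2 : |m L| < 1 := by exact_mod_cast h1
  simp [Int.abs_lt_one_iff.1 h2]

theorem IsPermType.mem_intLattice {i : H →* G} {n : ℕ} {t : Subgroup H → ℝ}
    (h : IsPermType i n t) : t ∈ intLattice (Subgroup H) := by
  obtain ⟨A, _, ψ, -, rfl⟩ := h
  exact ⟨fun L => Nat.card {y // permStab (ψ.comp i) y = L}, by
    funext L
    simp [permType]⟩

end PermMain

theorem IsFlexiblyPStable.amalgamatedProduct {H G₁ G₂ : Type*} [Group H] [Group G₁] [Group G₂]
    [Finite H] (i₁ : H →* G₁) (i₂ : H →* G₂) (hn₁ : IsAlmostNormal i₁.range)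
    (hn₂ : IsAlmostNormal i₂.range) (hG₁ : IsFlexiblyPStable G₁) (hG₂ : IsFlexiblyPStable G₂) :
    IsFlexiblyPStable (AmalgamatedProduct i₁ i₂) := by
  classical
  have := Fintype.ofFinite (Subgroup H)
  have : Finite i₁.range := Finite.of_surjective _ i₁.rangeRestrict_surjective
  have : Finite i₂.range := Finite.of_surjective _ i₂.rangeRestrict_surjective
  obtain ⟨F₁, hF₁n, hF₁f, hF₁⟩ := hn₁.exists_finite_normal
  obtain ⟨F₂, hF₂n, hF₂f, hF₂⟩ := hn₂.exists_finite_normal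
  obtain ⟨k₁, c₁, hc₁⟩ := exists_perm_rays i₁ F₁ fun h => hF₁ ⟨h, rfl⟩
  obtain ⟨k₂, c₂, hc₂⟩ := exists_perm_rays i₂ F₂ fun h => hF₂ ⟨h, rfl⟩
  intro X _ _ φ hφ
  obtain ⟨Y₁, hY₁, ι₁, ψ₁, hψ₁, hr₁⟩ := hG₁ X (fun n g => φ n (amalgInl i₁ i₂ g)) fun a b => by
    simpa using hφ (amalgInl i₁ i₂ a) (amalgInl i₁ i₂ b)
  obtain ⟨Y₂, hY₂, ι₂, ψ₂, hψ₂, hr₂⟩ := hG₂ X (fun n g => φ n (amalgInr i₁ i₂ g)) fun a b => by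
    simpa using hφ (amalgInr i₁ i₂ a) (amalgInr i₁ i₂ b)
  have hx : ∀ n, (0 : ℝ) < Nat.card (X n) := fun n => by exact_mod_cast Nat.card_pos
  choose ρ₁ hρ₁ hcρ₁ using fun n => hc₁ (Y₁ n) (ψ₁ n)
  choose ρ₂ hρ₂ hcρ₂ using fun n => hc₂ (Y₂ n) (ψ₂ n)
  set u : ℕ → Fin k₁ → ℕ := fun n r => Nat.card {y // ρ₁ n y = r} with hu
  set v : ℕ → Fin k₂ → ℕ := fun n r => Nat.card {y // ρ₂ n y = r} with hv
  -- Over `H` both actions approximate the same maps, because the two embeddings agree on `H` in the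
  -- amalgam. This bounds the difference of the types.
  have hgood := negl_not_good ι₁ ι₂ (fun n => (ψ₁ n).comp i₁) (fun n => (ψ₂ n).comp i₂)
    (fun n h => φ n (amalgInl i₁ i₂ (i₁ h))) (fun h => hψ₁ (i₁ h))
    (fun h => by
      simp_rw [amalgInl_eq_amalgInr]
      exact hψ₂ (i₂ h))
  have hcardY₁ : ∀ n, (Nat.card (X n) : ℝ) ≤ Nat.card (Y₁ n) := fun n => by
    exact_mod_cast Nat.card_le_card_of_injective _ (ι₁ n).injective
  have hcardY₂ : ∀ n, (Nat.card (X n) : ℝ) ≤ Nat.card (Y₂ n) := fun n => by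
    exact_mod_cast Nat.card_le_card_of_injective _ (ι₂ n).injective
  have hd₁ : Tendsto (fun n => ((Nat.card (Y₁ n) : ℝ) - Nat.card (X n)) / Nat.card (X n))
      atTop (𝓝 0) := by
    simpa [sub_div, div_self (hx _).ne'] using hr₁.sub_const 1
  have hd₂ : Tendsto (fun n => ((Nat.card (Y₂ n) : ℝ) - Nat.card (X n)) / Nat.card (X n))
      atTop (𝓝 0) := by
    simpa [sub_div, div_self (hx _).ne'] using hr₂.sub_const 1
  have huv : Tendsto (fun n => ‖∑ r, (u n r : ℝ) • c₁ r - ∑ r, (v n r : ℝ) • c₂ r‖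
      / (Nat.card (X n) : ℝ)) atTop (𝓝 0) := by
    have hb := (hd₁.add hd₂).add hgood
    simp only [add_zero, ← add_div] at hb
    refine squeeze_zero (fun n => by positivity) (fun n => ?_) hb
    gcongr
    rw [← permType_eq_sum_pieces i₁ c₁ (ψ₁ n) (ρ₁ n) (hρ₁ n) (hcρ₁ n),
      ← permType_eq_sum_pieces i₂ c₂ (ψ₂ n) (ρ₂ n) (hρ₂ n) (hcρ₂ n)]
    refine (pi_norm_le_iff_of_nonneg ?_).2 fun L => ?_
    · have := hcardY₁ n
      have := hcardY₂ n
      have : (0 : ℝ) ≤ Nat.card {x // ¬ Good (ι₁ n) (ι₂ n) ((ψ₁ n).comp i₁) ((ψ₂ n).comp i₂) x} :=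
        Nat.cast_nonneg _
      linarith
    · exact abs_permType_sub_le (ι₁ n) (ι₂ n) _ _ L
  have hu2 : ∀ᶠ n in atTop, ∀ r, (u n r : ℝ) ≤ 2 * Nat.card (X n) := by
    filter_upwards [hr₁.eventually (gt_mem_nhds one_lt_two)] with n hn r
    rw [div_lt_iff₀ (hx n)] at hn
    refine le_trans ?_ hn.le
    exact_mod_cast Nat.card_le_card_of_injective _ Subtype.val_injective
  have hv2 : ∀ᶠ n in atTop, ∀ r, (v n r : ℝ) ≤ 2 * Nat.card (X n) := by
    filter_upwards [hr₂.eventually (gt_mem_nhds one_lt_two)] with n hn r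
    rw [div_lt_iff₀ (hx n)] at hn
    refine le_trans ?_ hn.le
    exact_mod_cast Nat.card_le_card_of_injective _ Subtype.val_injective
  obtain ⟨J₁, J₂, α, β, hα, hβ, hrel, hJ₁, hJ₂, hαx, hβx⟩ := exists_seq_balance c₁ c₂
    (fun r => permSizes i₁ (c₁ r)) (fun r => permSizes i₂ (c₂ r)) (intLattice (Subgroup H)) one_pos
    (fun l => eq_zero_of_mem_intLattice) (fun r n hn => IsPermType.mem_intLattice hn)
    (fun r n hn => IsPermType.mem_intLattice hn) _ hx u v
    (fun n r => isPermType_piece i₁ c₁ (ψ₁ n) (ρ₁ n) (hρ₁ n) (hcρ₁ n) r)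
    (fun n r => isPermType_piece i₂ c₂ (ψ₂ n) (ρ₂ n) (hρ₂ n) (hcρ₂ n) r) hu2 hv2 huv
  -- Besides the corrections `α` and `β`, each side receives as many fixed points as were made
  -- trivial on the other side. The multiples of `trivType` then agree.
  choose Y₁' hY₁' ι₁' ψ₁' hcard₁ htype₁ hag₁ using fun n =>
    exists_perm_enlarge (ι₁ n) i₁ c₁ (ψ₁ n) (ρ₁ n) (hρ₁ n) (hcρ₁ n) (J₁ n)
      ((IsPermType.sum Finset.univ fun r _ => hα n r).add (isPermType_triv i₁ (∑ r ∈ (J₂ n)ᶜ, v n r)))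
  choose Y₂' hY₂' ι₂' ψ₂' hcard₂ htype₂ hag₂ using fun n =>
    exists_perm_enlarge (ι₂ n) i₂ c₂ (ψ₂ n) (ρ₂ n) (hρ₂ n) (hcρ₂ n) (J₂ n)
      ((IsPermType.sum Finset.univ fun r _ => hβ n r).add (isPermType_triv i₂ (∑ r ∈ (J₁ n)ᶜ, u n r)))
  have htype : ∀ n, permType ((ψ₁' n).comp i₁) = permType ((ψ₂' n).comp i₂) := fun n => by
    rw [htype₁, htype₂]
    linear_combination (exp := 1) hrel n
  have hout₁ : Negl fun n x => ρ₁ n (ι₁ n x) ∉ J₁ n :=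
    Negl.comap (q := fun n y => ρ₁ n y ∉ J₁ n) (by simpa [card_fiber_compl] using hJ₁) ι₁
  have hout₂ : Negl fun n x => ρ₂ n (ι₂ n x) ∉ J₂ n :=
    Negl.comap (q := fun n y => ρ₂ n y ∉ J₂ n) (by simpa [card_fiber_compl] using hJ₂) ι₂
  have hneg₁ : ∀ g, Negl fun n x => ι₁' n (φ n (amalgInl i₁ i₂ g) x) ≠ ψ₁' n g (ι₁' n x) :=
    fun g => ((negl_iff_hammDist.2 (hψ₁ g)).or hout₁).mono fun n x hx => by
      by_contra! hno
      exact hx (hag₁ n g x _ hno.1 hno.2)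
  have hneg₂ : ∀ g, Negl fun n x => ι₂' n (φ n (amalgInr i₁ i₂ g) x) ≠ ψ₂' n g (ι₂' n x) :=
    fun g => ((negl_iff_hammDist.2 (hψ₂ g)).or hout₂).mono fun n x hx => by
      by_contra! hno
      exact hx (hag₂ n g x _ hno.1 hno.2)
  -- Good points are counted again, now for the modified actions, whose types agree exactly.
  have hbad := negl_not_good ι₁' ι₂' (fun n => (ψ₁' n).comp i₁) (fun n => (ψ₂' n).comp i₂)
    (fun n h => φ n (amalgInl i₁ i₂ (i₁ h))) (fun h => hneg₁ (i₁ h))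
    (fun h => by
      simp_rw [amalgInl_eq_amalgInr]
      exact hneg₂ (i₂ h))
  choose e he hegood using fun n =>
    Good.exists_extension (ι₁' n) (ι₂' n) _ _ (htype n)
  choose Ψ hΨl hΨr using fun n => exists_amalgLift (i₁ := i₁) (i₂ := i₂)
    ((e n).permCongrHom.toMonoidHom.comp (ψ₁' n)) (ψ₂' n) fun h => by
      ext y
      have := he n h ((e n).symm y)
      simpa using this
  refine ⟨Y₂', hY₂', ι₂', Ψ, fun a => negl_iff_hammDist.1 ?_, ?_⟩
  · induction a using amalg_induction with
    | hl g =>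
      -- The transported action is the right one at `x` when `e` matches the two copies of both `x`
      -- and its image under `φ`.
      refine (hbad.or ((hneg₁ g).or (hbad.perm fun n => φ n (amalgInl i₁ i₂ g)))).mono fun n x hx => ?_
      by_contra! hno
      obtain ⟨h1, h2, h3⟩ := hno
      refine hx ?_
      rw [hΨl, ← hegood n x h1, ← hegood n _ h3, h2]
      simp
    | hr g => simpa only [hΨr] using hneg₂ g
    | hm a b ha hb =>
      refine ((negl_iff_hammDist.2 (hφ a b)).or (hb.or (ha.perm fun n => φ n b))).mono
        fun n x hx => ?_
      by_contra! hno
      obtain ⟨h1, h2, h3⟩ := hno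
      refine hx ?_
      rw [← h1, map_mul, Equiv.Perm.mul_apply, Equiv.Perm.mul_apply, h3, h2]
  · have h1 := (hr₂.add hβx).add hJ₁
    simp only [add_zero, ← add_div] at h1
    refine h1.congr fun n => ?_
    rw [hcard₂]
    push_cast
    ring

/-! ### The Hilbert–Schmidt norm -/

section HilbertSchmidt

set_option linter.unusedSectionVars false

variable {X Y Z : Type*} [NormedAddCommGroup X] [InnerProductSpace ℂ X] [FiniteDimensional ℂ X]
  [NormedAddCommGroup Y] [InnerProductSpace ℂ Y] [FiniteDimensional ℂ Y]
  [NormedAddCommGroup Z] [InnerProductSpace ℂ Z] [FiniteDimensional ℂ Z]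

/-- The vector of the values of an operator on an orthonormal basis. -/
noncomputable def hsVec (A : X →ₗ[ℂ] Y) :
    PiLp 2 fun _ : Fin (Module.finrank ℂ X) => Y :=
  WithLp.toLp 2 fun i => A (stdOrthonormalBasis ℂ X i)

/-- The unnormalized Hilbert–Schmidt norm. -/
noncomputable def hsN (A : X →ₗ[ℂ] Y) : ℝ := ‖hsVec A‖

theorem hsN_nonneg (A : X →ₗ[ℂ] Y) : 0 ≤ hsN A := norm_nonneg _

theorem hsN_add_le (A B : X →ₗ[ℂ] Y) : hsN (A + B) ≤ hsN A + hsN B :=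
  norm_add_le (hsVec A) (hsVec B)

theorem hsN_sub_le (A B : X →ₗ[ℂ] Y) : hsN (A - B) ≤ hsN A + hsN B :=
  norm_sub_le (hsVec A) (hsVec B)

theorem hsN_sub_comm (A B : X →ₗ[ℂ] Y) : hsN (A - B) = hsN (B - A) :=
  norm_sub_rev (hsVec A) (hsVec B)

theorem hsN_smul (c : ℂ) (A : X →ₗ[ℂ] Y) : hsN (c • A) = ‖c‖ * hsN A :=
  norm_smul c (hsVec A)

theorem hsN_sum_le {ι : Type*} (s : Finset ι) (A : ι → X →ₗ[ℂ] Y) :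
    hsN (∑ i ∈ s, A i) ≤ ∑ i ∈ s, hsN (A i) := by
  classical
  induction s using Finset.induction_on with
  | empty =>
    have h : hsVec (0 : X →ₗ[ℂ] Y) = 0 := rfl
    simp [hsN, h]
  | insert a s ha ih =>
    rw [Finset.sum_insert ha, Finset.sum_insert ha]
    exact (hsN_add_le _ _).trans (by gcongr)

/-- The trace pairing is an honest inner product of the vectors `hsVec`. This gives Cauchy–Schwarz
for traces and shows that the norm does not depend on the basis. -/
theorem trace_adjoint_comp (A B : X →ₗ[ℂ] Y) :
    LinearMap.trace ℂ X (LinearMap.adjoint A ∘ₗ B) = inner ℂ (hsVec A) (hsVec B) := by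
  rw [LinearMap.trace_eq_sum_inner _ (stdOrthonormalBasis ℂ X), PiLp.inner_apply]
  refine Finset.sum_congr rfl fun i _ => ?_
  rw [LinearMap.comp_apply, LinearMap.adjoint_inner_right]
  rfl

theorem hsN_sq (A : X →ₗ[ℂ] Y) :
    hsN A ^ 2 = (LinearMap.trace ℂ X (LinearMap.adjoint A ∘ₗ A)).re := by
  rw [trace_adjoint_comp, hsN]
  exact (inner_self_eq_norm_sq (𝕜 := ℂ) (hsVec A)).symm

theorem norm_trace_adjoint_comp_le (A B : X →ₗ[ℂ] Y) :
    ‖LinearMap.trace ℂ X (LinearMap.adjoint A ∘ₗ B)‖ ≤ hsN A * hsN B := by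
  rw [trace_adjoint_comp]
  exact norm_inner_le_norm _ _

/-- Cyclicity of the trace. It transfers estimates for composition on one side to the other. -/
theorem hsN_adjoint (A : X →ₗ[ℂ] Y) : hsN (LinearMap.adjoint A) = hsN A := by
  rw [← sq_eq_sq₀ (hsN_nonneg _) (hsN_nonneg _), hsN_sq, hsN_sq, LinearMap.adjoint_adjoint,
    LinearMap.trace_comp_comm']

theorem hsN_comp_le_left (C : Y →ₗ[ℂ] Z) (hC : ∀ y, ‖C y‖ ≤ ‖y‖) (A : X →ₗ[ℂ] Y) :
    hsN (C ∘ₗ A) ≤ hsN A := by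
  rw [← sq_le_sq₀ (hsN_nonneg _) (hsN_nonneg _), hsN, hsN, PiLp.norm_sq_eq_of_L2,
    PiLp.norm_sq_eq_of_L2]
  refine Finset.sum_le_sum fun i _ => ?_
  gcongr
  exact hC _

theorem norm_adjoint_apply_le (C : X →ₗ[ℂ] Y) (hC : ∀ x, ‖C x‖ ≤ ‖x‖) (y : Y) :
    ‖LinearMap.adjoint C y‖ ≤ ‖y‖ := by
  rcases (norm_nonneg (LinearMap.adjoint C y)).eq_or_lt with h | h
  · rw [← h]
    exact norm_nonneg y
  · refine le_of_mul_le_mul_left ?_ h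
    have h1 : ‖LinearMap.adjoint C y‖ * ‖LinearMap.adjoint C y‖
        = ‖inner ℂ (C (LinearMap.adjoint C y)) y‖ := by
      rw [← LinearMap.adjoint_inner_right, inner_self_eq_norm_sq_to_K]
      simp [sq]
    rw [h1]
    exact (norm_inner_le_norm _ _).trans (by gcongr; exact hC _)

theorem hsN_comp_le_right (A : Y →ₗ[ℂ] Z) (C : X →ₗ[ℂ] Y) (hC : ∀ x, ‖C x‖ ≤ ‖x‖) :
    hsN (A ∘ₗ C) ≤ hsN A := by
  rw [← hsN_adjoint, LinearMap.adjoint_comp, ← hsN_adjoint A]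
  exact hsN_comp_le_left _ (norm_adjoint_apply_le C hC) _

theorem hsN_sq_of_isometry (V : X →ₗ[ℂ] Y) (hV : ∀ x, ‖V x‖ = ‖x‖) :
    hsN V ^ 2 = Module.finrank ℂ X := by
  rw [hsN, PiLp.norm_sq_eq_of_L2]
  have : ∀ i, ‖(hsVec V).ofLp i‖ = 1 := fun i => by
    simp [hsVec, hV]
  simp [this]

theorem hsNorm_eq (A : X →ₗ[ℂ] X) : hsNorm A = hsN A / √(Module.finrank ℂ X) := by
  rw [hsNorm, ← hsN_sq, Real.sqrt_div (sq_nonneg _), Real.sqrt_sq (hsN_nonneg _)]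

theorem adjoint_comp_self_of_isometry (V : X →ₗ[ℂ] Y) (hV : ∀ x, ‖V x‖ = ‖x‖) :
    LinearMap.adjoint V ∘ₗ V = LinearMap.id := by
  let W : X →ₗᵢ[ℂ] Y := ⟨V, hV⟩
  refine LinearMap.ext fun x => ext_inner_left ℂ fun y => ?_
  rw [LinearMap.comp_apply, LinearMap.adjoint_inner_right, LinearMap.id_apply]
  exact W.inner_map_map y x

/-- If the compression of `B` is close to the isometry `U`, then `B` almost restricts to `U`. -/
theorem hsN_intertwine_sq_le (ι : X →ₗ[ℂ] Y) (hι : ∀ x, ‖ι x‖ = ‖x‖) (U : X →ₗ[ℂ] X)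
    (hU : ∀ x, ‖U x‖ = ‖x‖) (B : Y →ₗ[ℂ] Y) (hB : ∀ y, ‖B y‖ = ‖y‖) :
    hsN (B ∘ₗ ι - ι ∘ₗ U) ^ 2
      ≤ 2 * (√(Module.finrank ℂ X) * hsN (U - LinearMap.adjoint ι ∘ₗ B ∘ₗ ι)) := by
  have h1 : hsN (B ∘ₗ ι) ^ 2 = Module.finrank ℂ X :=
    hsN_sq_of_isometry _ fun x => by rw [LinearMap.comp_apply, hB, hι]
  have h2 : hsN (ι ∘ₗ U) ^ 2 = Module.finrank ℂ X :=
    hsN_sq_of_isometry _ fun x => by rw [LinearMap.comp_apply, hι, hU]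
  have h3 : hsN U ^ 2 = Module.finrank ℂ X := hsN_sq_of_isometry _ hU
  have h4 : hsN U = √(Module.finrank ℂ X) := by
    rw [← h3, Real.sqrt_sq (hsN_nonneg _)]
  -- Expanding the square gives twice the dimension minus twice the real part of the trace of `U* ι*
  -- B ι`; Cauchy–Schwarz against `U` bounds how far that trace is below the dimension.
  have h5 := norm_trace_adjoint_comp_le U (U - LinearMap.adjoint ι ∘ₗ B ∘ₗ ι)
  rw [h4] at h5
  have h6 := (Complex.re_le_norm _).trans h5
  rw [LinearMap.comp_sub, map_sub, Complex.sub_re, ← hsN_sq, h3] at h6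
  have h7 : (inner ℂ (hsVec (ι ∘ₗ U)) (hsVec (B ∘ₗ ι))).re
      = (LinearMap.trace ℂ X (LinearMap.adjoint U ∘ₗ LinearMap.adjoint ι ∘ₗ B ∘ₗ ι)).re := by
    rw [← trace_adjoint_comp, LinearMap.adjoint_comp, LinearMap.comp_assoc]
  have h8 := norm_sub_sq (𝕜 := ℂ) (hsVec (ι ∘ₗ U)) (hsVec (B ∘ₗ ι))
  have h9 : ‖hsVec (ι ∘ₗ U) - hsVec (B ∘ₗ ι)‖ = hsN (B ∘ₗ ι - ι ∘ₗ U) := norm_sub_rev _ _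
  have h10 : RCLike.re (inner ℂ (hsVec (ι ∘ₗ U)) (hsVec (B ∘ₗ ι)))
    = (inner ℂ (hsVec (ι ∘ₗ U)) (hsVec (B ∘ₗ ι))).re := rfl
  rw [h9, h10, h7] at h8
  have h11 : ‖hsVec (ι ∘ₗ U)‖ ^ 2 = Module.finrank ℂ X := h2
  have h12 : ‖hsVec (B ∘ₗ ι)‖ ^ 2 = Module.finrank ℂ X := h1
  rw [h11, h12] at h8
  linarith

end HilbertSchmidt

/-! ### Unitary representations and their characters -/

section UnitaryReps

set_option linter.unusedSectionVars false

variable {G H : Type*} [Group G] [Group H]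
  {V W : Type*} [NormedAddCommGroup V] [InnerProductSpace ℂ V] [FiniteDimensional ℂ V]
  [NormedAddCommGroup W] [InnerProductSpace ℂ W] [FiniteDimensional ℂ W]

/-- The linear representation underlying a unitary representation. -/
def linRep (π : G →* (V ≃ₗᵢ[ℂ] V)) : Representation ℂ G V where
  toFun g := unitaryOp (π g)
  map_one' := by
    rw [map_one]
    rfl
  map_mul' a b := by
    rw [map_mul]
    rfl

@[simp] theorem unitaryOp_apply (u : V ≃ₗᵢ[ℂ] V) (v : V) : unitaryOp u v = u v := rfl

/-- The character of a unitary representation. -/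
noncomputable def uchar (π : G →* (V ≃ₗᵢ[ℂ] V)) (g : G) : ℂ := LinearMap.trace ℂ V (unitaryOp (π g))

theorem uchar_one (π : G →* (V ≃ₗᵢ[ℂ] V)) : uchar π 1 = Module.finrank ℂ V :=
  (linRep π).char_one

theorem adjoint_unitaryOp (u : V ≃ₗᵢ[ℂ] V) :
    LinearMap.adjoint (unitaryOp u) = unitaryOp u⁻¹ := by
  refine LinearMap.ext fun x => ext_inner_left ℂ fun y => ?_
  rw [LinearMap.adjoint_inner_right, unitaryOp_apply, unitaryOp_apply]
  have h := u.inner_map_map y (u⁻¹ x)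
  rwa [show u (u⁻¹ x) = x from u.apply_symm_apply x] at h

theorem trace_adjoint (A : V →ₗ[ℂ] V) :
    LinearMap.trace ℂ V (LinearMap.adjoint A) = starRingEnd ℂ (LinearMap.trace ℂ V A) := by
  have h1 := trace_adjoint_comp A LinearMap.id
  have h2 := trace_adjoint_comp LinearMap.id A
  rw [LinearMap.comp_id] at h1
  rw [LinearMap.adjoint_id, LinearMap.id_comp] at h2
  rw [h1, h2, inner_conj_symm]

theorem uchar_inv (π : G →* (V ≃ₗᵢ[ℂ] V)) (g : G) : uchar π g⁻¹ = starRingEnd ℂ (uchar π g) := by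
  rw [uchar, uchar, ← trace_adjoint, adjoint_unitaryOp, map_inv]

/-- The restriction of a unitary representation to an invariant subspace. -/
def subRep (π : G →* (V ≃ₗᵢ[ℂ] V)) (K : Submodule ℂ V) (hK : ∀ g, ∀ v ∈ K, π g v ∈ K) :
    G →* (K ≃ₗᵢ[ℂ] K) where
  toFun g :=
    { toLinearEquiv := LinearEquiv.ofLinearMap ((unitaryOp (π g)).restrict (hK g))
        ((unitaryOp (π g⁻¹)).restrict (hK g⁻¹))
        (LinearMap.ext fun v => Subtype.ext (by
          change π g (π g⁻¹ v) = v
          rw [map_inv]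
          exact (π g).apply_symm_apply _))
        (LinearMap.ext fun v => Subtype.ext (by
          change π g⁻¹ (π g v) = v
          rw [map_inv]
          exact (π g).symm_apply_apply _))
      norm_map' := fun v => (π g).norm_map v }
  map_one' := LinearIsometryEquiv.ext fun v => Subtype.ext (by
    change π 1 v = v
    rw [map_one]
    rfl)
  map_mul' a b := LinearIsometryEquiv.ext fun v => Subtype.ext (by
    change π (a * b) v = π a (π b v)
    rw [map_mul]
    rfl)

theorem uchar_eq_sum_subRep {ι : Type*} [Fintype ι] [DecidableEq ι] {N : ι → Submodule ℂ V}
    (hN : DirectSum.IsInternal N) (π : G →* (V ≃ₗᵢ[ℂ] V))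
    (hinv : ∀ i g, ∀ v ∈ N i, π g v ∈ N i) (g : G) :
    uchar π g = ∑ i, uchar (subRep π (N i) (hinv i)) g :=
  LinearMap.trace_eq_sum_trace_restrict hN fun i => hinv i g

/-- The orthogonal direct sum of two unitaries. -/
noncomputable def prodUnitary (e : V ≃ₗᵢ[ℂ] V) (f : W ≃ₗᵢ[ℂ] W) : WithLp 2 (V × W) ≃ₗᵢ[ℂ] WithLp 2 (V × W) where
  toLinearEquiv := (WithLp.linearEquiv 2 ℂ (V × W)).trans
    ((e.toLinearEquiv.prodCongr f.toLinearEquiv).trans (WithLp.linearEquiv 2 ℂ (V × W)).symm)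
  norm_map' x := by
    rw [← sq_eq_sq₀ (norm_nonneg _) (norm_nonneg _), WithLp.prod_norm_sq_eq_of_L2,
      WithLp.prod_norm_sq_eq_of_L2]
    simp

/-- The orthogonal direct sum of two unitary representations. -/
noncomputable def prodRep (π : G →* (V ≃ₗᵢ[ℂ] V)) (σ : G →* (W ≃ₗᵢ[ℂ] W)) :
    G →* (WithLp 2 (V × W) ≃ₗᵢ[ℂ] WithLp 2 (V × W)) where
  toFun g := prodUnitary (π g) (σ g)
  map_one' := LinearIsometryEquiv.ext fun x => by
    change WithLp.toLp 2 (π 1 x.fst, σ 1 x.snd) = x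
    rw [map_one, map_one]
    rfl
  map_mul' a b := LinearIsometryEquiv.ext fun x => by
    change WithLp.toLp 2 (π (a * b) x.fst, σ (a * b) x.snd)
      = WithLp.toLp 2 (π a (π b x.fst), σ a (σ b x.snd))
    rw [map_mul, map_mul]
    rfl

theorem prodRep_apply (π : G →* (V ≃ₗᵢ[ℂ] V)) (σ : G →* (W ≃ₗᵢ[ℂ] W)) (g : G)
    (x : WithLp 2 (V × W)) : prodRep π σ g x = WithLp.toLp 2 (π g x.fst, σ g x.snd) := rfl

theorem uchar_prodRep (π : G →* (V ≃ₗᵢ[ℂ] V)) (σ : G →* (W ≃ₗᵢ[ℂ] W)) (g : G) :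
    uchar (prodRep π σ) g = uchar π g + uchar σ g := by
  rw [uchar, uchar, uchar, ← LinearMap.trace_prodMap',
    ← LinearMap.trace_conj' _ (WithLp.linearEquiv 2 ℂ (V × W)).symm]
  rfl

theorem finrank_prodL2 :
    Module.finrank ℂ (WithLp 2 (V × W)) = Module.finrank ℂ V + Module.finrank ℂ W := by
  rw [(WithLp.linearEquiv 2 ℂ (V × W)).finrank_eq, Module.finrank_prod]

/-- `χ` is the character of a finite-dimensional unitary representation of `G`. -/
def IsUChar (χ : G → ℂ) : Prop :=
  ∃ (V : Type) (_ : NormedAddCommGroup V) (_ : InnerProductSpace ℂ V) (_ : FiniteDimensional ℂ V)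
    (π : G →* (V ≃ₗᵢ[ℂ] V)), uchar π = χ

theorem IsUChar.add {χ χ' : G → ℂ} (h : IsUChar χ) (h' : IsUChar χ') : IsUChar (χ + χ') := by
  obtain ⟨V, _, _, _, π, rfl⟩ := h
  obtain ⟨W, _, _, _, σ, rfl⟩ := h'
  exact ⟨WithLp 2 (V × W), inferInstance, inferInstance, inferInstance, prodRep π σ,
    funext fun g => uchar_prodRep π σ g⟩

theorem isUChar_const (k : ℕ) : IsUChar fun _ : G => (k : ℂ) :=
  ⟨EuclideanSpace ℂ (Fin k), inferInstance, inferInstance, inferInstance, 1, by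
    funext g
    have : uchar (1 : G →* (EuclideanSpace ℂ (Fin k) ≃ₗᵢ[ℂ] EuclideanSpace ℂ (Fin k))) g
      = uchar (1 : G →* (EuclideanSpace ℂ (Fin k) ≃ₗᵢ[ℂ] EuclideanSpace ℂ (Fin k))) 1 := rfl
    rw [this, uchar_one]
    simp⟩

theorem isUChar_zero : IsUChar (0 : G → ℂ) := by
  convert! isUChar_const (G := G) 0 using 1
  ext
  simp

theorem IsUChar.sum {R : Type*} (s : Finset R) {χ : R → G → ℂ} (h : ∀ r ∈ s, IsUChar (χ r)) :
    IsUChar (∑ r ∈ s, χ r) := by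
  classical
  induction s using Finset.induction_on with
  | empty => simpa using isUChar_zero
  | insert a s ha ih =>
    rw [Finset.sum_insert ha]
    exact (h a (Finset.mem_insert_self a s)).add
      (ih fun r hr => h r (Finset.mem_insert_of_mem hr))

theorem IsUChar.comp {χ : G → ℂ} (h : IsUChar χ) (i : H →* G) : IsUChar fun a => χ (i a) := by
  obtain ⟨V, _, _, _, π, rfl⟩ := h
  exact ⟨V, inferInstance, inferInstance, inferInstance, π.comp i, rfl⟩

/-- Orthogonality of characters. The integrality of the right-hand side makes virtual characters
discrete, and its positivity produces intertwiners. -/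
theorem sum_uchar_mul_conj [Fintype H] (π : H →* (V ≃ₗᵢ[ℂ] V)) (σ : H →* (W ≃ₗᵢ[ℂ] W)) :
    ∑ h, uchar σ h * starRingEnd ℂ (uchar π h)
      = Nat.card H * Module.finrank ℂ (Representation.IntertwiningMap (linRep π) (linRep σ)) := by
  have hH : (Nat.card H : ℂ) ≠ 0 := by exact_mod_cast Nat.card_pos.ne'
  let _ : Invertible (Nat.card H : ℂ) := invertibleOfNonzero hH
  rw [← Representation.card_inv_mul_sum_char_mul_char_eq_finrank, mul_inv_cancel_left₀ hH]
  refine Finset.sum_congr rfl fun h _ => ?_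
  rw [← uchar_inv]
  rfl

/-- Two characters of a finite group that differ by less than `1` are equal. -/
theorem IsUChar.eq_of_norm_sub_lt [Fintype H] {χ χ' : H → ℂ} (h : IsUChar χ) (h' : IsUChar χ')
    (hlt : ‖χ - χ'‖ < 1) : χ = χ' := by
  obtain ⟨V, _, _, _, π, rfl⟩ := h
  obtain ⟨W, _, _, _, σ, rfl⟩ := h'
  have hH : (0 : ℝ) < Nat.card H := by exact_mod_cast Nat.card_pos
  -- The squared norm of a virtual character is the order of `H` times an integer; values smaller
  -- than `1` force that integer to vanish.
  obtain ⟨m, hm⟩ : ∃ m : ℤ, ∑ a, ‖uchar π a - uchar σ a‖ ^ 2 = Nat.card H * m := by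
    have h1 := sum_uchar_mul_conj π π
    have h2 := sum_uchar_mul_conj σ π
    have h3 := sum_uchar_mul_conj π σ
    have h4 := sum_uchar_mul_conj σ σ
    generalize Module.finrank ℂ (Representation.IntertwiningMap (linRep π) (linRep π)) = p at h1
    generalize Module.finrank ℂ (Representation.IntertwiningMap (linRep σ) (linRep π)) = q at h2
    generalize Module.finrank ℂ (Representation.IntertwiningMap (linRep π) (linRep σ)) = r at h3
    generalize Module.finrank ℂ (Representation.IntertwiningMap (linRep σ) (linRep σ)) = s at h4
    refine ⟨(p : ℤ) - q - r + s, Complex.ofReal_injective ?_⟩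
    have h5 : ∑ a, ((‖uchar π a - uchar σ a‖ ^ 2 : ℝ) : ℂ)
        = ∑ a, uchar π a * starRingEnd ℂ (uchar π a) - ∑ a, uchar π a * starRingEnd ℂ (uchar σ a)
          - ∑ a, uchar σ a * starRingEnd ℂ (uchar π a)
          + ∑ a, uchar σ a * starRingEnd ℂ (uchar σ a) := by
      rw [← Finset.sum_sub_distrib, ← Finset.sum_sub_distrib, ← Finset.sum_add_distrib]
      refine Finset.sum_congr rfl fun a _ => ?_
      push_cast
      rw [← Complex.mul_conj', map_sub]
      ring
    rw [h1, h2, h3, h4] at h5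
    push_cast at h5 ⊢
    rw [h5]
    ring
  have hle : ∀ a, ‖uchar π a - uchar σ a‖ ^ 2 < 1 := fun a => by
    have h1 := (norm_le_pi_norm (uchar π - uchar σ) a).trans_lt hlt
    rw [Pi.sub_apply] at h1
    exact pow_lt_one₀ (norm_nonneg _) h1 two_ne_zero
  have hm1 : (m : ℝ) < 1 := by
    have h1 : ∑ a : H, ‖uchar π a - uchar σ a‖ ^ 2 < ∑ a : H, (1 : ℝ) :=
      Finset.sum_lt_sum_of_nonempty Finset.univ_nonempty fun a _ => hle a
    rw [hm, Finset.sum_const, Finset.card_univ, nsmul_eq_mul, ← Nat.card_eq_fintype_card] at h1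
    exact lt_of_mul_lt_mul_left h1 hH.le
  have hm0 : (0 : ℝ) ≤ m := by
    have h1 : (0 : ℝ) ≤ Nat.card H * m := hm ▸ Finset.sum_nonneg fun a _ => by positivity
    exact nonneg_of_mul_nonneg_right h1 hH
  have hm2 : m = 0 := by
    have h1 : m < 1 := by exact_mod_cast hm1
    have h2 : 0 ≤ m := by exact_mod_cast hm0
    omega
  rw [hm2, Int.cast_zero, mul_zero, Finset.sum_eq_zero_iff_of_nonneg fun a _ => by positivity] at hm
  funext a
  have := hm a (Finset.mem_univ a)
  rwa [sq_eq_zero_iff, norm_eq_zero, sub_eq_zero] at this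

/-- The group of virtual characters. -/
def virtualChars (H : Type*) [Group H] : AddSubgroup (H → ℂ) where
  carrier := {f | ∃ χ χ', IsUChar χ ∧ IsUChar χ' ∧ f = χ - χ'}
  zero_mem' := ⟨0, 0, isUChar_zero, isUChar_zero, by simp⟩
  add_mem' := by
    rintro _ _ ⟨a, b, ha, hb, rfl⟩ ⟨c, d, hc, hd, rfl⟩
    exact ⟨a + c, b + d, ha.add hc, hb.add hd, by abel⟩
  neg_mem' := by
    rintro _ ⟨a, b, ha, hb, rfl⟩
    exact ⟨b, a, hb, ha, by abel⟩

theorem eq_zero_of_mem_virtualChars [Fintype H] {f : H → ℂ} (hf : f ∈ virtualChars H)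
    (h : ‖f‖ < 1) : f = 0 := by
  obtain ⟨a, b, ha, hb, rfl⟩ := hf
  rw [ha.eq_of_norm_sub_lt hb h, sub_self]

theorem IsUChar.mem_virtualChars {χ : H → ℂ} (h : IsUChar χ) : χ ∈ virtualChars H :=
  ⟨χ, 0, h, isUChar_zero, by simp⟩

/-- Representations of a finite group with the same nonzero character admit a nonzero intertwiner. -/
theorem exists_intertwiner_ne_zero [Finite H] [Nontrivial V] (π : H →* (V ≃ₗᵢ[ℂ] V))
    (σ : H →* (W ≃ₗᵢ[ℂ] W)) (h : uchar π = uchar σ) :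
    ∃ T : V →ₗ[ℂ] W, T ≠ 0 ∧ ∀ a v, T (π a v) = σ a (T v) := by
  have := Fintype.ofFinite H
  have h1 := sum_uchar_mul_conj π π
  have h2 := sum_uchar_mul_conj π σ
  rw [← h, h1] at h2
  have hH : (Nat.card H : ℂ) ≠ 0 := by exact_mod_cast Nat.card_pos.ne'
  have h3 := mul_left_cancel₀ hH h2
  have h4 : Module.finrank ℂ (Representation.IntertwiningMap (linRep π) (linRep π))
      = Module.finrank ℂ (Representation.IntertwiningMap (linRep π) (linRep σ)) := by
    exact_mod_cast h3
  -- Otherwise the character would vanish identically, although its value at `1` is the positive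
  -- dimension.
  have h5 : 0 < Module.finrank ℂ (Representation.IntertwiningMap (linRep π) (linRep π)) := by
    have h0 : Module.finrank ℂ (Representation.IntertwiningMap (linRep π) (linRep π)) ≠ 0 := by
      intro h0
      rw [h0, Nat.cast_zero, mul_zero] at h1
      have h6 : ∑ a : H, ((‖uchar π a‖ ^ 2 : ℝ) : ℂ) = 0 := by
        rw [← h1]
        refine Finset.sum_congr rfl fun a _ => ?_
        push_cast
        rw [← Complex.mul_conj']
      have h7 : ∑ a : H, ‖uchar π a‖ ^ 2 = 0 := by exact_mod_cast h6
      rw [Finset.sum_eq_zero_iff_of_nonneg fun a _ => by positivity] at h7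
      have h8 := h7 1 (Finset.mem_univ 1)
      rw [uchar_one] at h8
      have : 0 < Module.finrank ℂ V := Module.finrank_pos
      simp at h8
      omega
    exact Nat.pos_of_ne_zero h0
  rw [h4] at h5
  have := Module.nontrivial_of_finrank_pos h5
  obtain ⟨T, hT⟩ := exists_ne (0 : Representation.IntertwiningMap (linRep π) (linRep σ))
  refine ⟨T.toLinearMap, fun h0 => hT ?_, fun a v => ?_⟩
  · ext v
    exact LinearMap.congr_fun h0 v
  · exact LinearMap.congr_fun (T.isIntertwining' a) v

end UnitaryReps

/-! ### Polar decomposition of intertwiners -/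

section PolarDecomposition

set_option linter.unusedSectionVars false

variable {V W : Type*} [NormedAddCommGroup V] [InnerProductSpace ℂ V] [FiniteDimensional ℂ V]
  [NormedAddCommGroup W] [InnerProductSpace ℂ W] [FiniteDimensional ℂ W]

theorem adjoint_subtype_apply (K : Submodule ℂ V) (v : V) :
    LinearMap.adjoint K.subtype v = K.orthogonalProjectionOnto v := by
  refine ext_inner_left ℂ fun w => ?_
  rw [LinearMap.adjoint_inner_right]
  exact (Submodule.inner_orthogonalProjectionOnto_eq_of_mem_left w v).symm

/-- Passing to adjoints turns the two restrictions into orthogonal projections of the values, where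
Pythagoras applies term by term. -/
theorem hsN_sq_eq_add (K : Submodule ℂ V) (A : V →ₗ[ℂ] W) :
    hsN A ^ 2 = hsN (A ∘ₗ K.subtype) ^ 2 + hsN (A ∘ₗ Kᗮ.subtype) ^ 2 := by
  rw [← hsN_adjoint A, ← hsN_adjoint (A ∘ₗ K.subtype), ← hsN_adjoint (A ∘ₗ Kᗮ.subtype),
    LinearMap.adjoint_comp, LinearMap.adjoint_comp, hsN, hsN, hsN, PiLp.norm_sq_eq_of_L2,
    PiLp.norm_sq_eq_of_L2, PiLp.norm_sq_eq_of_L2, ← Finset.sum_add_distrib]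
  refine Finset.sum_congr rfl fun i _ => ?_
  simp only [hsVec, LinearMap.comp_apply, adjoint_subtype_apply]
  exact Submodule.norm_sq_eq_add_norm_sq_projection _ K

theorem orthogonal_invariant {G : Type*} [Group G] (π : G →* (V ≃ₗᵢ[ℂ] V)) (K : Submodule ℂ V)
    (hK : ∀ g, ∀ v ∈ K, π g v ∈ K) : ∀ g, ∀ v ∈ Kᗮ, π g v ∈ Kᗮ := by
  intro g v hv w hw
  have h1 := hv _ (hK g⁻¹ w hw)
  rw [← (π g).inner_map_map, map_inv] at h1
  rwa [show π g ((π g)⁻¹ w) = w from (π g).apply_symm_apply w] at h1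

theorem uchar_eq_add_orthogonal {G : Type*} [Group G] (π : G →* (V ≃ₗᵢ[ℂ] V)) (K : Submodule ℂ V)
    (hK : ∀ g, ∀ v ∈ K, π g v ∈ K) (g : G) :
    uchar π g = uchar (subRep π K hK) g
      + uchar (subRep π Kᗮ (orthogonal_invariant π K hK)) g := by
  let N : Bool → Submodule ℂ V := fun b => if b then K else Kᗮ
  have hN : DirectSum.IsInternal N := by
    rw [DirectSum.isInternal_submodule_iff_isCompl N (i := true) (j := false) (by simp)
      (by ext b; cases b <;> simp)]
    exact K.isCompl_orthogonal
  have hinv : ∀ i g, ∀ v ∈ N i, π g v ∈ N i := by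
    intro i
    cases i
    · exact orthogonal_invariant π K hK
    · exact hK
  have := uchar_eq_sum_subRep hN π hinv g
  rw [Fintype.sum_bool] at this
  exact this

theorem uchar_eq_of_equiv {G : Type*} [Group G] (π : G →* (V ≃ₗᵢ[ℂ] V)) (σ : G →* (W ≃ₗᵢ[ℂ] W))
    (e : V ≃ₗ[ℂ] W) (he : ∀ g v, e (π g v) = σ g (e v)) : uchar π = uchar σ := by
  funext g
  rw [uchar, uchar, ← LinearMap.trace_conj' _ e]
  congr 1
  refine LinearMap.ext fun w => ?_
  rw [LinearEquiv.conj_apply_apply]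
  change e (π g (e.symm w)) = σ g w
  rw [he, e.apply_symm_apply]

/-- A linear isometry that intertwines, glued from orthogonal pieces. -/
theorem exists_glue {G : Type*} [Group G] (π : G →* (V ≃ₗᵢ[ℂ] V)) (σ : G →* (W ≃ₗᵢ[ℂ] W))
    (K : Submodule ℂ V) (L : Submodule ℂ W) (hK : ∀ g, ∀ v ∈ K, π g v ∈ K) (A : V →ₗ[ℂ] W)
    (hAL : ∀ v ∈ K, A v ∈ L) (hA : ∀ v ∈ K, ‖A v‖ = ‖v‖)
    (hAπ : ∀ g, ∀ v ∈ K, A (π g v) = σ g (A v)) (B : Kᗮ →ₗᵢ[ℂ] Lᗮ)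
    (hB : ∀ g v, (B (subRep π Kᗮ (orthogonal_invariant π K hK) g v) : W) = σ g (B v)) :
    ∃ U : V →ₗᵢ[ℂ] W, (∀ g v, U (π g v) = σ g (U v)) ∧ (∀ v ∈ K, U v = A v) ∧
      ∀ v : Kᗮ, U v = B v := by
  let U₀ : V →ₗ[ℂ] W := A ∘ₗ K.subtype ∘ₗ (K.orthogonalProjectionOnto : V →ₗ[ℂ] K)
    + Lᗮ.subtype ∘ₗ B.toLinearMap ∘ₗ (Kᗮ.orthogonalProjectionOnto : V →ₗ[ℂ] Kᗮ)
  have hU₀ : ∀ v, U₀ v = A (K.orthogonalProjectionOnto v) + B (Kᗮ.orthogonalProjectionOnto v) :=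
    fun v => rfl
  have h1 : ∀ v ∈ K, U₀ v = A v := fun v hv => by
    rw [hU₀, Submodule.orthogonalProjectionOnto_apply_of_mem_orthogonal
      (K := Kᗮ) (by rwa [Submodule.orthogonal_orthogonal]),
      Submodule.orthogonalProjectionOnto_mem_subspace_eq_self (⟨v, hv⟩ : K)]
    simp
  have h2 : ∀ v : Kᗮ, U₀ v = B v := fun v => by
    rw [hU₀, Submodule.orthogonalProjectionOnto_apply_of_mem_orthogonal v.2,
      Submodule.orthogonalProjectionOnto_mem_subspace_eq_self v]
    simp
  refine ⟨⟨U₀, fun v => ?_⟩, fun g v => ?_, h1, h2⟩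
  · rw [← sq_eq_sq₀ (norm_nonneg _) (norm_nonneg _), K.norm_sq_eq_add_norm_sq_projection v, hU₀,
      sq, norm_add_sq_eq_norm_sq_add_norm_sq_of_inner_eq_zero (𝕜 := ℂ), hA _ (Subtype.mem _), ← sq, ← sq]
    · congr 2
      exact B.norm_map _
    · exact (B _).2 _ (hAL _ (Subtype.mem _))
  · change U₀ (π g v) = σ g (U₀ v)
    obtain ⟨p, hp, q, hq, rfl⟩ := K.exists_add_mem_mem_orthogonal v
    rw [map_add, map_add, map_add, map_add, h1 p hp, h1 _ (hK g p hp), hAπ g p hp, h2 ⟨q, hq⟩]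
    congr 1
    rw [← hB]
    exact h2 (subRep π Kᗮ (orthogonal_invariant π K hK) g ⟨q, hq⟩)

/-- The nonzero case of `exists_unitary_intertwiner_near`, for an inductive proof. -/
theorem exists_unitary_intertwiner_near_of_ne_zero {H : Type*} [Group H] [Finite H]
    (ih : ∀ (K : Submodule ℂ V) (L : Submodule ℂ W), K ≠ ⊤ → ∀ (π : H →* (K ≃ₗᵢ[ℂ] K))
      (σ : H →* (L ≃ₗᵢ[ℂ] L)), uchar π = uchar σ → ∀ T : K →ₗ[ℂ] L, (∀ a v, T (π a v) = σ a (T v)) →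
      (∀ v, ‖T v‖ ≤ ‖v‖) → ∃ U : K →ₗᵢ[ℂ] L, (∀ a v, U (π a v) = σ a (U v)) ∧
        hsN (U.toLinearMap - T) ^ 2 ≤ Module.finrank ℂ K - hsN T ^ 2)
    (π : H →* (V ≃ₗᵢ[ℂ] V)) (σ : H →* (W ≃ₗᵢ[ℂ] W)) (hχ : uchar π = uchar σ) (T : V →ₗ[ℂ] W)
    (hT : ∀ a v, T (π a v) = σ a (T v)) (hT1 : ∀ v, ‖T v‖ ≤ ‖v‖) (hT0 : T ≠ 0) :
    ∃ U : V →ₗᵢ[ℂ] W, (∀ a v, U (π a v) = σ a (U v)) ∧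
      hsN (U.toLinearMap - T) ^ 2 ≤ Module.finrank ℂ V - hsN T ^ 2 := by
  set S : V →ₗ[ℂ] V := LinearMap.adjoint T ∘ₗ T with hS
  have hSin : ∀ v w, inner ℂ v (S w) = inner ℂ (T v) (T w) := fun v w => by
    rw [hS, LinearMap.comp_apply, LinearMap.adjoint_inner_right]
  have hSin' : ∀ v w, inner ℂ (S v) w = inner ℂ (T v) (T w) := fun v w => by
    rw [hS, LinearMap.comp_apply, LinearMap.adjoint_inner_left]
  have hSsym : S.IsSymmetric := fun v w => by rw [hSin, hSin']
  -- a nonzero eigenvalue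
  obtain ⟨μ, hμ0, v₀, hv₀0, hv₀⟩ : ∃ μ : ℝ, μ ≠ 0 ∧ ∃ v : V, v ≠ 0 ∧ S v = (μ : ℂ) • v := by
    by_contra! hno
    refine hT0 (LinearMap.ext fun v => ?_)
    have hS0 : S = 0 := by
      refine (hSsym.eigenvectorBasis rfl).toBasis.ext fun i => ?_
      rw [OrthonormalBasis.coe_toBasis, LinearMap.zero_apply, hSsym.apply_eigenvectorBasis rfl i]
      by_cases h0 : hSsym.eigenvalues rfl i = 0
      · simp [h0]
      · exact (hno _ h0 _ ((hSsym.eigenvectorBasis rfl).orthonormal.ne_zero i)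
          (hSsym.apply_eigenvectorBasis rfl i)).elim
    rw [LinearMap.zero_apply, ← inner_self_eq_zero (𝕜 := ℂ), ← hSin, hS0]
    simp
  have hTμ : ∀ v, S v = (μ : ℂ) • v → ‖T v‖ ^ 2 = μ * ‖v‖ ^ 2 := fun v hv => by
    have h1 := hSin v v
    rw [hv, inner_smul_right, inner_self_eq_norm_sq_to_K, inner_self_eq_norm_sq_to_K] at h1
    refine Complex.ofReal_injective ?_
    push_cast
    exact h1.symm
  have hv₀p : 0 < ‖v₀‖ ^ 2 := by have := norm_pos_iff.2 hv₀0; positivity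
  have hμpos : 0 < μ := by
    have h1 : 0 ≤ μ * ‖v₀‖ ^ 2 := hTμ v₀ hv₀ ▸ sq_nonneg _
    exact lt_of_le_of_ne (nonneg_of_mul_nonneg_left h1 hv₀p) hμ0.symm
  have hμ1 : μ ≤ 1 := by
    have h1 := pow_le_pow_left₀ (norm_nonneg _) (hT1 v₀) 2
    rw [hTμ v₀ hv₀] at h1
    exact le_of_mul_le_mul_right (by simpa using h1) hv₀p
  set s : ℝ := √μ with hs
  have hs0 : 0 < s := Real.sqrt_pos.2 hμpos
  have hss : s ^ 2 = μ := Real.sq_sqrt hμpos.le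
  have hs1 : s ≤ 1 := Real.sqrt_le_one.2 hμ1
  -- the eigenspace and its image
  set K : Submodule ℂ V := Module.End.eigenspace S (μ : ℂ) with hKdef
  have hKmem : ∀ v, v ∈ K ↔ S v = (μ : ℂ) • v := fun v => Module.End.mem_eigenspace_iff
  have hK : ∀ a, ∀ v ∈ K, π a v ∈ K := fun a v hv => by
    rw [hKmem] at hv ⊢
    refine ext_inner_left ℂ fun w => ?_
    have h1 : w = π a ((π a)⁻¹ w) := ((π a).apply_symm_apply w).symm
    rw [hSin, h1, ← map_inv, hT a v, hT a (π a⁻¹ w), (σ a).inner_map_map, ← hSin, hv, inner_smul_right,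
      inner_smul_right, (π a).inner_map_map]
  set L : Submodule ℂ W := K.map T with hLdef
  have hL : ∀ a, ∀ w ∈ L, σ a w ∈ L := by
    rintro a _ ⟨v, hv, rfl⟩
    exact ⟨π a v, hK a v hv, hT a v⟩
  have hTorth : ∀ v ∈ Kᗮ, T v ∈ Lᗮ := by
    rintro v hv _ ⟨w, hw, rfl⟩
    rw [← hSin', (hKmem w).1 hw, inner_smul_left, hv w hw, mul_zero]
  have hTnorm : ∀ v ∈ K, ‖T v‖ = s * ‖v‖ := fun v hv => by
    rw [← sq_eq_sq₀ (norm_nonneg _) (by positivity), hTμ v ((hKmem v).1 hv), mul_pow, hss]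
  have hTinj : Set.InjOn T K := fun v hv w hw h => by
    have h1 := hTnorm (v - w) (K.sub_mem hv hw)
    rw [map_sub, h, sub_self, norm_zero] at h1
    rcases mul_eq_zero.1 h1.symm with h2 | h2
    · exact (hs0.ne' h2).elim
    · exact sub_eq_zero.1 (norm_eq_zero.1 h2)
  let eKL : K ≃ₗ[ℂ] L := LinearEquiv.ofBijective
    (T.restrict (q := L) fun v hv => Submodule.mem_map_of_mem hv)
    ⟨fun v w h => Subtype.ext (hTinj v.2 w.2 (congrArg Subtype.val h)), by
      rintro ⟨_, v, hv, rfl⟩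
      exact ⟨⟨v, hv⟩, rfl⟩⟩
  have hχK : uchar (subRep π K hK) = uchar (subRep σ L hL) :=
    uchar_eq_of_equiv _ _ eKL fun a v => Subtype.ext (hT a v)
  -- `T` identifies `K` with its image `L`, so their characters cancel and the complements again
  -- have equal characters.
  have hχ' : uchar (subRep π Kᗮ (orthogonal_invariant π K hK))
      = uchar (subRep σ Lᗮ (orthogonal_invariant σ L hL)) := by
    funext a
    have h1 := congrFun hχ a
    rw [uchar_eq_add_orthogonal π K hK, uchar_eq_add_orthogonal σ L hL, hχK] at h1
    exact add_left_cancel h1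
  have hKtop : Kᗮ ≠ ⊤ := fun h => by
    have h1 : v₀ ∈ Kᗮ := h ▸ Submodule.mem_top
    have h2 := h1 v₀ ((hKmem v₀).2 hv₀)
    exact hv₀0 (inner_self_eq_zero.1 h2)
  set T' : Kᗮ →ₗ[ℂ] Lᗮ := T.restrict hTorth with hT'
  obtain ⟨B, hB, hBT⟩ := ih Kᗮ Lᗮ hKtop _ _ hχ' T' (fun a v => Subtype.ext (hT a v))
    fun v => hT1 v
  obtain ⟨U, hU, hUK, hUKo⟩ := exists_glue π σ K L hK ((s⁻¹ : ℂ) • T)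
    (fun v hv => L.smul_mem _ (Submodule.mem_map_of_mem hv))
    (fun v hv => by
      rw [LinearMap.smul_apply, norm_smul, hTnorm v hv, norm_inv, Complex.norm_real,
        Real.norm_of_nonneg hs0.le, inv_mul_cancel_left₀ hs0.ne'])
    (fun a v _ => by
      rw [LinearMap.smul_apply, LinearMap.smul_apply, hT, map_smul]) B
    (fun a v => by rw [hB]; rfl)
  refine ⟨U, hU, ?_⟩
  rw [hsN_sq_eq_add K, hsN_sq_eq_add K T, ← K.finrank_add_finrank_orthogonal]
  have hUK' : U.toLinearMap ∘ₗ K.subtype = ((s⁻¹ : ℝ) : ℂ) • (T ∘ₗ K.subtype) := by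
    refine LinearMap.ext fun v => ?_
    rw [Complex.ofReal_inv]
    exact hUK v v.2
  have e0 : hsN (U.toLinearMap ∘ₗ K.subtype) ^ 2 = Module.finrank ℂ K :=
    hsN_sq_of_isometry _ fun v => U.norm_map v
  have e1 : hsN (T ∘ₗ K.subtype) ^ 2 = μ * Module.finrank ℂ K := by
    rw [hUK', hsN_smul, mul_pow, Complex.norm_real, Real.norm_of_nonneg (inv_nonneg.2 hs0.le),
      inv_pow, hss] at e0
    rw [← e0, mul_inv_cancel_left₀ hμpos.ne']
  have e2 : hsN ((U.toLinearMap - T) ∘ₗ K.subtype) ^ 2 = (1 - s) ^ 2 * Module.finrank ℂ K := by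
    have h1 : (U.toLinearMap - T) ∘ₗ K.subtype = ((s⁻¹ - 1 : ℝ) : ℂ) • (T ∘ₗ K.subtype) := by
      rw [LinearMap.sub_comp, hUK', Complex.ofReal_sub, sub_smul, Complex.ofReal_one, one_smul]
    rw [h1, hsN_smul, mul_pow, Complex.norm_real, Real.norm_eq_abs, sq_abs, e1, ← hss, ← mul_assoc,
      ← mul_pow, sub_mul, inv_mul_cancel₀ hs0.ne', one_mul]
  have e3 : hsN ((U.toLinearMap - T) ∘ₗ Kᗮ.subtype) ≤ hsN (B.toLinearMap - T') := by
    have h1 : (U.toLinearMap - T) ∘ₗ Kᗮ.subtype = Lᗮ.subtype ∘ₗ (B.toLinearMap - T') := by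
      refine LinearMap.ext fun v => ?_
      change U v - T v = ((B v - T' v : Lᗮ) : W)
      rw [hUKo]
      rfl
    rw [h1]
    exact hsN_comp_le_left _ (fun _ => le_rfl) _
  have e4 : hsN (T ∘ₗ Kᗮ.subtype) ≤ hsN T' := by
    have h1 : T ∘ₗ Kᗮ.subtype = Lᗮ.subtype ∘ₗ T' := rfl
    rw [h1]
    exact hsN_comp_le_left _ (fun _ => le_rfl) _
  have e5 := pow_le_pow_left₀ (hsN_nonneg _) e3 2
  have e6 := pow_le_pow_left₀ (hsN_nonneg _) e4 2
  rw [e1, e2]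
  push_cast
  -- Since `0 ≤ s ≤ 1`, one has `(1 - s) ^ 2 ≤ 1 - s ^ 2`, and the right side is the defect of `T`
  -- on `K`.
  have e7 : (1 - s) ^ 2 * (Module.finrank ℂ K : ℝ) ≤ (1 - μ) * Module.finrank ℂ K := by
    gcongr
    rw [← hss]
    nlinarith
  linarith

end PolarDecomposition

/-- A contractive intertwiner between unitary representations of a finite group with the same
character is close to a unitary one, in terms of its defect from being isometric. -/
theorem exists_unitary_intertwiner_near {H : Type*} [Group H] [Finite H] {V W : Type*}
    [NormedAddCommGroup V] [InnerProductSpace ℂ V] [FiniteDimensional ℂ V]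
    [NormedAddCommGroup W] [InnerProductSpace ℂ W] [FiniteDimensional ℂ W]
    (π : H →* (V ≃ₗᵢ[ℂ] V)) (σ : H →* (W ≃ₗᵢ[ℂ] W)) (hχ : uchar π = uchar σ) (T : V →ₗ[ℂ] W)
    (hT : ∀ a v, T (π a v) = σ a (T v)) (hT1 : ∀ v, ‖T v‖ ≤ ‖v‖) :
    ∃ U : V →ₗᵢ[ℂ] W, (∀ a v, U (π a v) = σ a (U v)) ∧
      hsN (U.toLinearMap - T) ^ 2 ≤ Module.finrank ℂ V - hsN T ^ 2 := by
  induction hn : Module.finrank ℂ V using Nat.strong_induction_on generalizing V W with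
  | _ n ih =>
  have key : ∀ T : V →ₗ[ℂ] W, (∀ a v, T (π a v) = σ a (T v)) → (∀ v, ‖T v‖ ≤ ‖v‖) → T ≠ 0 →
      ∃ U : V →ₗᵢ[ℂ] W, (∀ a v, U (π a v) = σ a (U v)) ∧
        hsN (U.toLinearMap - T) ^ 2 ≤ Module.finrank ℂ V - hsN T ^ 2 := by
    refine fun T hT hT1 hT0 => exists_unitary_intertwiner_near_of_ne_zero ?_ π σ hχ T hT hT1 hT0
    intro K L hK π' σ' hχ' T' hT' hT1'
    exact ih _ (hn ▸ Submodule.finrank_lt hK) π' σ' hχ' T' hT' hT1' rfl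
  rw [← hn]
  by_cases hT0 : T = 0
  swap
  · exact key T hT hT1 hT0
  subst hT0
  have hz : hsN (0 : V →ₗ[ℂ] W) = 0 := by simpa using hsN_smul (0 : ℂ) (0 : V →ₗ[ℂ] W)
  rcases subsingleton_or_nontrivial V with hV | hV
  · refine ⟨⟨0, fun v => by simp [Subsingleton.elim v 0]⟩, fun a v => by simp, ?_⟩
    have h0 : Module.finrank ℂ V = 0 := Module.finrank_zero_of_subsingleton
    change hsN (0 - 0 : V →ₗ[ℂ] W) ^ 2 ≤ _
    rw [sub_self, hz, h0]
    simp
  -- For `T = 0` the bound is the full dimension, so any isometric intertwiner will do. One comes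
  -- from a nonzero intertwiner rescaled to a contraction.
  · obtain ⟨T₁, hT₁0, hT₁⟩ := exists_intertwiner_ne_zero π σ hχ
    set c : ℝ := ‖LinearMap.toContinuousLinearMap T₁‖ with hc
    have hle : ∀ v, ‖T₁ v‖ ≤ c * ‖v‖ := fun v => (LinearMap.toContinuousLinearMap T₁).le_opNorm v
    have hcpos : 0 < c := by
      refine lt_of_le_of_ne (norm_nonneg _) fun h => hT₁0 (LinearMap.ext fun v => ?_)
      have := hle v
      rw [← h, zero_mul] at this
      simpa using this
    obtain ⟨U, hU, -⟩ := key ((c⁻¹ : ℂ) • T₁)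
      (fun a v => by rw [LinearMap.smul_apply, LinearMap.smul_apply, hT₁, map_smul])
      (fun v => by
        rw [LinearMap.smul_apply, norm_smul, norm_inv, Complex.norm_real,
          Real.norm_of_nonneg hcpos.le, inv_mul_le_iff₀ hcpos]
        exact hle v)
      (smul_ne_zero (by simpa using hcpos.ne') hT₁0)
    refine ⟨U, hU, ?_⟩
    rw [sub_zero, hz, hsN_sq_of_isometry _ fun v => U.norm_map v]
    simp

/-! ### Class sums and the kinds of unitary representations -/

section UnitaryRays

set_option linter.unusedSectionVars false

variable {H G : Type*} [Group H] [Group G]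

open Classical in
/-- The sum, in the group algebra of `F`, of the conjugates of `g` in `F`. -/
noncomputable def conjSum (F : Subgroup G) [Fintype F] (g : G) : MonoidAlgebra ℂ F :=
  ∑ f ∈ Finset.univ.filter (fun f : F => IsConj g f), MonoidAlgebra.single f 1

variable {Y : Type*} [NormedAddCommGroup Y] [InnerProductSpace ℂ Y] [FiniteDimensional ℂ Y]

open Classical in
theorem asAlgebraHom_conjSum (F : Subgroup G) [Fintype F] (ψ : G →* (Y ≃ₗᵢ[ℂ] Y)) (g : G) (y : Y) :
    (linRep (ψ.comp F.subtype)).asAlgebraHom (conjSum F g) y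
      = ∑ f ∈ Finset.univ.filter (fun f : F => IsConj g f), ψ f y := by
  rw [conjSum, map_sum, LinearMap.sum_apply]
  refine Finset.sum_congr rfl fun f _ => ?_
  rw [Representation.asAlgebraHom_single, one_smul]
  rfl

/-- The sum runs over a full class under `G`, not only under `F`, so conjugation by any `a` in `G`
permutes its terms. -/
theorem conjSum_comm (F : Subgroup G) [F.Normal] [Fintype F] (ψ : G →* (Y ≃ₗᵢ[ℂ] Y)) (g a : G) (y : Y) :
    (linRep (ψ.comp F.subtype)).asAlgebraHom (conjSum F g) (ψ a y)
      = ψ a ((linRep (ψ.comp F.subtype)).asAlgebraHom (conjSum F g) y) := by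
  classical
  rw [asAlgebraHom_conjSum, asAlgebraHom_conjSum, map_sum]
  refine Finset.sum_nbij' (fun f => ⟨a⁻¹ * f * a, by
      simpa using Subgroup.Normal.conj_mem ‹_› (f : G) f.2 a⁻¹⟩)
    (fun f => ⟨a * f * a⁻¹, Subgroup.Normal.conj_mem ‹_› (f : G) f.2 a⟩) ?_ ?_ ?_ ?_ ?_
  · intro f hf
    simp only [Finset.mem_filter, Finset.mem_univ, true_and] at hf ⊢
    exact hf.trans (isConj_iff.2 ⟨a⁻¹, by simp⟩)
  · intro f hf
    simp only [Finset.mem_filter, Finset.mem_univ, true_and] at hf ⊢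
    exact hf.trans (isConj_iff.2 ⟨a, by simp⟩)
  · intro f _
    ext
    simp [mul_assoc]
  · intro f _
    ext
    simp [mul_assoc]
  · intro f _
    change (ψ f * ψ a) y = (ψ a * ψ (a⁻¹ * f * a)) y
    rw [← map_mul, ← map_mul]
    congr 2
    group

/-- Inversion exchanges the classes of `g` and `g⁻¹`. Class sums therefore have self-adjoint real
and imaginary parts built from class sums. -/
theorem conjSum_inner (F : Subgroup G) [Fintype F] (ψ : G →* (Y ≃ₗᵢ[ℂ] Y)) (g : G) (x y : Y) :
    inner ℂ ((linRep (ψ.comp F.subtype)).asAlgebraHom (conjSum F g) x) y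
      = inner ℂ x ((linRep (ψ.comp F.subtype)).asAlgebraHom (conjSum F g⁻¹) y) := by
  classical
  rw [asAlgebraHom_conjSum, asAlgebraHom_conjSum, sum_inner, inner_sum]
  have hinv : ∀ a b : G, IsConj a b → IsConj a⁻¹ b⁻¹ := fun a b h => by
    obtain ⟨c, rfl⟩ := isConj_iff.1 h
    exact isConj_iff.2 ⟨c, by group⟩
  refine Finset.sum_nbij' (fun f => f⁻¹) (fun f => f⁻¹) ?_ ?_ ?_ ?_ ?_
  · intro f hf
    simp only [Finset.mem_filter, Finset.mem_univ, true_and] at hf ⊢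
    exact hinv _ _ hf
  · intro f hf
    simp only [Finset.mem_filter, Finset.mem_univ, true_and] at hf ⊢
    simpa using hinv _ _ hf
  · intro f _
    simp
  · intro f _
    simp
  · intro f _
    have h := (ψ f).inner_map_map x ((ψ f)⁻¹ y)
    rw [show ψ f ((ψ f)⁻¹ y) = y from (ψ f).apply_symm_apply y] at h
    rw [h]
    simp

/-- If the image of `H` lies in a finite normal subgroup of `G`, then every finite-dimensional
unitary representation of `G` splits orthogonally into finitely many kinds of subrepresentations,
and the character over `H` of a piece is determined by its kind and its dimension. -/
theorem exists_unitary_rays (i : H →* G) (F : Subgroup G) [F.Normal] [Finite F] [Finite H]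
    (hF : ∀ h, i h ∈ F) :
    ∃ (k : ℕ) (c : Fin k → H → ℂ), ∀ (Y : Type) [NormedAddCommGroup Y] [InnerProductSpace ℂ Y]
      [FiniteDimensional ℂ Y] (ψ : G →* (Y ≃ₗᵢ[ℂ] Y)),
      ∃ (N : Fin k → Submodule ℂ Y) (hinv : ∀ r g, ∀ v ∈ N r, ψ g v ∈ N r),
        OrthogonalFamily ℂ (fun r => N r) (fun r => (N r).subtypeₗᵢ) ∧ DirectSum.IsInternal N ∧
        ∀ r h, uchar (subRep ψ (N r) (hinv r)) (i h) = Module.finrank ℂ (N r) * c r h := by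
  classical
  have := Fintype.ofFinite F
  have hfd : Module.Finite ℂ (MonoidAlgebra ℂ F) := inferInstance
  -- Twice the real part of the class sum, and minus twice its imaginary part: a commuting family
  -- acting by symmetric operators.
  let ξ : H × Bool → MonoidAlgebra ℂ F := fun j =>
    if j.2 then conjSum F (i j.1) + conjSum F (i j.1)⁻¹
    else Complex.I • (conjSum F (i j.1) - conjSum F (i j.1)⁻¹)
  -- Minimal polynomials are taken in the group algebra, so the possible joint eigenvalues form a
  -- finite set independent of the representation.
  let R : Set (H × Bool → ℂ) := {γ | ∀ j, γ j ∈ (minpoly ℂ (ξ j)).rootSet ℂ}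
  have hR : R.Finite := by
    have := Set.Finite.pi fun j => (minpoly ℂ (ξ j)).rootSet_finite ℂ
    refine this.subset fun γ hγ j _ => hγ j
  have : Finite R := hR
  obtain ⟨k, ⟨eR⟩⟩ := Finite.exists_equiv_fin R
  let cnt : H → ℕ := fun h => (Finset.univ.filter (fun f : F => IsConj (i h) f)).card
  refine ⟨k, fun r h => ((eR.symm r : H × Bool → ℂ) (h, true)
    - Complex.I * (eR.symm r : H × Bool → ℂ) (h, false)) / 2 / cnt h, ?_⟩
  intro Y _ _ _ ψ
  set A := (linRep (ψ.comp F.subtype)).asAlgebraHom with hA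
  let T : H × Bool → Module.End ℂ Y := fun j => A (ξ j)
  have hTtrue : ∀ h y, T (h, true) y = A (conjSum F (i h)) y + A (conjSum F (i h)⁻¹) y := by
    intro h y
    simp [T, ξ]
  have hTfalse : ∀ h y, T (h, false) y
      = Complex.I • (A (conjSum F (i h)) y - A (conjSum F (i h)⁻¹) y) := by
    intro h y
    simp [T, ξ]
  have hTψ : ∀ j a y, T j (ψ a y) = ψ a (T j y) := by
    rintro ⟨h, b⟩ a y
    cases b
    · rw [hTfalse, hTfalse, conjSum_comm, conjSum_comm, ← map_sub, map_smul]
    · rw [hTtrue, hTtrue, conjSum_comm, conjSum_comm, ← map_add]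
  have hTA : ∀ j g y, T j (A (conjSum F g) y) = A (conjSum F g) (T j y) := by
    intro j g y
    rw [hA, asAlgebraHom_conjSum, asAlgebraHom_conjSum, map_sum]
    exact Finset.sum_congr rfl fun f _ => hTψ _ _ _
  have hcomm : Pairwise (Function.onFun Commute T) := by
    rintro j ⟨h, b⟩ -
    refine LinearMap.ext fun y => ?_
    change T j (T (h, b) y) = T (h, b) (T j y)
    cases b
    · rw [hTfalse, hTfalse, map_smul, map_sub, hTA, hTA]
    · rw [hTtrue, hTtrue, map_add, hTA, hTA]
  have hsymm : ∀ j, (T j).IsSymmetric := by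
    rintro ⟨h, b⟩ x y
    cases b
    · rw [hTfalse, hTfalse, inner_smul_left, inner_smul_right, inner_sub_left, inner_sub_right,
        conjSum_inner, conjSum_inner, inv_inv, Complex.conj_I]
      ring
    · rw [hTtrue, hTtrue, inner_add_left, inner_add_right, conjSum_inner, conjSum_inner, inv_inv,
        add_comm]
  let E : (H × Bool → ℂ) → Submodule ℂ Y := fun γ => ⨅ j, Module.End.eigenspace (T j) (γ j)
  have hEmem : ∀ γ v, v ∈ E γ ↔ ∀ j, T j v = γ j • v := fun γ v => by
    simp only [E, Submodule.mem_iInf, Module.End.mem_eigenspace_iff]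
  have hErange : ∀ γ, E γ ≠ ⊥ → γ ∈ R := by
    intro γ hγ j
    obtain ⟨v, hv, hv0⟩ := Submodule.exists_mem_ne_zero_of_ne_bot hγ
    have hev : Module.End.HasEigenvector (T j) (γ j) v :=
      ⟨Module.End.mem_eigenspace_iff.2 ((hEmem γ v).1 hv j), hv0⟩
    have h1 := Module.End.aeval_apply_of_hasEigenvector (p := minpoly ℂ (ξ j)) hev
    have h2 : Polynomial.aeval (T j) (minpoly ℂ (ξ j)) = 0 := by
      rw [Polynomial.aeval_algHom_apply, minpoly.aeval, map_zero]
    rw [h2, LinearMap.zero_apply] at h1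
    rw [Polynomial.mem_rootSet]
    refine ⟨minpoly.ne_zero (Algebra.IsIntegral.isIntegral (R := ℂ) (ξ j)), ?_⟩
    have h3 := (smul_eq_zero.1 h1.symm).resolve_right hv0
    simpa using h3
  have horth : OrthogonalFamily ℂ (fun r => E (eR.symm r))
      (fun r => (E (eR.symm r : H × Bool → ℂ)).subtypeₗᵢ) :=
    fun r s hrs v w => LinearMap.IsSymmetric.orthogonalFamily_iInf_eigenspaces hsymm
      (fun h => hrs (eR.symm.injective (Subtype.ext h))) v w
  have hint : DirectSum.IsInternal fun r => E (eR.symm r) := by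
    rw [OrthogonalFamily.isInternal_iff horth, Submodule.orthogonal_eq_bot_iff, eq_top_iff,
      ← LinearMap.IsSymmetric.iSup_iInf_eq_top_of_commute hsymm hcomm]
    refine iSup_le fun γ => ?_
    by_cases hγ : E γ = ⊥
    · exact hγ.le.trans bot_le
    · refine le_trans ?_ (le_iSup _ (eR ⟨γ, hErange γ hγ⟩))
      rw [Equiv.symm_apply_apply]
  have hinv : ∀ r g, ∀ v ∈ E (eR.symm r), ψ g v ∈ E (eR.symm r) := fun r g v hv => by
    rw [hEmem] at hv ⊢
    intro j
    rw [hTψ, hv, map_smul]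
  refine ⟨fun r => E (eR.symm r), hinv, horth, hint, fun r h => ?_⟩
  set γ : H × Bool → ℂ := (eR.symm r : H × Bool → ℂ) with hγ
  have hz : ∀ v ∈ E γ, A (conjSum F (i h)) v = ((γ (h, true) - Complex.I * γ (h, false)) / 2) • v := by
    intro v hv
    rw [hEmem] at hv
    have h1 := hv (h, true)
    have h2 := hv (h, false)
    rw [hTtrue] at h1
    rw [hTfalse] at h2
    have h3 : Complex.I • Complex.I • (A (conjSum F (i h)) v - A (conjSum F (i h)⁻¹) v)
        = -(A (conjSum F (i h)) v - A (conjSum F (i h)⁻¹) v) := by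
      rw [smul_smul, Complex.I_mul_I, neg_one_smul]
    rw [h2, smul_smul] at h3
    have h4 : (2 : ℂ) • A (conjSum F (i h)) v = (γ (h, true) - Complex.I * γ (h, false)) • v := by
      rw [sub_smul, ← h1, h3, two_smul]
      abel
    rw [div_eq_inv_mul, mul_smul, ← h4, smul_smul, inv_mul_cancel₀ two_ne_zero, one_smul]
  -- The class sum acts on the piece as a scalar, which determines its trace. The summands are
  -- conjugate in `G` and have equal traces, so each is that trace divided by the class size.
  have hsum : ∑ f ∈ Finset.univ.filter (fun f : F => IsConj (i h) f),
      uchar (subRep ψ (E γ) (hinv r)) (f : G)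
      = Module.finrank ℂ (E γ) * ((γ (h, true) - Complex.I * γ (h, false)) / 2) := by
    simp only [uchar]
    rw [← map_sum]
    have h1 : ∑ f ∈ Finset.univ.filter (fun f : F => IsConj (i h) f),
        unitaryOp (subRep ψ (E γ) (hinv r) (f : G))
        = ((γ (h, true) - Complex.I * γ (h, false)) / 2) • LinearMap.id := by
      refine LinearMap.ext fun v => Subtype.ext ?_
      rw [LinearMap.sum_apply, Submodule.coe_sum, LinearMap.smul_apply, LinearMap.id_apply,
        Submodule.coe_smul, ← hz v v.2, hA, asAlgebraHom_conjSum]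
      rfl
    rw [h1, map_smul, LinearMap.trace_id, smul_eq_mul, mul_comm]
  have hconst : ∀ f ∈ Finset.univ.filter (fun f : F => IsConj (i h) f),
      uchar (subRep ψ (E γ) (hinv r)) (f : G) = uchar (subRep ψ (E γ) (hinv r)) (i h) := by
    intro f hf
    obtain ⟨a, ha⟩ := isConj_iff.1 (Finset.mem_filter.1 hf).2
    rw [← ha]
    exact (linRep (subRep ψ (E γ) (hinv r))).char_conj (i h) a
  rw [Finset.sum_congr rfl hconst, Finset.sum_const, nsmul_eq_mul] at hsum
  have hcnt : (cnt h : ℂ) ≠ 0 := by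
    have : 0 < cnt h := Finset.card_pos.2 ⟨⟨i h, hF h⟩, Finset.mem_filter.2 ⟨Finset.mem_univ _, IsConj.refl _⟩⟩
    exact_mod_cast this.ne'
  change uchar (subRep ψ (E γ) (hinv r)) (i h) = _
  rw [mul_div_assoc', eq_div_iff hcnt, ← hsum, mul_comm]

end UnitaryRays

/-! ### Modifying and matching unitary representations -/

section UnitaryEnlarge

set_option linter.unusedSectionVars false

variable {G H : Type*} [Group G] [Group H]
  {X Y V W : Type*} [NormedAddCommGroup V] [InnerProductSpace ℂ V] [FiniteDimensional ℂ V]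
  [NormedAddCommGroup W] [InnerProductSpace ℂ W] [FiniteDimensional ℂ W]
  [NormedAddCommGroup X] [InnerProductSpace ℂ X] [FiniteDimensional ℂ X]
  [NormedAddCommGroup Y] [InnerProductSpace ℂ Y] [FiniteDimensional ℂ Y]

theorem unitaryRep_mul_apply (π : G →* (V ≃ₗᵢ[ℂ] V)) (a b : G) (v : V) :
    π (a * b) v = π a (π b v) := by
  rw [map_mul]
  rfl

/-- A unitary representation can be made trivial on an invariant subspace. -/
theorem exists_trivial_on (ψ : G →* (Y ≃ₗᵢ[ℂ] Y)) (L : Submodule ℂ Y)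
    (hL : ∀ g, ∀ y ∈ L, ψ g y ∈ L) :
    ∃ ψ' : G →* (Y ≃ₗᵢ[ℂ] Y), (∀ g, ∀ y ∈ L, ψ' g y = y) ∧ ∀ g, ∀ y ∈ Lᗮ, ψ' g y = ψ g y := by
  let π := prodRep (1 : G →* (L ≃ₗᵢ[ℂ] L)) (subRep ψ Lᗮ (orthogonal_invariant ψ L hL))
  let e := L.orthogonalDecomposition
  have he : ∀ v, e v = WithLp.toLp 2 (L.orthogonalProjectionOnto v, Lᗮ.orthogonalProjectionOnto v) :=
    fun v => L.orthogonalDecomposition_apply v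
  refine ⟨{ toFun := fun g => e.trans ((π g).trans e.symm)
            map_one' := ?_
            map_mul' := fun a b => ?_ }, fun g y hy => ?_, fun g y hy => ?_⟩
  · ext y
    simp
  · ext y
    simp
  · change e.symm (π g (e y)) = y
    rw [LinearIsometryEquiv.symm_apply_eq, he, prodRep_apply]
    congr 2
    rw [Submodule.orthogonalProjectionOnto_apply_of_mem_orthogonal
      (K := Lᗮ) (by rwa [Submodule.orthogonal_orthogonal])]
    exact map_zero (subRep ψ Lᗮ (orthogonal_invariant ψ L hL) g)
  · change e.symm (π g (e y)) = ψ g y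
    have h1 := orthogonal_invariant ψ L hL g y hy
    rw [LinearIsometryEquiv.symm_apply_eq, he, he, prodRep_apply,
      Submodule.orthogonalProjectionOnto_apply_of_mem_orthogonal hy,
      Submodule.orthogonalProjectionOnto_apply_of_mem_orthogonal h1,
      Submodule.orthogonalProjectionOnto_mem_subspace_eq_self (⟨y, hy⟩ : Lᗮ),
      Submodule.orthogonalProjectionOnto_mem_subspace_eq_self (⟨_, h1⟩ : Lᗮ)]
    rfl

/-- Only the restriction to `L` contributes, and there each isometry has squared norm `finrank L`.
-/
theorem hsN_sub_sq_le_of_eqOn_orthogonal (A B : X →ₗ[ℂ] Y) (hA : ∀ x, ‖A x‖ = ‖x‖)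
    (hB : ∀ x, ‖B x‖ = ‖x‖) (L : Submodule ℂ X) (h : ∀ x ∈ Lᗮ, A x = B x) :
    hsN (A - B) ^ 2 ≤ 4 * Module.finrank ℂ L := by
  have h0 : (A - B) ∘ₗ Lᗮ.subtype = 0 := LinearMap.ext fun x => by simp [h x x.2]
  have hz : hsN (0 : Lᗮ →ₗ[ℂ] Y) = 0 := by simpa using hsN_smul (0 : ℂ) (0 : Lᗮ →ₗ[ℂ] Y)
  have h1 := hsN_sq_of_isometry (A ∘ₗ L.subtype) fun x => hA x
  have h2 := hsN_sq_of_isometry (B ∘ₗ L.subtype) fun x => hB x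
  have h3 := hsN_sub_le (A ∘ₗ L.subtype) (B ∘ₗ L.subtype)
  rw [← LinearMap.sub_comp] at h3
  rw [hsN_sq_eq_add L, h0, hz]
  nlinarith [hsN_nonneg ((A - B) ∘ₗ L.subtype), hsN_nonneg (A ∘ₗ L.subtype),
    hsN_nonneg (B ∘ₗ L.subtype), sq_nonneg (hsN (A ∘ₗ L.subtype) - hsN (B ∘ₗ L.subtype))]

theorem finrank_finset_sup_le {ι : Type*} (s : Finset ι) (N : ι → Submodule ℂ V) :
    Module.finrank ℂ (s.sup N : Submodule ℂ V) ≤ ∑ r ∈ s, Module.finrank ℂ (N r) := by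
  classical
  induction s using Finset.induction_on with
  | empty => simp
  | insert a s ha ih =>
    rw [Finset.sup_insert, Finset.sum_insert ha]
    exact (Submodule.finrank_add_le_finrank_add_finrank _ _).trans (by gcongr)

/-- Making a unitary representation trivial on some pieces, and adding a further representation. -/
theorem exists_unitary_enlarge {Y : Type} [NormedAddCommGroup Y] [InnerProductSpace ℂ Y]
    [FiniteDimensional ℂ Y] (i : H →* G) {k : ℕ} (c : Fin k → H → ℂ) (ψ : G →* (Y ≃ₗᵢ[ℂ] Y))
    (N : Fin k → Submodule ℂ Y) (hinv : ∀ r g, ∀ v ∈ N r, ψ g v ∈ N r)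
    (horth : OrthogonalFamily ℂ (fun r => N r) (fun r => (N r).subtypeₗᵢ))
    (hint : DirectSum.IsInternal N)
    (hc : ∀ r h, uchar (subRep ψ (N r) (hinv r)) (i h) = Module.finrank ℂ (N r) * c r h)
    (J : Finset (Fin k)) {χ : G → ℂ} (hχ : IsUChar χ) :
    ∃ (Y' : Type) (_ : NormedAddCommGroup Y') (_ : InnerProductSpace ℂ Y')
      (_ : FiniteDimensional ℂ Y') (V : Y →ₗᵢ[ℂ] Y') (ψ' : G →* (Y' ≃ₗᵢ[ℂ] Y')),
      (∀ h, uchar ψ' (i h) = ∑ r ∈ J, Module.finrank ℂ (N r) * c r h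
        + (∑ r ∈ Jᶜ, Module.finrank ℂ (N r) : ℕ) + χ (i h)) ∧
      (Module.finrank ℂ Y' : ℂ) = Module.finrank ℂ Y + χ 1 ∧
      ∀ g, hsN (unitaryOp (ψ' g) ∘ₗ V.toLinearMap - V.toLinearMap ∘ₗ unitaryOp (ψ g)) ^ 2
        ≤ 4 * ∑ r ∈ Jᶜ, (Module.finrank ℂ (N r) : ℝ) := by
  set L : Submodule ℂ Y := Jᶜ.sup N with hLdef
  have hL : ∀ g, ∀ y ∈ L, ψ g y ∈ L := by
    intro g
    have h1 : L ≤ L.comap (unitaryOp (ψ g)) := Finset.sup_le fun r hr v hv =>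
      (Finset.le_sup hr : N r ≤ L) (hinv r g v hv)
    exact h1
  have hN1 : ∀ r ∈ Jᶜ, N r ≤ L := fun r hr => Finset.le_sup hr
  -- Orthogonality of the pieces ensures that making `L` trivial leaves the pieces in `J` untouched.
  have hN2 : ∀ r ∈ J, N r ≤ Lᗮ := by
    intro r hr
    rw [Submodule.le_orthogonal_iff_le_orthogonal]
    refine Finset.sup_le fun s hs v hv w hw => ?_
    have hrs : r ≠ s := by
      rintro rfl
      exact Finset.mem_compl.1 hs hr
    exact horth hrs ⟨w, hw⟩ ⟨v, hv⟩
  obtain ⟨ψ₀, h1, h2⟩ := exists_trivial_on ψ L hL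
  obtain ⟨A, _, _, _, π, rfl⟩ := hχ
  let V : Y →ₗᵢ[ℂ] WithLp 2 (Y × A) :=
    { toFun := fun y => WithLp.toLp 2 (y, 0)
      map_add' := fun x y => by
        rw [← WithLp.toLp_add]
        simp
      map_smul' := fun c y => by
        rw [RingHom.id_apply, ← WithLp.toLp_smul]
        simp
      norm_map' := fun y => by simp }
  have hinv₀ : ∀ r g, ∀ v ∈ N r, ψ₀ g v ∈ N r := by
    intro r g v hv
    by_cases hr : r ∈ J
    · rw [h2 g v (hN2 r hr hv)]
      exact hinv r g v hv
    · rwa [h1 g v (hN1 r (Finset.mem_compl.2 hr) hv)]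
  refine ⟨WithLp 2 (Y × A), inferInstance, inferInstance, inferInstance, V, prodRep ψ₀ π,
    fun h => ?_, ?_, fun g => ?_⟩
  · rw [uchar_prodRep, uchar_eq_sum_subRep hint ψ₀ hinv₀, ← Finset.sum_add_sum_compl J]
    push_cast
    congr 2
    · refine Finset.sum_congr rfl fun r hr => ?_
      rw [← hc, uchar, uchar]
      congr 1
      exact LinearMap.ext fun v => Subtype.ext (h2 _ v (hN2 r hr v.2))
    · refine Finset.sum_congr rfl fun r hr => ?_
      rw [← uchar_one (subRep ψ₀ (N r) (hinv₀ r)), uchar, uchar]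
      congr 1
      refine LinearMap.ext fun v => Subtype.ext ?_
      exact (h1 _ v (hN1 r hr v.2)).trans (by simp)
  · rw [finrank_prodL2, uchar_one]
    push_cast
    rfl
  · have hle : (Module.finrank ℂ L : ℝ) ≤ ∑ r ∈ Jᶜ, (Module.finrank ℂ (N r) : ℝ) := by
      exact_mod_cast finrank_finset_sup_le Jᶜ N
    refine le_trans (hsN_sub_sq_le_of_eqOn_orthogonal _ _ (fun y => ?_) (fun y => ?_) L
      fun y hy => ?_) (mul_le_mul_of_nonneg_left hle (by norm_num))
    · exact ((prodRep ψ₀ π g).norm_map _).trans (V.norm_map y)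
    · exact (V.norm_map _).trans ((ψ g).norm_map y)
    · change WithLp.toLp 2 (ψ₀ g y, π g 0) = WithLp.toLp 2 (ψ g y, 0)
      rw [h2 g y hy, map_zero]

/-- The traces of two unitaries, one almost extending the other, are close. -/
theorem norm_trace_sub_trace_le (ι : X →ₗᵢ[ℂ] Y) (U : X ≃ₗᵢ[ℂ] X) (B : Y ≃ₗᵢ[ℂ] Y) :
    ‖LinearMap.trace ℂ Y (unitaryOp B) - LinearMap.trace ℂ X (unitaryOp U)‖
      ≤ √(Module.finrank ℂ Y) * √(Module.finrank ℂ Y - Module.finrank ℂ X)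
        + √(Module.finrank ℂ X)
          * hsN (unitaryOp B ∘ₗ ι.toLinearMap - ι.toLinearMap ∘ₗ unitaryOp U) := by
  set j : X →ₗ[ℂ] Y := ι.toLinearMap with hj
  have hjj : LinearMap.adjoint j ∘ₗ j = LinearMap.id :=
    adjoint_comp_self_of_isometry j ι.norm_map
  set Q : Y →ₗ[ℂ] Y := LinearMap.id - j ∘ₗ LinearMap.adjoint j with hQ
  have hQadj : LinearMap.adjoint Q = Q := by
    rw [hQ, map_sub, LinearMap.adjoint_id, LinearMap.adjoint_comp, LinearMap.adjoint_adjoint]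
  have hQQ : Q ∘ₗ Q = Q := by
    have h0 : Q ∘ₗ j = 0 := by
      rw [hQ, LinearMap.sub_comp, LinearMap.comp_assoc, hjj, LinearMap.comp_id,
        LinearMap.id_comp, sub_self]
    conv_lhs => rw [hQ]
    rw [LinearMap.comp_sub, ← LinearMap.comp_assoc, ← hQ, h0, LinearMap.comp_id,
      LinearMap.zero_comp, sub_zero]
  have hQn : hsN Q = √(Module.finrank ℂ Y - Module.finrank ℂ X) := by
    rw [← Real.sqrt_sq (hsN_nonneg Q), hsN_sq, hQadj, hQQ, hQ, map_sub, LinearMap.trace_id,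
      LinearMap.trace_comp_comm', hjj, LinearMap.trace_id]
    simp
  have hBn : hsN (LinearMap.adjoint (unitaryOp B)) = √(Module.finrank ℂ Y) := by
    rw [hsN_adjoint, ← hsN_sq_of_isometry (unitaryOp B) B.norm_map, Real.sqrt_sq (hsN_nonneg _)]
  have hjn : hsN j = √(Module.finrank ℂ X) := by
    rw [← hsN_sq_of_isometry j ι.norm_map, Real.sqrt_sq (hsN_nonneg _)]
  -- The trace of `B` splits into the part on the complement of `X` and the part on `X`; each error
  -- term is then bounded by Cauchy–Schwarz.
  have e1 : LinearMap.trace ℂ Y (unitaryOp B) - LinearMap.trace ℂ X (unitaryOp U)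
      = LinearMap.trace ℂ Y (LinearMap.adjoint (LinearMap.adjoint (unitaryOp B)) ∘ₗ Q)
        + LinearMap.trace ℂ X (LinearMap.adjoint j ∘ₗ (unitaryOp B ∘ₗ j - j ∘ₗ unitaryOp U)) := by
    have e2 : LinearMap.trace ℂ Y (unitaryOp B ∘ₗ j ∘ₗ LinearMap.adjoint j)
        = LinearMap.trace ℂ X (LinearMap.adjoint j ∘ₗ unitaryOp B ∘ₗ j) := by
      rw [← LinearMap.comp_assoc, LinearMap.trace_comp_comm']
    rw [LinearMap.adjoint_adjoint, hQ, LinearMap.comp_sub, LinearMap.comp_sub, map_sub, map_sub,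
      e2, ← LinearMap.comp_assoc (unitaryOp U), hjj, LinearMap.comp_id, LinearMap.id_comp]
    ring
  rw [e1]
  refine (norm_add_le _ _).trans (add_le_add ?_ ?_)
  · exact (norm_trace_adjoint_comp_le _ _).trans (by rw [hBn, hQn])
  · exact (norm_trace_adjoint_comp_le _ _).trans (by rw [hjn])

/-- Two isometric embeddings into representations of a finite group with the same character, that
almost intertwine the same maps, almost differ by a unitary intertwiner. -/
theorem exists_unitary_matching [Finite H] (ι : X →ₗᵢ[ℂ] V) (κ : X →ₗᵢ[ℂ] W)
    (π : H →* (V ≃ₗᵢ[ℂ] V)) (σ : H →* (W ≃ₗᵢ[ℂ] W)) (hχ : uchar π = uchar σ)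
    (φ : H → X →ₗ[ℂ] X) {ε : ℝ}
    (h1 : ∀ h, hsN (unitaryOp (π h) ∘ₗ ι.toLinearMap - ι.toLinearMap ∘ₗ φ h) ≤ ε)
    (h2 : ∀ h, hsN (unitaryOp (σ h) ∘ₗ κ.toLinearMap - κ.toLinearMap ∘ₗ φ h) ≤ ε) :
    ∃ e : V ≃ₗᵢ[ℂ] W, (∀ h v, e (π h v) = σ h (e v)) ∧
      hsN (e.toLinearIsometry.toLinearMap ∘ₗ ι.toLinearMap - κ.toLinearMap)
        ≤ √(Module.finrank ℂ V - Module.finrank ℂ X + 4 * √(Module.finrank ℂ X) * ε) + 2 * ε := by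
  have := Fintype.ofFinite H
  have hH : (Fintype.card H : ℂ) ≠ 0 := by exact_mod_cast Fintype.card_ne_zero
  have hH' : (0 : ℝ) < Fintype.card H := by exact_mod_cast Fintype.card_pos
  set p : X →ₗ[ℂ] V := ι.toLinearMap with hp
  set q : X →ₗ[ℂ] W := κ.toLinearMap with hq
  have hpn : ∀ x, ‖p x‖ = ‖x‖ := ι.norm_map
  have hqn : ∀ x, ‖q x‖ = ‖x‖ := κ.norm_map
  have hpp : LinearMap.adjoint p ∘ₗ p = LinearMap.id := adjoint_comp_self_of_isometry p hpn
  have hpa : ∀ v, ‖LinearMap.adjoint p v‖ ≤ ‖v‖ := norm_adjoint_apply_le p fun x => (hpn x).le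
  let S : H → V →ₗ[ℂ] W := fun h =>
    unitaryOp (σ h) ∘ₗ q ∘ₗ LinearMap.adjoint p ∘ₗ unitaryOp (π h⁻¹)
  have hS : ∀ h v, S h v = σ h (q (LinearMap.adjoint p (π h⁻¹ v))) := fun h v => rfl
  have hSn : ∀ h v, ‖S h v‖ ≤ ‖v‖ := fun h v => by
    rw [hS, LinearIsometryEquiv.norm_map, hqn]
    exact (hpa _).trans (by rw [LinearIsometryEquiv.norm_map])
  -- Averaging the partial isometry `q p*` over `H` gives a contractive intertwiner, which still
  -- almost carries `p` to `q` because both embeddings almost intertwine `φ`.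
  let T : V →ₗ[ℂ] W := (Fintype.card H : ℂ)⁻¹ • ∑ h, S h
  have hT : ∀ v, T v = (Fintype.card H : ℂ)⁻¹ • ∑ h, S h v := fun v => by
    simp only [T, LinearMap.smul_apply, LinearMap.sum_apply]
  have hTn : ∀ v, ‖T v‖ ≤ ‖v‖ := fun v => by
    rw [hT, norm_smul, norm_inv, Complex.norm_natCast, inv_mul_le_iff₀ hH']
    refine (norm_sum_le _ _).trans ((Finset.sum_le_sum fun h _ => hSn h v).trans ?_)
    simp
  have hTeq : ∀ a v, T (π a v) = σ a (T v) := fun a v => by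
    rw [hT, hT, map_smul, map_sum]
    congr 1
    rw [← Equiv.sum_comp (Equiv.mulLeft a) fun h => S h (π a v)]
    refine Finset.sum_congr rfl fun h _ => ?_
    rw [Equiv.coe_mulLeft, hS, hS, unitaryRep_mul_apply, ← unitaryRep_mul_apply π]
    simp
  have hSq : ∀ h, hsN (S h ∘ₗ p - q) ≤ 2 * ε := fun h => by
    have e1 : S h ∘ₗ p - q
        = (unitaryOp (σ h) ∘ₗ q ∘ₗ LinearMap.adjoint p) ∘ₗ (unitaryOp (π h⁻¹) ∘ₗ p - p ∘ₗ φ h⁻¹)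
          - unitaryOp (σ h) ∘ₗ (unitaryOp (σ h⁻¹) ∘ₗ q - q ∘ₗ φ h⁻¹) := by
      refine LinearMap.ext fun x => ?_
      have e2 : LinearMap.adjoint p (p (φ h⁻¹ x)) = φ h⁻¹ x := LinearMap.congr_fun hpp _
      have e3 : σ h (σ h⁻¹ (q x)) = q x := by
        rw [← unitaryRep_mul_apply, mul_inv_cancel, map_one]
        rfl
      simp only [LinearMap.sub_apply, LinearMap.comp_apply, unitaryOp_apply, hS, map_sub, e2, e3]
      abel
    rw [e1, two_mul]
    refine (hsN_sub_le _ _).trans (add_le_add ?_ ?_)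
    · refine (hsN_comp_le_left _ (fun v => ?_) _).trans (h1 h⁻¹)
      change ‖σ h (q (LinearMap.adjoint p v))‖ ≤ _
      rw [LinearIsometryEquiv.norm_map, hqn]
      exact hpa v
    · exact (hsN_comp_le_left _ (fun v => ((σ h).norm_map v).le) _).trans (h2 h⁻¹)
  have hTq : hsN (T ∘ₗ p - q) ≤ 2 * ε := by
    have e1 : T ∘ₗ p - q = (Fintype.card H : ℂ)⁻¹ • ∑ h, (S h ∘ₗ p - q) := by
      rw [Finset.sum_sub_distrib, Finset.sum_const, Finset.card_univ, ← Nat.cast_smul_eq_nsmul ℂ,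
        smul_sub, inv_smul_smul₀ hH]
      congr 1
      refine LinearMap.ext fun x => ?_
      simp [hT, LinearMap.sum_apply]
    rw [e1, hsN_smul, norm_inv, Complex.norm_natCast, inv_mul_le_iff₀ hH']
    refine (hsN_sum_le _ _).trans ((Finset.sum_le_sum fun h _ => hSq h).trans ?_)
    simp
  obtain ⟨U, hU, hUT⟩ := exists_unitary_intertwiner_near π σ hχ T hTeq hTn
  have hfin : Module.finrank ℂ V = Module.finrank ℂ W := by
    have h3 := congrFun hχ 1
    rw [uchar_one, uchar_one] at h3
    exact_mod_cast h3
  refine ⟨U.toLinearIsometryEquiv hfin, fun h v => hU h v, ?_⟩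
  have hUe : (U.toLinearIsometryEquiv hfin).toLinearIsometry.toLinearMap = U.toLinearMap := rfl
  have hqd : hsN q = √(Module.finrank ℂ X) := by
    rw [← hsN_sq_of_isometry q hqn, Real.sqrt_sq (hsN_nonneg _)]
  have hTd : √(Module.finrank ℂ X) ≤ hsN T + 2 * ε := by
    rw [← hqd]
    have h3 := hsN_sub_le (T ∘ₗ p) (T ∘ₗ p - q)
    rw [sub_sub_cancel] at h3
    exact h3.trans (add_le_add (hsN_comp_le_right T p fun x => (hpn x).le) hTq)
  -- Completing the square avoids assuming that `2 * ε` is smaller than the root of the dimension.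
  have hT2 : (Module.finrank ℂ X : ℝ) ≤ hsN T ^ 2 + 4 * √(Module.finrank ℂ X) * ε := by
    have h3 := Real.sq_sqrt (Nat.cast_nonneg (Module.finrank ℂ X) : (0 : ℝ) ≤ _)
    have h4 := Real.sqrt_nonneg (Module.finrank ℂ X : ℝ)
    have h5 := hsN_nonneg T
    nlinarith [sq_nonneg (√(Module.finrank ℂ X : ℝ) - hsN T)]
  rw [hUe]
  have e1 : U.toLinearMap ∘ₗ p - q = (U.toLinearMap - T) ∘ₗ p + (T ∘ₗ p - q) := by
    rw [LinearMap.sub_comp]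
    abel
  rw [e1]
  refine (hsN_add_le _ _).trans (add_le_add ?_ hTq)
  refine (hsN_comp_le_right _ p fun x => (hpn x).le).trans (Real.le_sqrt_of_sq_le ?_)
  linarith

end UnitaryEnlarge

/-! ### Calculus of almost intertwining isometries -/

section HSDefect

set_option linter.unusedSectionVars false

variable {X Y Z V W : Type*} [NormedAddCommGroup V] [InnerProductSpace ℂ V]
  [FiniteDimensional ℂ V] [NormedAddCommGroup W] [InnerProductSpace ℂ W] [FiniteDimensional ℂ W]
  [NormedAddCommGroup X] [InnerProductSpace ℂ X] [FiniteDimensional ℂ X]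
  [NormedAddCommGroup Y] [InnerProductSpace ℂ Y] [FiniteDimensional ℂ Y]
  [NormedAddCommGroup Z] [InnerProductSpace ℂ Z] [FiniteDimensional ℂ Z]

/-- The Hilbert–Schmidt distance of an isometry `ι` from intertwining `U` with `B`. -/
noncomputable def hsDefect (B : Y ≃ₗᵢ[ℂ] Y) (ι : X →ₗᵢ[ℂ] Y) (U : X ≃ₗᵢ[ℂ] X) : ℝ :=
  hsN (unitaryOp B ∘ₗ ι.toLinearMap - ι.toLinearMap ∘ₗ unitaryOp U)

theorem hsDefect_nonneg (B : Y ≃ₗᵢ[ℂ] Y) (ι : X →ₗᵢ[ℂ] Y) (U : X ≃ₗᵢ[ℂ] X) :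
    0 ≤ hsDefect B ι U := hsN_nonneg _

/-- Telescoping through `B ι U'`; composition with contractions does not increase the norm. This
spreads closeness from the two factors to all of the amalgam. -/
theorem hsDefect_mul_le (B B' : Y ≃ₗᵢ[ℂ] Y) (ι : X →ₗᵢ[ℂ] Y) (U U' U'' : X ≃ₗᵢ[ℂ] X) :
    hsDefect (B * B') ι U''
      ≤ hsDefect B ι U + hsDefect B' ι U' + hsN (unitaryOp (U * U') - unitaryOp U'') := by
  have e : unitaryOp (B * B') ∘ₗ ι.toLinearMap - ι.toLinearMap ∘ₗ unitaryOp U''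
      = (unitaryOp B ∘ₗ ι.toLinearMap - ι.toLinearMap ∘ₗ unitaryOp U) ∘ₗ unitaryOp U'
        + unitaryOp B ∘ₗ (unitaryOp B' ∘ₗ ι.toLinearMap - ι.toLinearMap ∘ₗ unitaryOp U')
        + ι.toLinearMap ∘ₗ (unitaryOp (U * U') - unitaryOp U'') := by
    refine LinearMap.ext fun x => ?_
    have e1 : ∀ x, (U * U') x = U (U' x) := fun x => rfl
    have e2 : ∀ x, (B * B') x = B (B' x) := fun x => rfl
    simp only [LinearMap.sub_apply, LinearMap.comp_apply, LinearMap.add_apply, unitaryOp_apply,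
      map_sub, e1, e2]
    abel
  rw [hsDefect, e]
  refine (hsN_add_le _ _).trans (add_le_add ((hsN_add_le _ _).trans (add_le_add ?_ ?_)) ?_)
  · exact hsN_comp_le_right _ _ fun x => (U'.norm_map x).le
  · exact hsN_comp_le_left _ (fun x => (B.norm_map x).le) _
  · exact hsN_comp_le_left _ (fun x => (ι.norm_map x).le) _

theorem hsDefect_comp_le (C : Z ≃ₗᵢ[ℂ] Z) (κ : Y →ₗᵢ[ℂ] Z) (B : Y ≃ₗᵢ[ℂ] Y) (ι : X →ₗᵢ[ℂ] Y)
    (U : X ≃ₗᵢ[ℂ] X) : hsDefect C (κ.comp ι) U ≤ hsDefect C κ B + hsDefect B ι U := by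
  have e : unitaryOp C ∘ₗ (κ.comp ι).toLinearMap - (κ.comp ι).toLinearMap ∘ₗ unitaryOp U
      = (unitaryOp C ∘ₗ κ.toLinearMap - κ.toLinearMap ∘ₗ unitaryOp B) ∘ₗ ι.toLinearMap
        + κ.toLinearMap ∘ₗ (unitaryOp B ∘ₗ ι.toLinearMap - ι.toLinearMap ∘ₗ unitaryOp U) := by
    refine LinearMap.ext fun x => ?_
    simp
  rw [hsDefect, e]
  refine (hsN_add_le _ _).trans (add_le_add ?_ ?_)
  · exact hsN_comp_le_right _ _ fun x => (ι.norm_map x).le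
  · exact hsN_comp_le_left _ (fun x => (κ.norm_map x).le) _

/-- Conjugation by a unitary. -/
def unitaryConj (e : V ≃ₗᵢ[ℂ] W) : (V ≃ₗᵢ[ℂ] V) →* (W ≃ₗᵢ[ℂ] W) where
  toFun u := e.symm.trans (u.trans e)
  map_one' := by
    ext w
    simp
  map_mul' a b := by
    ext w
    simp

theorem unitaryConj_apply (e : V ≃ₗᵢ[ℂ] W) (u : V ≃ₗᵢ[ℂ] V) (w : W) :
    unitaryConj e u w = e (u (e.symm w)) := rfl

theorem hsDefect_conj_le (e : V ≃ₗᵢ[ℂ] W) (u : V ≃ₗᵢ[ℂ] V) (ι : X →ₗᵢ[ℂ] V) (κ : X →ₗᵢ[ℂ] W)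
    (U : X ≃ₗᵢ[ℂ] X) : hsDefect (unitaryConj e u) κ U ≤ hsDefect u ι U
      + 2 * hsN (e.toLinearIsometry.toLinearMap ∘ₗ ι.toLinearMap - κ.toLinearMap) := by
  set E : V →ₗ[ℂ] W := e.toLinearIsometry.toLinearMap with hE
  have hEa : ∀ v, E v = e v := fun v => rfl
  have h : unitaryOp (unitaryConj e u) ∘ₗ κ.toLinearMap - κ.toLinearMap ∘ₗ unitaryOp U
      = E ∘ₗ (unitaryOp u ∘ₗ ι.toLinearMap - ι.toLinearMap ∘ₗ unitaryOp U)
        + ((E ∘ₗ ι.toLinearMap - κ.toLinearMap) ∘ₗ unitaryOp U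
          - unitaryOp (unitaryConj e u) ∘ₗ (E ∘ₗ ι.toLinearMap - κ.toLinearMap)) := by
    refine LinearMap.ext fun x => ?_
    simp only [LinearMap.sub_apply, LinearMap.comp_apply, LinearMap.add_apply, unitaryOp_apply,
      map_sub, unitaryConj_apply, hEa, e.symm_apply_apply]
    abel
  rw [hsDefect, h, two_mul]
  refine (hsN_add_le _ _).trans (add_le_add ?_ ((hsN_sub_le _ _).trans (add_le_add ?_ ?_)))
  · exact hsN_comp_le_left _ (fun x => (e.norm_map x).le) _
  · exact hsN_comp_le_right _ _ fun x => (U.norm_map x).le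
  · exact hsN_comp_le_left _ (fun x => ((unitaryConj e u).norm_map x).le) _

theorem hsNorm_sub_compression_le (B : Y ≃ₗᵢ[ℂ] Y) (ι : X →ₗᵢ[ℂ] Y) (U : X ≃ₗᵢ[ℂ] X) :
    hsNorm (unitaryOp U - compression ι (unitaryOp B))
      ≤ hsDefect B ι U / √(Module.finrank ℂ X) := by
  rw [hsNorm_eq]
  gcongr
  have hjj := adjoint_comp_self_of_isometry ι.toLinearMap ι.norm_map
  have e : unitaryOp U - compression ι (unitaryOp B) = LinearMap.adjoint ι.toLinearMap ∘ₗ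
      (ι.toLinearMap ∘ₗ unitaryOp U - unitaryOp B ∘ₗ ι.toLinearMap) := by
    rw [LinearMap.comp_sub, ← LinearMap.comp_assoc, hjj, LinearMap.id_comp]
    rfl
  rw [e, hsDefect, hsN_sub_comm]
  exact hsN_comp_le_left _ (norm_adjoint_apply_le _ fun x => (ι.norm_map x).le) _

/-- With `hsNorm_sub_compression_le`, this makes closeness of compressions and almost intertwining
equivalent in the limit, at the price of a square root. Unlike compressions, the defect behaves well
under products. -/
theorem hsDefect_div_le [Nontrivial X] (B : Y ≃ₗᵢ[ℂ] Y) (ι : X →ₗᵢ[ℂ] Y) (U : X ≃ₗᵢ[ℂ] X) :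
    hsDefect B ι U / √(Module.finrank ℂ X)
      ≤ √(2 * hsNorm (unitaryOp U - compression ι (unitaryOp B))) := by
  have hd : (0 : ℝ) < Module.finrank ℂ X := by exact_mod_cast Module.finrank_pos
  have hs := Real.sqrt_pos.2 hd
  refine Real.le_sqrt_of_sq_le ?_
  rw [hsNorm_eq, div_pow, Real.sq_sqrt hd.le, div_le_iff₀ hd]
  refine (hsN_intertwine_sq_le ι.toLinearMap ι.norm_map (unitaryOp U) U.norm_map (unitaryOp B)
    B.norm_map).trans (le_of_eq ?_)
  rw [compression]
  nth_rw 3 [← Real.sq_sqrt hd.le]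
  field_simp

end HSDefect

/-! ### Hilbert–Schmidt stability for the amalgam -/

section HSMain

variable {H G : Type*} [Group H] [Group G]

/-- The submonoid of the dimensions of the representations of a given kind. -/
def unitarySizes (i : H →* G) (c : H → ℂ) : AddSubmonoid ℕ where
  carrier := {n | ∃ χ : G → ℂ, IsUChar χ ∧ χ 1 = n ∧ ∀ h, χ (i h) = n * c h}
  zero_mem' := ⟨0, isUChar_zero, by simp, by simp⟩
  add_mem' := by
    rintro a b ⟨χ, h1, h2, h3⟩ ⟨χ', h1', h2', h3'⟩
    refine ⟨χ + χ', h1.add h1', ?_, fun h => ?_⟩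
    · rw [Pi.add_apply, h2, h2']
      push_cast
      rfl
    · rw [Pi.add_apply, h3, h3']
      push_cast
      ring

theorem smul_mem_virtualChars (i : H →* G) (c : H → ℂ) {n : ℕ} (hn : n ∈ unitarySizes i c) :
    (n : ℝ) • c ∈ virtualChars H := by
  obtain ⟨χ, h1, -, h3⟩ := hn
  have h := (h1.comp i).mem_virtualChars
  convert h using 1
  funext a
  rw [h3]
  simp

/-- `norm_trace_sub_trace_le` divided by the dimension. It makes the characters of both factors over
`H` asymptotically equal. -/
theorem norm_sub_trace_tendsto {X Y : ℕ → Type*} [∀ n, NormedAddCommGroup (X n)]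
    [∀ n, InnerProductSpace ℂ (X n)] [∀ n, FiniteDimensional ℂ (X n)] [∀ n, Nontrivial (X n)]
    [∀ n, NormedAddCommGroup (Y n)] [∀ n, InnerProductSpace ℂ (Y n)]
    [∀ n, FiniteDimensional ℂ (Y n)] (ι : ∀ n, X n →ₗᵢ[ℂ] Y n) (U : ∀ n, X n ≃ₗᵢ[ℂ] X n)
    (B : ∀ n, Y n ≃ₗᵢ[ℂ] Y n)
    (h : Tendsto (fun n => hsDefect (B n) (ι n) (U n) / √(Module.finrank ℂ (X n))) atTop (𝓝 0))
    (hr : Tendsto (fun n => (Module.finrank ℂ (Y n) : ℝ) / Module.finrank ℂ (X n)) atTop (𝓝 1)) :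
    Tendsto (fun n => ‖LinearMap.trace ℂ _ (unitaryOp (B n)) - LinearMap.trace ℂ _ (unitaryOp (U n))‖
      / Module.finrank ℂ (X n)) atTop (𝓝 0) := by
  have hb := (hr.sqrt.mul (hr.sub_const 1).sqrt).add h
  simp only [sub_self, Real.sqrt_zero, mul_zero, add_zero] at hb
  refine squeeze_zero (fun n => by positivity) (fun n => ?_) hb
  have hd : (0 : ℝ) < Module.finrank ℂ (X n) := by exact_mod_cast Module.finrank_pos
  have hs := Real.sqrt_pos.2 hd
  refine (div_le_div_of_nonneg_right (norm_trace_sub_trace_le (ι n) (U n) (B n)) hd.le).trans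
    (le_of_eq ?_)
  rw [div_sub_one hd.ne', Real.sqrt_div (Nat.cast_nonneg _),
    Real.sqrt_div' _ hd.le, add_div, hsDefect]
  congr 1
  · rw [div_mul_div_comm, Real.mul_self_sqrt hd.le]
  · nth_rw 2 [← Real.mul_self_sqrt hd.le]
    rw [mul_div_mul_left _ _ hs.ne']

end HSMain

theorem IsFlexiblyHSStable.amalgamatedProduct {H G₁ G₂ : Type*} [Group H] [Group G₁] [Group G₂]
    [Finite H] (i₁ : H →* G₁) (i₂ : H →* G₂) (hn₁ : IsAlmostNormal i₁.range)
    (hn₂ : IsAlmostNormal i₂.range) (hG₁ : IsFlexiblyHSStable G₁) (hG₂ : IsFlexiblyHSStable G₂) :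
    IsFlexiblyHSStable (AmalgamatedProduct i₁ i₂) := by
  classical
  have := Fintype.ofFinite H
  have : Finite i₁.range := Finite.of_surjective _ i₁.rangeRestrict_surjective
  have : Finite i₂.range := Finite.of_surjective _ i₂.rangeRestrict_surjective
  obtain ⟨F₁, hF₁n, hF₁f, hF₁⟩ := hn₁.exists_finite_normal
  obtain ⟨F₂, hF₂n, hF₂f, hF₂⟩ := hn₂.exists_finite_normal
  obtain ⟨k₁, c₁, hc₁⟩ := exists_unitary_rays i₁ F₁ fun h => hF₁ ⟨h, rfl⟩
  obtain ⟨k₂, c₂, hc₂⟩ := exists_unitary_rays i₂ F₂ fun h => hF₂ ⟨h, rfl⟩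
  intro X _ _ _ _ φ hφ
  obtain ⟨Y₁, _, _, _, ι₁, ψ₁, hψ₁, hr₁⟩ := hG₁ X (fun n g => φ n (amalgInl i₁ i₂ g)) fun a b => by
    simpa using hφ (amalgInl i₁ i₂ a) (amalgInl i₁ i₂ b)
  obtain ⟨Y₂, _, _, _, ι₂, ψ₂, hψ₂, hr₂⟩ := hG₂ X (fun n g => φ n (amalgInr i₁ i₂ g)) fun a b => by
    simpa using hφ (amalgInr i₁ i₂ a) (amalgInr i₁ i₂ b)
  have hx : ∀ n, (0 : ℝ) < Module.finrank ℂ (X n) := fun n => by exact_mod_cast Module.finrank_pos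
  have hsx : ∀ n, 0 < √(Module.finrank ℂ (X n) : ℝ) := fun n => Real.sqrt_pos.2 (hx n)
  choose N₁ hinv₁ horth₁ hint₁ hN₁ using fun n => hc₁ (Y₁ n) (ψ₁ n)
  choose N₂ hinv₂ horth₂ hint₂ hN₂ using fun n => hc₂ (Y₂ n) (ψ₂ n)
  set u : ℕ → Fin k₁ → ℕ := fun n r => Module.finrank ℂ (N₁ n r) with hu
  set v : ℕ → Fin k₂ → ℕ := fun n r => Module.finrank ℂ (N₂ n r) with hv
  have hdef₁ : ∀ g, Tendsto (fun n => hsDefect (ψ₁ n g) (ι₁ n) (φ n (amalgInl i₁ i₂ g))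
      / √(Module.finrank ℂ (X n))) atTop (𝓝 0) := fun g => by
    have hb := ((hψ₁ g).const_mul 2).sqrt
    rw [mul_zero, Real.sqrt_zero] at hb
    exact squeeze_zero (fun n => div_nonneg (hsDefect_nonneg _ _ _) (Real.sqrt_nonneg _))
      (fun n => hsDefect_div_le _ _ _) hb
  have hdef₂ : ∀ g, Tendsto (fun n => hsDefect (ψ₂ n g) (ι₂ n) (φ n (amalgInr i₁ i₂ g))
      / √(Module.finrank ℂ (X n))) atTop (𝓝 0) := fun g => by
    have hb := ((hψ₂ g).const_mul 2).sqrt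
    rw [mul_zero, Real.sqrt_zero] at hb
    exact squeeze_zero (fun n => div_nonneg (hsDefect_nonneg _ _ _) (Real.sqrt_nonneg _))
      (fun n => hsDefect_div_le _ _ _) hb
  have huv : Tendsto (fun n => ‖∑ r, (u n r : ℝ) • c₁ r - ∑ r, (v n r : ℝ) • c₂ r‖
      / (Module.finrank ℂ (X n) : ℝ)) atTop (𝓝 0) := by
    have hb := tendsto_finsetSum Finset.univ fun (h : H) _ =>
      (norm_sub_trace_tendsto ι₁ _ _ (hdef₁ (i₁ h)) hr₁).add
        (norm_sub_trace_tendsto ι₂ _ _ (hdef₂ (i₂ h)) hr₂)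
    simp only [add_zero, Finset.sum_const_zero, ← add_div, ← Finset.sum_div] at hb
    refine squeeze_zero (fun n => by positivity) (fun n => ?_) hb
    gcongr
    refine (pi_norm_le_iff_of_nonneg (Finset.sum_nonneg fun h _ => by positivity)).2 fun h => ?_
    refine le_trans ?_ (Finset.single_le_sum (fun h _ => by positivity) (Finset.mem_univ h))
    have e1 : (∑ r, (u n r : ℝ) • c₁ r - ∑ r, (v n r : ℝ) • c₂ r) h
        = uchar (ψ₁ n) (i₁ h) - uchar (ψ₂ n) (i₂ h) := by
      rw [uchar_eq_sum_subRep (hint₁ n) (ψ₁ n) (hinv₁ n),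
        uchar_eq_sum_subRep (hint₂ n) (ψ₂ n) (hinv₂ n)]
      simp [hN₁, hN₂, hu, hv]
    rw [e1, amalgInl_eq_amalgInr]
    simp only [← dist_eq_norm]
    exact dist_triangle_right _ _ _
  have hu2 : ∀ᶠ n in atTop, ∀ r, (u n r : ℝ) ≤ 2 * Module.finrank ℂ (X n) := by
    filter_upwards [hr₁.eventually (gt_mem_nhds one_lt_two)] with n hn r
    rw [div_lt_iff₀ (hx n)] at hn
    refine le_trans ?_ hn.le
    exact_mod_cast Submodule.finrank_le _
  have hv2 : ∀ᶠ n in atTop, ∀ r, (v n r : ℝ) ≤ 2 * Module.finrank ℂ (X n) := by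
    filter_upwards [hr₂.eventually (gt_mem_nhds one_lt_two)] with n hn r
    rw [div_lt_iff₀ (hx n)] at hn
    refine le_trans ?_ hn.le
    exact_mod_cast Submodule.finrank_le _
  obtain ⟨J₁, J₂, α, β, hα, hβ, hrel, hJ₁, hJ₂, hαx, hβx⟩ := exists_seq_balance c₁ c₂
    (fun r => unitarySizes i₁ (c₁ r)) (fun r => unitarySizes i₂ (c₂ r)) (virtualChars H) one_pos
    (fun l => eq_zero_of_mem_virtualChars) (fun r n hn => smul_mem_virtualChars i₁ _ hn)
    (fun r n hn => smul_mem_virtualChars i₂ _ hn) _ hx u v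
    (fun n r => ⟨_, ⟨N₁ n r, inferInstance, inferInstance, inferInstance,
      subRep (ψ₁ n) _ (hinv₁ n r), rfl⟩, uchar_one _, hN₁ n r⟩)
    (fun n r => ⟨_, ⟨N₂ n r, inferInstance, inferInstance, inferInstance,
      subRep (ψ₂ n) _ (hinv₂ n r), rfl⟩, uchar_one _, hN₂ n r⟩) hu2 hv2 huv
  choose χ₁ hχ₁ hχ₁1 hχ₁i using hα
  choose χ₂ hχ₂ hχ₂1 hχ₂i using hβ
  -- As many trivial dimensions are added on each side as were made trivial on the other, so only
  -- the relation `hrel` is needed for equality of the characters.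
  choose Y₁' hY₁a hY₁b hY₁c V₁ ψ₁' htype₁ hrank₁ hag₁ using fun n =>
    exists_unitary_enlarge i₁ c₁ (ψ₁ n) (N₁ n) (hinv₁ n) (horth₁ n) (hint₁ n) (hN₁ n) (J₁ n)
      ((IsUChar.sum Finset.univ fun r _ => hχ₁ n r).add (isUChar_const (∑ r ∈ (J₂ n)ᶜ, v n r)))
  choose Y₂' hY₂a hY₂b hY₂c V₂ ψ₂' htype₂ hrank₂ hag₂ using fun n =>
    exists_unitary_enlarge i₂ c₂ (ψ₂ n) (N₂ n) (hinv₂ n) (horth₂ n) (hint₂ n) (hN₂ n) (J₂ n)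
      ((IsUChar.sum Finset.univ fun r _ => hχ₂ n r).add (isUChar_const (∑ r ∈ (J₁ n)ᶜ, u n r)))
  have htype : ∀ n, uchar ((ψ₁' n).comp i₁) = uchar ((ψ₂' n).comp i₂) := fun n => by
    funext h
    have e1 : uchar ((ψ₁' n).comp i₁) h = uchar (ψ₁' n) (i₁ h) := rfl
    have e2 : uchar ((ψ₂' n).comp i₂) h = uchar (ψ₂' n) (i₂ h) := rfl
    have e3 := congrFun (hrel n) h
    simp only [Pi.add_apply, Finset.sum_apply, Pi.smul_apply, Complex.real_smul,
      Complex.ofReal_natCast] at e3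
    rw [e1, e2, htype₁, htype₂]
    simp only [Pi.add_apply, Finset.sum_apply, hχ₁i, hχ₂i]
    linear_combination e3
  have hD₁ : ∀ n, (Module.finrank ℂ (Y₁' n) : ℝ)
      = Module.finrank ℂ (Y₁ n) + ∑ r, (α n r : ℝ) + ∑ r ∈ (J₂ n)ᶜ, (v n r : ℝ) := fun n => by
    have h := hrank₁ n
    simp only [Pi.add_apply, Finset.sum_apply, hχ₁1] at h
    rw [add_assoc]
    exact_mod_cast h
  have hD₂ : ∀ n, (Module.finrank ℂ (Y₂' n) : ℝ)
      = Module.finrank ℂ (Y₂ n) + ∑ r, (β n r : ℝ) + ∑ r ∈ (J₁ n)ᶜ, (u n r : ℝ) := fun n => by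
    have h := hrank₂ n
    simp only [Pi.add_apply, Finset.sum_apply, hχ₂1] at h
    rw [add_assoc]
    exact_mod_cast h
  have hr₁' : Tendsto (fun n => (Module.finrank ℂ (Y₁' n) : ℝ) / Module.finrank ℂ (X n))
      atTop (𝓝 1) := by
    simpa [hD₁, add_div] using (hr₁.add hαx).add hJ₂
  have hr₂' : Tendsto (fun n => (Module.finrank ℂ (Y₂' n) : ℝ) / Module.finrank ℂ (X n))
      atTop (𝓝 1) := by
    simpa [hD₂, add_div] using (hr₂.add hβx).add hJ₁
  have hdef₁' : ∀ g, Tendsto (fun n => hsDefect (ψ₁' n g) ((V₁ n).comp (ι₁ n))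
      (φ n (amalgInl i₁ i₂ g)) / √(Module.finrank ℂ (X n))) atTop (𝓝 0) := fun g => by
    have hb := ((hJ₁.const_mul 4).sqrt).add (hdef₁ g)
    rw [mul_zero, Real.sqrt_zero, zero_add] at hb
    refine squeeze_zero (fun n => div_nonneg (hsDefect_nonneg _ _ _) (Real.sqrt_nonneg _))
      (fun n => ?_) hb
    rw [mul_div_assoc', Real.sqrt_div' _ (hx n).le, ← add_div]
    gcongr
    exact (hsDefect_comp_le _ _ (ψ₁ n g) _ _).trans
      (by gcongr; exact Real.le_sqrt_of_sq_le (hag₁ n g))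
  have hdef₂' : ∀ g, Tendsto (fun n => hsDefect (ψ₂' n g) ((V₂ n).comp (ι₂ n))
      (φ n (amalgInr i₁ i₂ g)) / √(Module.finrank ℂ (X n))) atTop (𝓝 0) := fun g => by
    have hb := ((hJ₂.const_mul 4).sqrt).add (hdef₂ g)
    rw [mul_zero, Real.sqrt_zero, zero_add] at hb
    refine squeeze_zero (fun n => div_nonneg (hsDefect_nonneg _ _ _) (Real.sqrt_nonneg _))
      (fun n => ?_) hb
    rw [mul_div_assoc', Real.sqrt_div' _ (hx n).le, ← add_div]
    gcongr
    exact (hsDefect_comp_le _ _ (ψ₂ n g) _ _).trans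
      (by gcongr; exact Real.le_sqrt_of_sq_le (hag₂ n g))
  -- Summing over the finite group gives one bound valid for all `h` and both sides, still of lower
  -- order than the root of the dimension.
  set ε : ℕ → ℝ := fun n => ∑ h, (hsDefect (ψ₁' n (i₁ h)) ((V₁ n).comp (ι₁ n))
      (φ n (amalgInl i₁ i₂ (i₁ h))) + hsDefect (ψ₂' n (i₂ h)) ((V₂ n).comp (ι₂ n))
      (φ n (amalgInr i₁ i₂ (i₂ h)))) with hεdef
  have hε : Tendsto (fun n => ε n / √(Module.finrank ℂ (X n))) atTop (𝓝 0) := by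
    have hb := tendsto_finsetSum Finset.univ fun (h : H) _ =>
      (hdef₁' (i₁ h)).add (hdef₂' (i₂ h))
    simpa only [add_zero, Finset.sum_const_zero, ← add_div, ← Finset.sum_div] using hb
  have hle : ∀ n h, hsDefect (ψ₁' n (i₁ h)) ((V₁ n).comp (ι₁ n))
      (φ n (amalgInl i₁ i₂ (i₁ h))) + hsDefect (ψ₂' n (i₂ h)) ((V₂ n).comp (ι₂ n))
      (φ n (amalgInr i₁ i₂ (i₂ h))) ≤ ε n := fun n h =>
    Finset.single_le_sum (f := fun h => hsDefect (ψ₁' n (i₁ h)) ((V₁ n).comp (ι₁ n))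
      (φ n (amalgInl i₁ i₂ (i₁ h))) + hsDefect (ψ₂' n (i₂ h)) ((V₂ n).comp (ι₂ n))
      (φ n (amalgInr i₁ i₂ (i₂ h))))
      (fun h _ => add_nonneg (hsDefect_nonneg _ _ _) (hsDefect_nonneg _ _ _)) (Finset.mem_univ h)
  choose e he henear using fun n =>
    exists_unitary_matching ((V₁ n).comp (ι₁ n)) ((V₂ n).comp (ι₂ n)) _ _ (htype n)
      (fun h => unitaryOp (φ n (amalgInl i₁ i₂ (i₁ h)))) (ε := ε n)
      (fun h => (le_add_of_nonneg_right (hsDefect_nonneg _ _ _)).trans (hle n h))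
      (fun h => by
        have h1 := (le_add_of_nonneg_left (hsDefect_nonneg _ _ _)).trans (hle n h)
        rw [amalgInl_eq_amalgInr]
        exact h1)
  have hnear : Tendsto (fun n => hsN ((e n).toLinearIsometry.toLinearMap ∘ₗ
      ((V₁ n).comp (ι₁ n)).toLinearMap - ((V₂ n).comp (ι₂ n)).toLinearMap)
      / √(Module.finrank ℂ (X n))) atTop (𝓝 0) := by
    have hb := ((hr₁'.sub_const 1).add (hε.const_mul 4)).sqrt.add (hε.const_mul 2)
    simp only [sub_self, mul_zero, add_zero, Real.sqrt_zero] at hb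
    refine squeeze_zero (fun n => div_nonneg (hsN_nonneg _) (Real.sqrt_nonneg _)) (fun n => ?_) hb
    refine (div_le_div_of_nonneg_right (henear n) (hsx n).le).trans (le_of_eq ?_)
    rw [add_div, mul_div_assoc, ← Real.sqrt_div' _ (hx n).le, add_div, sub_div,
      div_self (hx n).ne']
    congr 4
    nth_rw 2 [← Real.mul_self_sqrt (hx n).le]
    have := (hsx n).ne'
    field_simp
  choose Ψ hΨl hΨr using fun n => exists_amalgLift (i₁ := i₁) (i₂ := i₂)
    ((unitaryConj (e n)).comp (ψ₁' n)) (ψ₂' n) fun h => by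
      ext y
      have := he n h ((e n).symm y)
      rw [(e n).apply_symm_apply] at this
      exact this
  have hΨ : ∀ a, Tendsto (fun n => hsDefect (Ψ n a) ((V₂ n).comp (ι₂ n)) (φ n a)
      / √(Module.finrank ℂ (X n))) atTop (𝓝 0) := by
    intro a
    induction a using amalg_induction with
    | hl g =>
      have hb := (hdef₁' g).add (hnear.const_mul 2)
      rw [mul_zero, add_zero] at hb
      refine squeeze_zero (fun n => div_nonneg (hsDefect_nonneg _ _ _) (Real.sqrt_nonneg _))
        (fun n => ?_) hb
      rw [mul_div_assoc', ← add_div, hΨl]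
      gcongr
      exact hsDefect_conj_le _ _ _ _ _
    | hr g => simpa only [hΨr] using hdef₂' g
    | hm a b ha hb =>
      have hbd := (ha.add hb).add (hφ a b)
      simp only [add_zero, hsNorm_eq, ← add_div] at hbd
      refine squeeze_zero (fun n => div_nonneg (hsDefect_nonneg _ _ _) (Real.sqrt_nonneg _))
        (fun n => ?_) hbd
      rw [map_mul]
      gcongr
      exact hsDefect_mul_le _ _ _ _ _ _
  refine ⟨Y₂', hY₂a, hY₂b, hY₂c, fun n => (V₂ n).comp (ι₂ n), Ψ, fun a => ?_, hr₂'⟩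
  exact squeeze_zero (fun n => Real.sqrt_nonneg _) (fun n => hsNorm_sub_compression_le _ _ _) (hΨ a)

theorem mainTheorem6 {H G₁ G₂ : Type*} [Group H] [Group G₁] [Group G₂]
    [Finite H] [Group.FG G₁] [Group.FG G₂]
    (i₁ : H →* G₁) (i₂ : H →* G₂)
    (hi₁ : Function.Injective i₁) (hi₂ : Function.Injective i₂)
    (hn₁ : IsAlmostNormal i₁.range) (hn₂ : IsAlmostNormal i₂.range) :
    (IsFlexiblyHSStable G₁ → IsFlexiblyHSStable G₂ →
      IsFlexiblyHSStable (AmalgamatedProduct i₁ i₂)) ∧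
    (IsFlexiblyPStable G₁ → IsFlexiblyPStable G₂ →
      IsFlexiblyPStable (AmalgamatedProduct i₁ i₂)) := by
  exact ⟨IsFlexiblyHSStable.amalgamatedProduct i₁ i₂ hn₁ hn₂,
    IsFlexiblyPStable.amalgamatedProduct i₁ i₂ hn₁ hn₂⟩
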